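/- Let $k$ be an algebraically closed field of characteristic zero, let $G$ be a finite group, and let $1\to\mathbb G_m\to\tilde G\to G\to 1$ be a central extension. Let $V$ be a faithful $6$-dimensional representation of $\tilde G$ on which the central $\mathbb G_m$ acts by scalars (through an algebraic character), and suppose that the induced action of $G$ on $\mathbb P(V)$ is generically free. Let $A$ be a $5$-dimensional vector space and let $f:A\to\wedge^2(V^\vee)$ be an injective linear map which is regular, i.e. $\mathrm{rk}(f(a))\ge 4$ for all nonzero $a\in A$. Suppose that the subspace $f(A)\subset\wedge^2(V^\vee)$ is $\tilde G$-invariant and that the induced $G$-actions on $\mathbb P(f(A))$ and on $\mathbb P(f(A)^\perp)$ are generically free, where $f(A)^\perp\subset\wedge^2V$ is the annihilator of $f(A)$. Put $$Y_f=\mathbb P(f(A))\cap \mathrm{Gr}(2,V)^\vee,\qquad X_f=\mathbb P(f(A)^\perp)\cap \mathrm{Gr}(2,V),$$ where $\mathrm{Gr}(2,V)\subset\mathbb P(\wedge^2V)$ is the Grassmannian in its Plücker embedding and $\mathrm{Gr}(2,V)^\vee\subset\mathbb P(\wedge^2(V^\vee))$ is the hypersurface where the Pfaffian cubic form vanishes;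 both carry the induced actions of $G$. Then the Pfaffian cubic threefold $Y_f$ and the associated degree $14$ Fano threefold $X_f$ are twisted $G$-equivariantly stably birational. More precisely, for every faithful finite-dimensional representation $W$ of $\tilde G$ on which the central $\mathbb G_m$ acts by scalars (through an algebraic character) and such that the induced $G$-action on $\mathbb P(W)$ is generically free (for example $W=V$), one has $$Y_f\times\mathbb P^2\times\mathbb P(W)\ \sim_G\ X_f\times\mathbb P^2\times\mathbb P(W),$$ with trivial $G$-action on $\mathbb P^2$ and the induced projectively linear $G$-action on $\mathbb P(W)$. Here $\sim_G$ means that there are $G$-stable dense Zariski open subsets of the two sides which are $G$-equivariantly isomorphic. -/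

import Mathlib

open scoped LinearAlgebra.Projectivization

noncomputable section

namespace PfaffianGrassmannian

/-! ### Classical (multi-)projective varieties over an algebraically closed field -/

section Zariski

/-- A set of points `M` presented by homogeneous coordinates in the vector space `E`:
`IsCoord k x m` means that `x` is a vector of homogeneous coordinates of the point `m`. -/
class HomCoords (k : Type*) (E : outParam Type*) (M : Type*) where
  /-- `x` is a vector of homogeneous coordinates of `m`. -/
  IsCoord : E → M → Prop

/-- The coordinates of a point of `ℙ(E)` are the nonzero vectors on the corresponding line. -/
instance projHomCoords (k E : Type*) [Field k] [AddCommGroup E] [Module k E] :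
    HomCoords k E (ℙ k E) where
  IsCoord x m := ∃ hx : x ≠ 0, m = Projectivization.mk k x hx

/-- Multihomogeneous coordinates on a product. -/
instance prodHomCoords (k E F M N : Type*) [HomCoords k E M] [HomCoords k F N] :
    HomCoords k (E × F) (M × N) where
  IsCoord x m := HomCoords.IsCoord k x.1 m.1 ∧ HomCoords.IsCoord k x.2 m.2

variable (k : Type*) [Field k]

/-- The ring `k[E]` of polynomial functions on a finite-dimensional vector space `E`, generated
by the linear functionals. -/
def PolyFun (E : Type*) [AddCommGroup E] [Module k E] : Subalgebra k (E → k) :=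
  Algebra.adjoin k (Set.range fun (l : Module.Dual k E) (x : E) => l x)

/-- Polynomial maps between finite-dimensional vector spaces. -/
def IsPolyMap {E F : Type*} [AddCommGroup E] [Module k E] [AddCommGroup F] [Module k F]
    (P : E → F) : Prop :=
  ∀ l : Module.Dual k F, (fun x => l (P x)) ∈ PolyFun k E

variable {E M : Type*} [HomCoords k E M] [AddCommGroup E] [Module k E]
variable {F N : Type*} [HomCoords k F N] [AddCommGroup F] [Module k F]

/-- Zariski closed sets: common zero loci of polynomials in the homogeneous coordinates (the
topology on `M` is the quotient of the Zariski topology on the space of coordinate vectors). -/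
def IsZariskiClosed (C : Set M) : Prop :=
  ∃ S : Set (E → k), S ⊆ PolyFun k E ∧
    ∀ (x : E) (m : M), HomCoords.IsCoord k x m → (m ∈ C ↔ ∀ p ∈ S, p x = 0)

/-- `U` is a dense Zariski open subset of `Z`. -/
def IsDenseOpenIn (U Z : Set M) : Prop :=
  (∃ C : Set M, IsZariskiClosed k C ∧ U = Z \ C) ∧
    ∀ C : Set M, IsZariskiClosed k C → U ⊆ C → Z ⊆ C

/-- `φ` is a regular map (morphism) on `U`: Zariski locally on `U`, it is given by polynomials in
the homogeneous coordinates. -/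
def IsRegularOn (φ : M → N) (U : Set M) : Prop :=
  ∀ m ∈ U, ∃ C : Set M, IsZariskiClosed k C ∧ m ∉ C ∧
    ∃ P : E → F, IsPolyMap k P ∧
      ∀ m' ∈ U \ C, ∀ x : E, HomCoords.IsCoord k x m' → HomCoords.IsCoord k (P x) (φ m')

variable {G : Type*} [Group G]

/-- The action `α` of `G` is generically free on `Z`: there is a dense open subset of `Z` all of
whose points have trivial stabilizer. -/
def GenericallyFree (α : G →* Equiv.Perm M) (Z : Set M) : Prop :=
  ∃ U : Set M, IsDenseOpenIn k U Z ∧ ∀ m ∈ U, ∀ g : G, α g m = m → g = 1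

/-- `Z ∼_G Z'`: there are `G`-stable dense open subsets of `Z` and `Z'` and mutually inverse
`G`-equivariant morphisms `φ`, `ψ` between them. -/
def EquivBirational (α : G →* Equiv.Perm M) (Z : Set M) (β : G →* Equiv.Perm N) (Z' : Set N) :
    Prop :=
  ∃ (U : Set M) (U' : Set N) (φ : M → N) (ψ : N → M),
    IsDenseOpenIn k U Z ∧ IsDenseOpenIn k U' Z' ∧
    Set.MapsTo φ U U' ∧ Set.MapsTo ψ U' U ∧ Set.LeftInvOn ψ φ U ∧ Set.RightInvOn ψ φ U' ∧
    IsRegularOn k φ U ∧ IsRegularOn k ψ U' ∧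
    (∀ g, ∀ m ∈ U, α g m ∈ U) ∧ (∀ g, ∀ n ∈ U', β g n ∈ U') ∧
    ∀ g, ∀ m ∈ U, φ (α g m) = β g (φ m)

end Zariski

/-- The diagonal action on a product. -/
def prodAction {G M N : Type*} [Group G] (α : G →* Equiv.Perm M) (β : G →* Equiv.Perm N) :
    G →* Equiv.Perm (M × N) where
  toFun g := (α g).prodCongr (β g)
  map_one' := by ext x <;> simp
  map_mul' g h := by ext x <;> simp

/-! ### Central extensions by the multiplicative group and their representations -/

/-- A central extension `1 → 𝔾_m → Gt → G → 1`, on the level of `k`-points. -/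
structure GmExtension (k G Gt : Type*) [Field k] [Group G] [Group Gt] where
  /-- the inclusion of `𝔾_m` -/
  incl : kˣ →* Gt
  /-- the projection to `G` -/
  proj : Gt →* G
  incl_injective : Function.Injective incl
  proj_surjective : Function.Surjective proj
  ker_proj : proj.ker = incl.range
  central : incl.range ≤ Subgroup.center Gt

section Rep

variable {k G Gt : Type*} [Field k] [Group G] [Group Gt] (ext : GmExtension k G Gt)
variable {V : Type*} [AddCommGroup V] [Module k V]

/-- The central `𝔾_m` acts on the representation `ρ` through scalars, via an (algebraic) character
`z ↦ z ^ n`. For finite `G` this also says that `ρ` is algebraic, since the group `Gt` is a finite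
union of cosets of `𝔾_m`. -/
def GmActsByScalars (ρ : Gt →* (V ≃ₗ[k] V)) : Prop :=
  ∃ n : ℤ, ∀ (z : kˣ) (v : V), ρ (ext.incl z) v = ((z ^ n : kˣ) : k) • v

/-- The action of `Gt` on `ℙ(V)`. -/
def permRep (ρ : Gt →* (V ≃ₗ[k] V)) : Gt →* Equiv.Perm (ℙ k V) :=
  (MulAction.toPermHom (V ≃ₗ[k] V) (ℙ k V)).comp ρ

variable {ext} in
theorem ker_proj_le_ker_permRep {ρ : Gt →* (V ≃ₗ[k] V)} (h : GmActsByScalars ext ρ) :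
    ext.proj.ker ≤ (permRep ρ).ker := by
  obtain ⟨n, hn⟩ := h
  rw [ext.ker_proj]
  rintro _ ⟨z, rfl⟩
  rw [MonoidHom.mem_ker]
  ext m
  induction m using Projectivization.ind with
  | h v hv =>
    change ρ (ext.incl z) • Projectivization.mk k v hv = Projectivization.mk k v hv
    rw [Projectivization.smul_mk, Projectivization.mk_eq_mk_iff]
    exact ⟨z ^ n, (hn z v).symm⟩

/-- The projectively linear action of `G` on `ℙ(V)` induced by a representation of `Gt` on which
the central `𝔾_m` acts by scalars. -/
def projAction {ρ : Gt →* (V ≃ₗ[k] V)} (h : GmActsByScalars ext ρ) :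
    G →* Equiv.Perm (ℙ k V) :=
  ext.proj.liftOfSurjective ext.proj_surjective ⟨permRep ρ, ker_proj_le_ker_permRep h⟩

theorem projAction_proj {ρ : Gt →* (V ≃ₗ[k] V)} (h : GmActsByScalars ext ρ) (g : Gt)
    (m : ℙ k V) : projAction ext h (ext.proj g) m = ρ g • m := by
  have := ext.proj.liftOfRightInverse_comp_apply (Function.surjInv ext.proj_surjective)
    (Function.rightInverse_surjInv _) ⟨permRep ρ, ker_proj_le_ker_permRep h⟩ g
  exact congrArg (fun e : Equiv.Perm (ℙ k V) => e m) this

/-- The space `⋀²(V^∨)` of skew forms on `V`. -/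
abbrev SkewForm (k V : Type*) [Field k] [AddCommGroup V] [Module k V] : Type _ :=
  V [⋀^Fin 2]→ₗ[k] k

/-- The induced representation on skew forms, `(g ω)(v, w) = ω(g⁻¹ v, g⁻¹ w)`. -/
def formRep (ρ : Gt →* (V ≃ₗ[k] V)) : Gt →* (SkewForm k V ≃ₗ[k] SkewForm k V) where
  toFun g := AlternatingMap.domLCongr k k (Fin 2) k (ρ g)
  map_one' := by rw [map_one]; rfl
  map_mul' g h := by rw [map_mul]; rfl

/-- The induced representation on `⋀²V`, `g (v ∧ w) = g v ∧ g w`. -/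
def wedgeRep (ρ : Gt →* (V ≃ₗ[k] V)) : Gt →* (⋀[k]^2 V ≃ₗ[k] ⋀[k]^2 V) where
  toFun g := LinearEquiv.ofLinearMap (exteriorPower.map 2 (ρ g : V →ₗ[k] V))
    (exteriorPower.map 2 ((ρ g).symm : V →ₗ[k] V))
    (by rw [← exteriorPower.map_comp, LinearEquiv.comp_symm, exteriorPower.map_id])
    (by rw [← exteriorPower.map_comp, LinearEquiv.symm_comp, exteriorPower.map_id])
  map_one' := by
    ext1 x
    change exteriorPower.map 2 ((ρ 1 : V ≃ₗ[k] V) : V →ₗ[k] V) x = x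
    rw [map_one, show (((1 : V ≃ₗ[k] V)) : V →ₗ[k] V) = LinearMap.id from rfl,
      exteriorPower.map_id, LinearMap.id_apply]
  map_mul' g h := by
    ext1 x
    change exteriorPower.map 2 ((ρ (g * h) : V ≃ₗ[k] V) : V →ₗ[k] V) x =
      exteriorPower.map 2 ((ρ g : V ≃ₗ[k] V) : V →ₗ[k] V)
        (exteriorPower.map 2 ((ρ h : V ≃ₗ[k] V) : V →ₗ[k] V) x)
    rw [map_mul, ← LinearMap.comp_apply, ← exteriorPower.map_comp]
    rfl

variable {ext}

theorem GmActsByScalars.form {ρ : Gt →* (V ≃ₗ[k] V)} (h : GmActsByScalars ext ρ) :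
    GmActsByScalars ext (formRep ρ) := by
  obtain ⟨n, hn⟩ := h
  refine ⟨-(n + n), fun z ω => ?_⟩
  have hs : ∀ v, (ρ (ext.incl z)).symm v = ((z ^ (-n) : kˣ) : k) • v := by
    intro v
    rw [LinearEquiv.symm_apply_eq, hn, smul_smul, ← Units.val_mul, ← zpow_add]
    simp
  ext v
  change ω (fun i => (ρ (ext.incl z)).symm (v i)) = ((z ^ (-(n + n)) : kˣ) : k) • ω v
  simp only [hs]
  rw [ω.map_smul_univ (fun _ => ((z ^ (-n) : kˣ) : k)) v]
  congr 1
  simp only [Finset.prod_const, Finset.card_univ, Fintype.card_fin]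
  rw [← Units.val_pow_eq_pow_val, ← zpow_natCast, ← zpow_mul]
  congr 2
  push_cast
  ring

theorem GmActsByScalars.wedge {ρ : Gt →* (V ≃ₗ[k] V)} (h : GmActsByScalars ext ρ) :
    GmActsByScalars ext (wedgeRep ρ) := by
  obtain ⟨n, hn⟩ := h
  refine ⟨n + n, fun z x => ?_⟩
  have key : exteriorPower.map 2 ((ρ (ext.incl z) : V ≃ₗ[k] V) : V →ₗ[k] V) =
      ((z ^ (n + n) : kˣ) : k) • LinearMap.id := by
    apply exteriorPower.linearMap_ext
    ext v : 1
    simp only [LinearMap.compAlternatingMap_apply, exteriorPower.map_apply_ιMulti,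
      LinearMap.smul_apply, LinearMap.id_apply]
    have : (((ρ (ext.incl z) : V ≃ₗ[k] V) : V →ₗ[k] V) ∘ v) =
        fun i => ((z ^ n : kˣ) : k) • v i := by
      funext i
      exact hn z (v i)
    rw [this, (exteriorPower.ιMulti k 2).map_smul_univ (fun _ => ((z ^ n : kˣ) : k)) v]
    congr 1
    simp only [Finset.prod_const, Finset.card_univ, Fintype.card_fin]
    rw [zpow_add, Units.val_mul, sq]
  change exteriorPower.map 2 ((ρ (ext.incl z) : V ≃ₗ[k] V) : V →ₗ[k] V) x = _
  rw [key]
  rfl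

end Rep

/-! ### The Pfaffian cubic and the Fano threefold of a net of skew forms -/

section Net

variable {k V A : Type*} [Field k] [AddCommGroup V] [Module k V] [AddCommGroup A] [Module k A]

/-- The rank of a skew form, i.e. of the linear map `v ↦ ω(v, ·)`. -/
def skewRank (ω : SkewForm k V) : ℕ :=
  Module.finrank k (LinearMap.range ω.curryLeft)

/-- The net `f` is regular: all nonzero members have rank at least four. -/
def IsRegularNet (f : A →ₗ[k] SkewForm k V) : Prop :=
  ∀ a : A, a ≠ 0 → 4 ≤ skewRank (f a)

/-- The Pfaffian of the Gram matrix of `ω` in the basis `b`. -/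
def pfaffian (b : Module.Basis (Fin 6) k V) (ω : SkewForm k V) : k :=
  (48 : k)⁻¹ * ∑ σ : Equiv.Perm (Fin 6), ((Equiv.Perm.sign σ : ℤ) : k) *
    (ω ![b (σ 0), b (σ 1)] * ω ![b (σ 2), b (σ 3)] * ω ![b (σ 4), b (σ 5)])

variable (k V) in
/-- The Pfaffian hypersurface `Gr(2,V)^∨ ⊆ ℙ(⋀²V^∨)` (the vanishing of the Pfaffian does not
depend on the basis). -/
def pfaffianHypersurface : Set (ℙ k (SkewForm k V)) :=
  {m | ∀ b : Module.Basis (Fin 6) k V, pfaffian b m.rep = 0}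

variable (k V) in
/-- The Grassmannian `Gr(2,V) ⊆ ℙ(⋀²V)` in its Plücker embedding. -/
def grassmannian : Set (ℙ k (⋀[k]^2 V)) :=
  {m | ∃ v w : V, m.rep = exteriorPower.ιMulti k 2 ![v, w]}

/-- `ℙ(U) ⊆ ℙ(E)` for a linear subspace `U ⊆ E`. -/
def projSub {E : Type*} [AddCommGroup E] [Module k E] (U : Submodule k E) : Set (ℙ k E) :=
  {m | m.rep ∈ U}

/-- The annihilator `f(A)^⊥ ⊆ ⋀²V` for the pairing `⟨ω, v ∧ w⟩ = ω(v, w)`. -/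
def perp (f : A →ₗ[k] SkewForm k V) : Submodule k (⋀[k]^2 V) :=
  ⨅ a : A, LinearMap.ker (exteriorPower.alternatingMapLinearEquiv (f a))

/-- `Y_f = ℙ(f(A)) ∩ Gr(2,V)^∨`. -/
def cubicY (f : A →ₗ[k] SkewForm k V) : Set (ℙ k (SkewForm k V)) :=
  projSub (LinearMap.range f) ∩ pfaffianHypersurface k V

/-- `X_f = ℙ(f(A)^⊥) ∩ Gr(2,V)`. -/
def fanoX (f : A →ₗ[k] SkewForm k V) : Set (ℙ k (⋀[k]^2 V)) :=
  projSub (perp f) ∩ grassmannian k V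

end Net

end PfaffianGrassmannian

end

set_option linter.unusedSectionVars false

noncomputable section

namespace PfaffianGrassmannian

/-! ### Polynomial functions and polynomial maps on vector spaces -/

section PolynomialFunctions

variable {k : Type*} [Field k] {E F H : Type*} [AddCommGroup E] [Module k E]
  [AddCommGroup F] [Module k F] [AddCommGroup H] [Module k H]

/-! Compare two projective line bundles through their common base `ℙ(V)`. By regularity, every
nonzero degenerate form in `f(A)` has a two-dimensional kernel, so the pairs (form in `Y_f`, line in
its kernel) form a `ℙ¹`-bundle over `Y_f`. A point of `X_f` is a plane in `V`, and the pairs (plane,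
line in it) form a `ℙ¹`-bundle over `X_f`. Over `[v] ∈ ℙ(V)` the first space has as fibre the
projectivized kernel of `a ↦ f(a)(v, ·)`, a map from `A` to `(V/v)^∨`. The second has the
projectivized kernel of the transposed map `V/v → A^∨`, embedded in `⋀²V` by `w ↦ v ∧ w`. Both maps
go between five-dimensional spaces, so the two kernels have the same dimension for every `v`
(`nullity_perpFamily`).

Kernels of equal dimension give bundles that are locally but not canonically isomorphic. An
equivariant no-name lemma (`equivBirational_noName`) repairs this after multiplication by `ℙ¹ ×
ℙ(W)`. Local kernel sections, written with adjugates, are averaged over `G`. The weights are a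
polynomial on `W` that separates a free orbit and a power of the determinant that cancels the
central character. The extra `ℙ¹` picks a generic combination of a finite spanning set of sections,
so the trivialization is generically defined on every fibre and the base may be reducible. The same
lemma trivializes the rank two bundles over `Y_f` and `X_f`; since `ℙ²` is birational to `ℙ¹ × ℙ¹`,
one line is the fibre and the other is the parameter line.

It remains to see that the loci of constant nullity in `ℙ(V)` control both spaces. In affine
coordinates, each space of pairs is locally cut out by few equations, so through each of its points
passes an irreducible piece of dimension at least `dim V` (`exists_aIrr_of_equations`). Conversely,
a locus of nullity `j` has dimension at most `dim V - j` (`strataBound_flip`): its pairs map to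
degenerate forms with two-dimensional kernels, and these fill only a proper subset of `A`.
Properness is the statement that five-dimensional regular spaces of forms contain a nondegenerate
member (`exists_nondegenerate`). Hence exactly the loci of maximal dimension `dim V - j` matter.
Their bundles are generically open and together dense on both sides, and the trivializations over
them are glued (`equivBirational_flagSet`). -/

theorem dual_mem_polyFun (l : Module.Dual k E) : (fun x => l x) ∈ PolyFun k E :=
  Algebra.subset_adjoin ⟨l, rfl⟩

theorem const_mem_polyFun (c : k) : (fun _ : E => c) ∈ PolyFun k E :=
  (PolyFun k E).algebraMap_mem c

theorem mul_mem_polyFun {p q : E → k} (hp : p ∈ PolyFun k E) (hq : q ∈ PolyFun k E) :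
    (fun x => p x * q x) ∈ PolyFun k E :=
  (PolyFun k E).mul_mem hp hq

theorem add_mem_polyFun {p q : E → k} (hp : p ∈ PolyFun k E) (hq : q ∈ PolyFun k E) :
    (fun x => p x + q x) ∈ PolyFun k E :=
  (PolyFun k E).add_mem hp hq

theorem sub_mem_polyFun {p q : E → k} (hp : p ∈ PolyFun k E) (hq : q ∈ PolyFun k E) :
    (fun x => p x - q x) ∈ PolyFun k E :=
  (PolyFun k E).sub_mem hp hq

theorem pow_mem_polyFun {p : E → k} (hp : p ∈ PolyFun k E) (n : ℕ) :
    (fun x => p x ^ n) ∈ PolyFun k E :=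
  (PolyFun k E).pow_mem hp n

theorem sum_mem_polyFun {ι : Type*} (s : Finset ι) {p : ι → E → k}
    (hp : ∀ i ∈ s, p i ∈ PolyFun k E) : (fun x => ∑ i ∈ s, p i x) ∈ PolyFun k E := by
  have : (fun x => ∑ i ∈ s, p i x) = ∑ i ∈ s, p i := by
    ext x; simp
  rw [this]
  exact (PolyFun k E).sum_mem hp

theorem prod_mem_polyFun {ι : Type*} (s : Finset ι) {p : ι → E → k}
    (hp : ∀ i ∈ s, p i ∈ PolyFun k E) : (fun x => ∏ i ∈ s, p i x) ∈ PolyFun k E := by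
  have : (fun x => ∏ i ∈ s, p i x) = ∏ i ∈ s, p i := by
    ext x; simp
  rw [this]
  exact (PolyFun k E).prod_mem hp

theorem det_mem_polyFun {n : Type*} [Fintype n] [DecidableEq n] {M : E → Matrix n n k}
    (hM : ∀ i j, (fun x => M x i j) ∈ PolyFun k E) : (fun x => (M x).det) ∈ PolyFun k E := by
  simp only [Matrix.det_apply']
  exact sum_mem_polyFun _ fun σ _ => mul_mem_polyFun (const_mem_polyFun _)
    (prod_mem_polyFun _ fun i _ => hM _ _)

theorem adjugate_mem_polyFun {n : Type*} [Fintype n] [DecidableEq n] {M : E → Matrix n n k}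
    (hM : ∀ i j, (fun x => M x i j) ∈ PolyFun k E) (i j : n) :
    (fun x => (M x).adjugate i j) ∈ PolyFun k E := by
  simp only [Matrix.adjugate_apply]
  refine det_mem_polyFun fun a b => ?_
  by_cases h : a = j
  · subst h
    simp only [Matrix.updateRow_self]
    exact const_mem_polyFun _
  · simp only [Matrix.updateRow_ne h]
    exact hM a b

theorem comp_mem_polyFun {P : E → F} (hP : IsPolyMap k P) {q : F → k} (hq : q ∈ PolyFun k F) :
    (fun x => q (P x)) ∈ PolyFun k E := by
  induction hq using Algebra.adjoin_induction with
  | mem q hq =>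
    obtain ⟨l, rfl⟩ := hq
    exact hP l
  | algebraMap c => exact const_mem_polyFun c
  | add p q _ _ hp hq => exact add_mem_polyFun hp hq
  | mul p q _ _ hp hq => exact mul_mem_polyFun hp hq

theorem IsPolyMap.comp {P : E → F} {Q : F → H} (hQ : IsPolyMap k Q) (hP : IsPolyMap k P) :
    IsPolyMap k (fun x => Q (P x)) :=
  fun l => comp_mem_polyFun hP (hQ l)

theorem isPolyMap_linear (T : E →ₗ[k] F) : IsPolyMap k (fun x => T x) :=
  fun l => dual_mem_polyFun (l ∘ₗ T)

theorem isPolyMap_id : IsPolyMap k (fun x : E => x) := isPolyMap_linear LinearMap.id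

theorem isPolyMap_const (c : F) : IsPolyMap k (fun _ : E => c) :=
  fun l => const_mem_polyFun (l c)

theorem IsPolyMap.add {P Q : E → F} (hP : IsPolyMap k P) (hQ : IsPolyMap k Q) :
    IsPolyMap k (fun x => P x + Q x) := fun l => by
  simpa using add_mem_polyFun (hP l) (hQ l)

theorem IsPolyMap.smul {p : E → k} {P : E → F} (hp : p ∈ PolyFun k E) (hP : IsPolyMap k P) :
    IsPolyMap k (fun x => p x • P x) := fun l => by
  simpa using mul_mem_polyFun hp (hP l)

theorem IsPolyMap.sum {ι : Type*} (s : Finset ι) {P : ι → E → F}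
    (hP : ∀ i ∈ s, IsPolyMap k (P i)) : IsPolyMap k (fun x => ∑ i ∈ s, P i x) := fun l => by
  simpa using sum_mem_polyFun s fun i hi => hP i hi l

theorem IsPolyMap.prodMk {P : E → F} {Q : E → H} (hP : IsPolyMap k P) (hQ : IsPolyMap k Q) :
    IsPolyMap k (fun x => (P x, Q x)) := fun l => by
  have h : ∀ x, l (P x, Q x) = (l ∘ₗ LinearMap.inl k F H) (P x) +
      (l ∘ₗ LinearMap.inr k F H) (Q x) := fun x => by
    simp [← map_add]
  simp only [h]
  exact add_mem_polyFun (hP _) (hQ _)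

theorem IsPolyMap.pi {ι : Type*} [Fintype ι] {P : E → ι → k}
    (hP : ∀ i, (fun x => P x i) ∈ PolyFun k E) : IsPolyMap k P := fun l => by
  classical
  have h : ∀ x, l (P x) = ∑ i, P x i * l (Pi.single i 1) := fun x => by
    conv_lhs => rw [pi_eq_sum_univ' (P x)]
    simp
  simp only [h]
  exact sum_mem_polyFun _ fun i _ => mul_mem_polyFun (hP i) (const_mem_polyFun _)

theorem IsPolyMap.fst {P : E → F × H} (hP : IsPolyMap k P) : IsPolyMap k (fun x => (P x).1) :=
  (isPolyMap_linear (LinearMap.fst k F H)).comp hP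

theorem IsPolyMap.snd {P : E → F × H} (hP : IsPolyMap k P) : IsPolyMap k (fun x => (P x).2) :=
  (isPolyMap_linear (LinearMap.snd k F H)).comp hP

/-- The restriction of a polynomial function to a line is a polynomial in the parameter. -/
theorem exists_polynomial_line {q : E → k} (hq : q ∈ PolyFun k E) (x y : E) :
    ∃ P : Polynomial k, ∀ s : k, q (x + s • y) = P.eval s := by
  induction hq using Algebra.adjoin_induction with
  | mem q hq =>
    obtain ⟨l, rfl⟩ := hq
    exact ⟨Polynomial.C (l x) + Polynomial.X * Polynomial.C (l y), fun s => by simp; ring⟩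
  | algebraMap c => exact ⟨Polynomial.C c, fun s => by simp⟩
  | add p q _ _ hp hq =>
    obtain ⟨P, hP⟩ := hp
    obtain ⟨Q, hQ⟩ := hq
    exact ⟨P + Q, fun s => by simp [hP, hQ]⟩
  | mul p q _ _ hp hq =>
    obtain ⟨P, hP⟩ := hp
    obtain ⟨Q, hQ⟩ := hq
    exact ⟨P * Q, fun s => by simp [hP, hQ]⟩

/-- A polynomial function vanishes at `x` if it vanishes on the part of a line through `x` on
which another polynomial function, not identically zero on the line, does not vanish. -/
theorem eq_zero_of_line [Infinite k] {q h : E → k} (hq : q ∈ PolyFun k E) (hh : h ∈ PolyFun k E)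
    (x z : E) (hz : h z ≠ 0)
    (H : ∀ s : k, h (x + s • (z - x)) ≠ 0 → q (x + s • (z - x)) = 0) : q x = 0 := by
  obtain ⟨P, hP⟩ := exists_polynomial_line hq x (z - x)
  obtain ⟨Q, hQ⟩ := exists_polynomial_line hh x (z - x)
  have hQ0 : Q ≠ 0 := by
    rintro rfl
    apply hz
    have := hQ 1
    simpa using this
  have : P * Q = 0 := by
    apply Polynomial.funext
    intro s
    rw [Polynomial.eval_mul, ← hP, ← hQ, Polynomial.eval_zero]
    by_cases hs : h (x + s • (z - x)) = 0
    · rw [hs, mul_zero]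
    · rw [H s hs, zero_mul]
  have hP0 : P = 0 := (mul_eq_zero.1 this).resolve_right hQ0
  have := hP 0
  simpa [hP0] using this

/-- Joining a point where `p` is nonzero to one where `q` is nonzero by a line reduces the claim to
polynomials in one variable over an infinite field. -/
theorem polyFun_mul_eq_zero [Infinite k] {p q : E → k} (hp : p ∈ PolyFun k E)
    (hq : q ∈ PolyFun k E) (h : ∀ x, p x * q x = 0) : (∀ x, p x = 0) ∨ ∀ x, q x = 0 := by
  by_contra! hc
  obtain ⟨⟨x, hx⟩, z, hz⟩ := hc
  exact hx (eq_zero_of_line hp hq x z hz fun s hs => (mul_eq_zero.1 (h _)).resolve_right hs)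

end PolynomialFunctions

/-! ### Zariski closure, density and regular maps -/

section Closure

variable (k : Type*) [Field k]

/-- Coordinates behave as multihomogeneous coordinates: they exist, determine the point, and two
coordinate vectors of a point differ by a rescaling. -/
class NiceCoords (E M : Type*) [AddCommGroup E] [Module k E] [HomCoords k E M] : Prop where
  exists_coord : ∀ m : M, ∃ x : E, HomCoords.IsCoord k x m
  unique : ∀ (x : E) (m m' : M), HomCoords.IsCoord k x m → HomCoords.IsCoord k x m' → m = m'
  rescale : ∀ (x x' : E) (m : M), HomCoords.IsCoord k x m → HomCoords.IsCoord k x' m →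
    ∃ T : E →ₗ[k] E, T x = x' ∧ ∀ (y : E) (n : M), HomCoords.IsCoord k y n →
      HomCoords.IsCoord k (T y) n

instance projNiceCoords (E : Type*) [AddCommGroup E] [Module k E] : NiceCoords k E (ℙ k E) where
  exists_coord m := ⟨m.rep, m.rep_nonzero, (m.mk_rep).symm⟩
  unique := by
    rintro x m m' ⟨hx, rfl⟩ ⟨hx', rfl⟩
    rfl
  rescale := by
    rintro x x' m ⟨hx, rfl⟩ ⟨hx', h⟩
    rw [Projectivization.mk_eq_mk_iff] at h
    obtain ⟨c, hc⟩ := h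
    refine ⟨((c⁻¹ : kˣ) : k) • LinearMap.id, ?_, ?_⟩
    · rw [LinearMap.smul_apply, LinearMap.id_apply, ← hc, Units.smul_def, smul_smul,
        ← Units.val_mul]
      simp
    · rintro y n ⟨hy, rfl⟩
      refine ⟨?_, ?_⟩
      · simpa using hy
      · rw [Projectivization.mk_eq_mk_iff]
        refine ⟨c, ?_⟩
        rw [LinearMap.smul_apply, LinearMap.id_apply, Units.smul_def, smul_smul,
          ← Units.val_mul]
        simp

instance prodNiceCoords (E F M N : Type*) [AddCommGroup E] [Module k E] [AddCommGroup F]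
    [Module k F] [HomCoords k E M] [HomCoords k F N] [NiceCoords k E M] [NiceCoords k F N] :
    NiceCoords k (E × F) (M × N) where
  exists_coord m := by
    obtain ⟨x, hx⟩ := NiceCoords.exists_coord (k := k) (E := E) m.1
    obtain ⟨y, hy⟩ := NiceCoords.exists_coord (k := k) (E := F) m.2
    exact ⟨(x, y), hx, hy⟩
  unique x m m' h h' := Prod.ext (NiceCoords.unique _ _ _ h.1 h'.1)
    (NiceCoords.unique _ _ _ h.2 h'.2)
  rescale x x' m h h' := by
    obtain ⟨T, hT, hT'⟩ := NiceCoords.rescale _ _ _ h.1 h'.1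
    obtain ⟨S, hS, hS'⟩ := NiceCoords.rescale _ _ _ h.2 h'.2
    exact ⟨T.prodMap S, Prod.ext hT hS, fun y n hy => ⟨hT' _ _ hy.1, hS' _ _ hy.2⟩⟩

variable {E M : Type*} [HomCoords k E M] [AddCommGroup E] [Module k E]
variable {F N : Type*} [HomCoords k F N] [AddCommGroup F] [Module k F]
variable {H L : Type*} [HomCoords k H L] [AddCommGroup H] [Module k H]

/-- The Zariski closure of a set of points. -/
def zcl (T : Set M) : Set M :=
  {m | ∀ p ∈ PolyFun k E, (∀ m' ∈ T, ∀ x : E, HomCoords.IsCoord k x m' → p x = 0) →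
    ∀ x : E, HomCoords.IsCoord k x m → p x = 0}

variable {k}

theorem subset_zcl (T : Set M) : T ⊆ zcl k T := fun m hm _ _ h x hx => h m hm x hx

theorem zcl_mono {T T' : Set M} (h : T ⊆ T') : zcl k T ⊆ zcl k T' :=
  fun _ hm p hp hpT => hm p hp fun m' hm' => hpT m' (h hm')

theorem zcl_subset_of_closed [NiceCoords k E M] {T C : Set M} (hC : IsZariskiClosed k C)
    (h : T ⊆ C) : zcl k T ⊆ C := by
  obtain ⟨S, hS, hSC⟩ := hC
  intro m hm
  obtain ⟨x, hx⟩ := NiceCoords.exists_coord (k := k) (E := E) m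
  exact (hSC x m hx).2 fun p hp => hm p (hS hp) (fun m' hm' y hy => (hSC y m' hy).1 (h hm') p hp)
    x hx

/-- `IsZariskiClosed` tests membership on any single coordinate vector, `zcl` on all of them. The
two agree because an equation of `T` composed with a rescaling is again an equation of `T`. -/
theorem isZariskiClosed_zcl [NiceCoords k E M] (T : Set M) : IsZariskiClosed k (zcl k T) := by
  refine ⟨{p | p ∈ PolyFun k E ∧ ∀ m' ∈ T, ∀ x : E, HomCoords.IsCoord k x m' → p x = 0},
    fun p hp => hp.1, fun x m hx => ⟨fun hm p hp => hm p hp.1 hp.2 x hx, ?_⟩⟩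
  intro h p hp hpT y hy
  obtain ⟨S, hS, hS'⟩ := NiceCoords.rescale x y m hx hy
  rw [← hS]
  exact h (fun z => p (S z)) ⟨comp_mem_polyFun (isPolyMap_linear S) hp,
    fun m' hm' z hz => hpT m' hm' _ (hS' z m' hz)⟩

theorem subset_zcl_iff [NiceCoords k E M] {T Z : Set M} :
    (∀ C : Set M, IsZariskiClosed k C → T ⊆ C → Z ⊆ C) ↔ Z ⊆ zcl k T :=
  ⟨fun h => h _ (isZariskiClosed_zcl T) (subset_zcl T),
    fun h _ hC hT => h.trans (zcl_subset_of_closed hC hT)⟩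

theorem IsZariskiClosed.union {C D : Set M} (hC : IsZariskiClosed k C)
    (hD : IsZariskiClosed k D) : IsZariskiClosed k (C ∪ D) := by
  obtain ⟨S, hS, hSC⟩ := hC
  obtain ⟨T, hT, hTD⟩ := hD
  refine ⟨{r | ∃ p ∈ S, ∃ q ∈ T, r = fun x => p x * q x}, ?_, fun x m hx => ?_⟩
  · rintro _ ⟨p, hp, q, hq, rfl⟩
    exact mul_mem_polyFun (hS hp) (hT hq)
  · rw [Set.mem_union, hSC x m hx, hTD x m hx]
    constructor
    · rintro (h | h) _ ⟨p, hp, q, hq, rfl⟩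
      · simp [h p hp]
      · simp [h q hq]
    · intro h
      by_contra! hc
      obtain ⟨⟨p, hp, hpx⟩, q, hq, hqx⟩ := hc
      exact mul_ne_zero hpx hqx (h _ ⟨p, hp, q, hq, rfl⟩)

theorem isZariskiClosed_empty : IsZariskiClosed k (∅ : Set M) :=
  ⟨{fun _ => 1}, by rintro _ rfl; exact const_mem_polyFun 1, fun x m _ => by simp⟩

theorem isDenseOpenIn_iff [NiceCoords k E M] {U Z : Set M} :
    IsDenseOpenIn k U Z ↔ (∃ C : Set M, IsZariskiClosed k C ∧ U = Z \ C) ∧ Z ⊆ zcl k U := by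
  rw [IsDenseOpenIn, subset_zcl_iff]

theorem subset_zcl_trans [NiceCoords k E M] {Z U T : Set M} (h : Z ⊆ zcl k U)
    (h' : U ⊆ zcl k T) : Z ⊆ zcl k T :=
  h.trans (zcl_subset_of_closed (isZariskiClosed_zcl T) h')

/-- A regular map on `U` is continuous on `U`. -/
theorem IsRegularOn.exists_preimage [NiceCoords k E M] {φ : M → N} {U : Set M}
    (hφ : IsRegularOn k φ U) {C : Set N} (hC : IsZariskiClosed k C) :
    ∃ D : Set M, IsZariskiClosed k D ∧ ∀ m ∈ U, (m ∈ D ↔ φ m ∈ C) := by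
  refine ⟨zcl k {m | m ∈ U ∧ φ m ∈ C}, isZariskiClosed_zcl _, fun m hm => ⟨fun h => ?_,
    fun h => subset_zcl _ ⟨hm, h⟩⟩⟩
  obtain ⟨D, ⟨S, hS, hSD⟩, hmD, P, hP, hPφ⟩ := hφ m hm
  obtain ⟨T, hT, hTC⟩ := hC
  obtain ⟨x, hx⟩ := NiceCoords.exists_coord (k := k) (E := E) m
  have hx' := hPφ m ⟨hm, hmD⟩ x hx
  rw [hTC _ _ hx']
  intro p hp
  obtain ⟨q, hq, hqx⟩ : ∃ q ∈ S, q x ≠ 0 := by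
    by_contra! hc
    exact hmD ((hSD x m hx).2 hc)
  -- The factor `q` kills the locus where the local formula `P` is not valid, so the product
  -- vanishes on the whole preimage; at `x` the factor is nonzero and can be cancelled.
  have := h (fun y => q y * p (P y))
    (mul_mem_polyFun (hS hq) (comp_mem_polyFun hP (hT hp))) ?_ x hx
  · exact (mul_eq_zero.1 this).resolve_left hqx
  · rintro m' ⟨hm'U, hm'C⟩ y hy
    by_cases hm'D : m' ∈ D
    · simp [(hSD y m' hy).1 hm'D q hq]
    · simp [(hTC _ _ (hPφ m' ⟨hm'U, hm'D⟩ y hy)).1 hm'C p hp]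

theorem IsRegularOn.mono {φ : M → N} {U V : Set M} (hφ : IsRegularOn k φ U) (h : V ⊆ U) :
    IsRegularOn k φ V := fun m hm => by
  obtain ⟨C, hC, hmC, P, hP, hPφ⟩ := hφ m (h hm)
  exact ⟨C, hC, hmC, P, hP, fun m' hm' => hPφ m' ⟨h hm'.1, hm'.2⟩⟩

theorem IsRegularOn.comp [NiceCoords k E M] {φ : M → N} {ψ : N → L} {U : Set M} {V : Set N}
    (hψ : IsRegularOn k ψ V) (hφ : IsRegularOn k φ U) (hUV : Set.MapsTo φ U V) :
    IsRegularOn k (fun m => ψ (φ m)) U := fun m hm => by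
  obtain ⟨C, hC, hmC, P, hP, hPφ⟩ := hφ m hm
  obtain ⟨D, hD, hmD, Q, hQ, hQψ⟩ := hψ _ (hUV hm)
  obtain ⟨D', hD', hD'D⟩ := hφ.exists_preimage hD
  refine ⟨C ∪ D', hC.union hD', ?_, fun x => Q (P x), hQ.comp hP, ?_⟩
  · rintro (h | h)
    · exact hmC h
    · exact hmD ((hD'D m hm).1 h)
  · rintro m' ⟨hm', hm'C⟩ x hx
    rw [Set.mem_union, not_or] at hm'C
    exact hQψ _ ⟨hUV hm', fun h => hm'C.2 ((hD'D m' hm').2 h)⟩ _ (hPφ m' ⟨hm', hm'C.1⟩ x hx)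

/-- Under mutually inverse regular maps, preimages of dense subsets are dense. -/
theorem subset_zcl_preimage [NiceCoords k E M] [NiceCoords k F N] {φ : M → N} {ψ : N → M}
    {U : Set M} {U' V' : Set N}
    (hφ : Set.MapsTo φ U U') (hψ : Set.MapsTo ψ U' U) (hl : Set.LeftInvOn ψ φ U)
    (hr : Set.RightInvOn ψ φ U') (hψr : IsRegularOn k ψ U')
    (hV : V' ⊆ U') (hd : U' ⊆ zcl k V') : U ⊆ zcl k (U ∩ φ ⁻¹' V') := by
  rw [← subset_zcl_iff]
  intro C hC hUC m hm
  obtain ⟨D, hD, hDC⟩ := hψr.exists_preimage hC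
  have h1 : V' ⊆ D := fun n hn => (hDC n (hV hn)).2
    (hUC ⟨hψ (hV hn), by rw [Set.mem_preimage, hr (hV hn)]; exact hn⟩)
  have h2 := hd.trans (zcl_subset_of_closed hD h1) (hφ hm)
  have h3 := (hDC _ (hφ hm)).1 h2
  rwa [hl hm] at h3

/-- A dense set meets a dense open set densely: `Z` lies in the closure of `V \ C` together with
`C`, and `C` may be dropped since `Z \ C` is dense. No irreducibility of `Z` is involved. -/
theorem subset_zcl_inter [NiceCoords k E M] {Z C V : Set M} (hC : IsZariskiClosed k C)
    (hd : Z ⊆ zcl k (Z \ C)) (hV : Z ⊆ zcl k V) : Z ⊆ zcl k (V \ C) := by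
  have h1 : Z ⊆ zcl k (V \ C) ∪ C :=
    hV.trans (zcl_subset_of_closed ((isZariskiClosed_zcl _).union hC) fun m hm => by
      by_cases h : m ∈ C
      · exact Or.inr h
      · exact Or.inl (subset_zcl _ ⟨hm, h⟩))
  exact hd.trans (zcl_subset_of_closed (isZariskiClosed_zcl _) fun m hm =>
    (h1 hm.1).resolve_right hm.2)

end Closure

/-! ### Equivariant birational equivalence -/

section Birational

variable {k : Type*} [Field k]
variable {E M : Type*} [HomCoords k E M] [AddCommGroup E] [Module k E] [NiceCoords k E M]
variable {F N : Type*} [HomCoords k F N] [AddCommGroup F] [Module k F] [NiceCoords k F N]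
variable {H L : Type*} [HomCoords k H L] [AddCommGroup H] [Module k H] [NiceCoords k H L]
variable {G : Type*} [Group G] {α : G →* Equiv.Perm M} {β : G →* Equiv.Perm N}
  {γ : G →* Equiv.Perm L}

theorem EquivBirational.symm {Z : Set M} {Z' : Set N} (h : EquivBirational k α Z β Z') :
    EquivBirational k β Z' α Z := by
  obtain ⟨U, U', φ, ψ, hU, hU', hφ, hψ, hl, hr, hφr, hψr, hs, hs', he⟩ := h
  refine ⟨U', U, ψ, φ, hU', hU, hψ, hφ, hr, hl, hψr, hφr, hs', hs, fun g n hn => ?_⟩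
  rw [← hl (hs g _ (hψ hn)), he g _ (hψ hn), hr hn]

/-- The two open subsets of `Z'` have a dense intersection. Both maps are restricted to its
preimages, whose density is transported back along the inverse maps. -/
theorem EquivBirational.trans {Z : Set M} {Z' : Set N} {Z'' : Set L}
    (h : EquivBirational k α Z β Z') (h' : EquivBirational k β Z' γ Z'') :
    EquivBirational k α Z γ Z'' := by
  obtain ⟨U, U', φ, ψ, hU, hU', hφ, hψ, hl, hr, hφr, hψr, hs, hs', he⟩ := h
  obtain ⟨V, V', φ₂, ψ₂, hV, hV', hφ₂, hψ₂, hl₂, hr₂, hφr₂, hψr₂, ht, ht', he₂⟩ := h'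
  rw [isDenseOpenIn_iff] at hU hU' hV hV'
  obtain ⟨⟨C, hC, rfl⟩, hUd⟩ := hU
  obtain ⟨⟨C', hC', hU'C⟩, hU'd⟩ := hU'
  obtain ⟨⟨D, hD, hVD⟩, hVd⟩ := hV
  obtain ⟨⟨D', hD', rfl⟩, hV'd⟩ := hV'
  obtain ⟨A, hA, hAD⟩ := hφr.exists_preimage hD
  obtain ⟨B, hB, hBC⟩ := hψr₂.exists_preimage hC'
  have hdense : Z' ⊆ zcl k (U' ∩ V) := by
    have h1 := subset_zcl_inter hD (hVD ▸ hVd) hU'd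
    have h2 : U' \ D = U' ∩ V := by
      rw [hVD, hU'C]; ext n; simp only [Set.mem_sdiff, Set.mem_inter_iff]; tauto
    rwa [h2] at h1
  have hU'Z : U' ⊆ Z' := by rw [hU'C]; exact Set.sdiff_subset
  have hVZ : V ⊆ Z' := by rw [hVD]; exact Set.sdiff_subset
  refine ⟨(Z \ C) ∩ φ ⁻¹' (U' ∩ V), (Z'' \ D') ∩ ψ₂ ⁻¹' (U' ∩ V), fun m => φ₂ (φ m),
    fun n => ψ (ψ₂ n), isDenseOpenIn_iff.2 ⟨⟨C ∪ A, hC.union hA, ?_⟩, ?_⟩,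
    isDenseOpenIn_iff.2 ⟨⟨D' ∪ B, hD'.union hB, ?_⟩, ?_⟩, ?_, ?_, ?_, ?_, ?_, ?_, ?_, ?_, ?_⟩
  · ext m
    simp only [Set.mem_inter_iff, Set.mem_sdiff, Set.mem_preimage, Set.mem_union, not_or]
    constructor
    · rintro ⟨hm, h1, h2⟩
      exact ⟨hm.1, hm.2, fun h => by
        rw [hAD m hm] at h
        rw [hVD] at h2
        exact h2.2 h⟩
    · rintro ⟨h1, h2, h3⟩
      have h4 := hφ ⟨h1, h2⟩
      refine ⟨⟨h1, h2⟩, h4, ?_⟩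
      rw [hVD]
      exact ⟨hU'Z h4, fun h => h3 ((hAD m ⟨h1, h2⟩).2 h)⟩
  · exact subset_zcl_trans hUd (subset_zcl_preimage hφ hψ hl hr hψr Set.inter_subset_left
      (hU'Z.trans hdense))
  · ext m
    simp only [Set.mem_inter_iff, Set.mem_sdiff, Set.mem_preimage, Set.mem_union, not_or]
    constructor
    · rintro ⟨hm, h1, h2⟩
      exact ⟨hm.1, hm.2, fun h => by
        rw [hBC m hm] at h
        rw [hU'C] at h1
        exact h1.2 h⟩
    · rintro ⟨h1, h2, h3⟩
      have h4 := hψ₂ ⟨h1, h2⟩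
      refine ⟨⟨h1, h2⟩, ?_, h4⟩
      rw [hU'C]
      exact ⟨hVZ h4, fun h => h3 ((hBC m ⟨h1, h2⟩).2 h)⟩
  · exact subset_zcl_trans hV'd (subset_zcl_preimage hψ₂ hφ₂ hr₂ hl₂ hφr₂ Set.inter_subset_right
      (hVZ.trans hdense))
  · rintro m ⟨hm, h1, h2⟩
    refine ⟨hφ₂ h2, ?_⟩
    rw [Set.mem_preimage, hl₂ h2]
    exact ⟨h1, h2⟩
  · rintro m ⟨hm, h1, h2⟩
    refine ⟨hψ h1, ?_⟩
    rw [Set.mem_preimage, hr h1]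
    exact ⟨h1, h2⟩
  · rintro m ⟨hm, h1, h2⟩
    change ψ (ψ₂ (φ₂ (φ m))) = m
    rw [hl₂ h2, hl hm]
  · rintro m ⟨hm, h1, h2⟩
    change φ₂ (φ (ψ (ψ₂ m))) = m
    rw [hr h1, hr₂ hm]
  · exact (hφr₂.mono Set.inter_subset_right).comp (hφr.mono Set.inter_subset_left)
      fun m hm => hm.2
  · exact (hψr.mono Set.inter_subset_left).comp (hψr₂.mono Set.inter_subset_left)
      fun m hm => hm.2
  · rintro g m ⟨hm, h1, h2⟩
    refine ⟨hs g m hm, ?_⟩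
    rw [Set.mem_preimage, he g m hm]
    exact ⟨hs' g _ h1, ht g _ h2⟩
  · rintro g m ⟨hm, h1, h2⟩
    have h3 : ψ₂ (γ g m) = β g (ψ₂ m) := by
      rw [← hl₂ (ht g _ h2), he₂ g _ h2, hr₂ hm]
    refine ⟨ht' g m hm, ?_⟩
    rw [Set.mem_preimage, h3]
    exact ⟨hs' g _ h1, ht g _ h2⟩
  · rintro g m ⟨hm, h1, h2⟩
    change φ₂ (φ (α g m)) = γ g (φ₂ (φ m))
    rw [he g m hm, he₂ g _ h2]

/-- An equivariant isomorphism given globally by polynomials in the coordinates. -/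
theorem equivBirational_of_iso {Z : Set M} {Z' : Set N} (e : M ≃ N) {P : E → F} {Q : F → E}
    (hP : IsPolyMap k P) (hQ : IsPolyMap k Q)
    (hPe : ∀ x m, HomCoords.IsCoord k x m → HomCoords.IsCoord k (P x) (e m))
    (hQe : ∀ y n, HomCoords.IsCoord k y n → HomCoords.IsCoord k (Q y) (e.symm n))
    (hZ : ∀ m, m ∈ Z ↔ e m ∈ Z') (hα : ∀ g, ∀ m ∈ Z, α g m ∈ Z)
    (he : ∀ g m, e (α g m) = β g (e m)) : EquivBirational k α Z β Z' := by
  refine ⟨Z, Z', e, e.symm, isDenseOpenIn_iff.2 ⟨⟨∅, isZariskiClosed_empty, by simp⟩,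
    subset_zcl Z⟩, isDenseOpenIn_iff.2 ⟨⟨∅, isZariskiClosed_empty, by simp⟩, subset_zcl Z'⟩,
    fun m hm => (hZ m).1 hm, fun n hn => (hZ _).2 (by simpa using hn), fun m _ => by simp,
    fun n _ => by simp, fun m _ => ⟨∅, isZariskiClosed_empty, by simp, P, hP,
      fun m' _ x hx => hPe x m' hx⟩,
    fun m _ => ⟨∅, isZariskiClosed_empty, by simp, Q, hQ, fun m' _ x hx => hQe x m' hx⟩, hα, ?_,
    fun g m _ => he g m⟩
  intro g n hn
  have h1 : e.symm n ∈ Z := (hZ _).2 (by simpa using hn)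
  have h2 := (hZ _).1 (hα g _ h1)
  rw [he] at h2
  simpa using h2

/-- The action is by polynomial transformations of the coordinates. -/
def IsPolyAction (α : G →* Equiv.Perm M) : Prop :=
  ∀ g, ∃ P : E → E, IsPolyMap k P ∧
    ∀ x m, HomCoords.IsCoord k x m → HomCoords.IsCoord k (P x) (α g m)

theorem IsPolyAction.map_zcl (hα : IsPolyAction (k := k) α) {T T' : Set M} (g : G)
    (h : ∀ m ∈ T, α g m ∈ T') {m : M} (hm : m ∈ zcl k T) : α g m ∈ zcl k T' := by
  obtain ⟨P, hP, hPα⟩ := hα g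
  intro q hq hqT' x hx
  obtain ⟨y, hy⟩ := NiceCoords.exists_coord (k := k) (E := E) m
  obtain ⟨S, hS, hS'⟩ := NiceCoords.rescale (P y) x (α g m) (hPα y m hy) hx
  rw [← hS]
  exact hm (fun z => q (S (P z)))
    (comp_mem_polyFun ((isPolyMap_linear S).comp hP) hq)
    (fun m' hm' z hz => hqT' _ (h m' hm') _ (hS' _ _ (hPα z m' hz))) y hy

theorem IsPolyAction.prod (hα : IsPolyAction (k := k) α) (hβ : IsPolyAction (k := k) β) :
    IsPolyAction (k := k) (prodAction α β) := fun g => by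
  obtain ⟨P, hP, hPα⟩ := hα g
  obtain ⟨Q, hQ, hQβ⟩ := hβ g
  exact ⟨fun x => (P x.1, Q x.2),
    (hP.comp (isPolyMap_linear (LinearMap.fst k E F))).prodMk
      (hQ.comp (isPolyMap_linear (LinearMap.snd k E F))),
    fun x m hx => ⟨hPα _ _ hx.1, hQβ _ _ hx.2⟩⟩

theorem isPolyAction_one : IsPolyAction (k := k) (1 : G →* Equiv.Perm M) := fun _ =>
  ⟨fun x => x, isPolyMap_id, fun _ _ h => h⟩

end Birational

/-! ### Gluing equivalences over disjoint pieces -/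

section Glue

variable {k : Type*} [Field k]
variable {E M : Type*} [HomCoords k E M] [AddCommGroup E] [Module k E] [NiceCoords k E M]
variable {F N : Type*} [HomCoords k F N] [AddCommGroup F] [Module k F] [NiceCoords k F N]
variable {G : Type*} [Group G] {α : G →* Equiv.Perm M} {β : G →* Equiv.Perm N}

theorem IsZariskiClosed.iInter {ι : Type*} {C : ι → Set M} (hC : ∀ i, IsZariskiClosed k (C i)) :
    IsZariskiClosed k (⋂ i, C i) := by
  choose S hS hSC using hC
  refine ⟨⋃ i, S i, Set.iUnion_subset hS, fun x m hx => ?_⟩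
  simp only [Set.mem_iInter, Set.mem_iUnion]
  exact ⟨fun h p ⟨i, hp⟩ => (hSC i x m hx).1 (h i) p hp,
    fun h i => (hSC i x m hx).2 fun p hp => h p ⟨i, hp⟩⟩

theorem isRegularOn_id (U : Set M) : IsRegularOn k (id : M → M) U := fun _ _ =>
  ⟨∅, isZariskiClosed_empty, by simp, fun x => x, isPolyMap_id, fun _ _ _ hx => hx⟩

theorem equivBirational_of_isDenseOpenIn {V Z : Set M} (h : IsDenseOpenIn k V Z)
    (hs : ∀ g, ∀ m ∈ V, α g m ∈ V) : EquivBirational k α V α Z :=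
  ⟨V, V, id, id, isDenseOpenIn_iff.2 ⟨⟨∅, isZariskiClosed_empty, by simp⟩, subset_zcl V⟩, h,
    fun _ h => h, fun _ h => h, fun _ _ => rfl, fun _ _ => rfl, isRegularOn_id V,
    isRegularOn_id V, hs, hs, fun _ _ _ => rfl⟩

/-- Equivariant birational equivalences between disjoint open pieces with dense union can be
glued. -/
theorem equivBirational_iUnion [Nonempty M] [Nonempty N] {ι : Type*} {Z : Set M} {Z' : Set N}
    {A : ι → Set M} {A' : ι → Set N}
    (hA : ∀ i, ∃ C, IsZariskiClosed k C ∧ A i = Z \ C)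
    (hA' : ∀ i, ∃ C, IsZariskiClosed k C ∧ A' i = Z' \ C)
    (hdis : ∀ i j m, m ∈ A i → m ∈ A j → i = j) (hdis' : ∀ i j m, m ∈ A' i → m ∈ A' j → i = j)
    (hZ : Z ⊆ zcl k (⋃ i, A i)) (hZ' : Z' ⊆ zcl k (⋃ i, A' i))
    (h : ∀ i, EquivBirational k α (A i) β (A' i)) : EquivBirational k α Z β Z' := by
  classical
  choose D hD hAD using hA
  choose D' hD' hAD' using hA'
  choose U U' φ ψ hU hU' hφ hψ hl hr hφr hψr hs hs' he using h
  simp only [isDenseOpenIn_iff] at hU hU'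
  choose hU hUd using hU
  choose hU' hUd' using hU'
  choose C hC hUC using hU
  choose C' hC' hUC' using hU'
  have hUZ : ∀ i, U i = Z \ (D i ∪ C i) := fun i => by
    rw [hUC, hAD]; ext m; simp only [Set.mem_sdiff, Set.mem_union]; tauto
  have hUZ' : ∀ i, U' i = Z' \ (D' i ∪ C' i) := fun i => by
    rw [hUC', hAD']; ext m; simp only [Set.mem_sdiff, Set.mem_union]; tauto
  have hUA : ∀ i, U i ⊆ A i := fun i => by rw [hUC]; exact Set.sdiff_subset
  have hUA' : ∀ i, U' i ⊆ A' i := fun i => by rw [hUC']; exact Set.sdiff_subset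
  -- Off the union of the pieces the value is arbitrary; on the union the chosen index is the only
  -- possible one, by disjointness.
  set Φ : M → N := fun m => if h : ∃ i, m ∈ U i then φ h.choose m else Classical.arbitrary N
    with hΦ
  set Ψ : N → M := fun n => if h : ∃ i, n ∈ U' i then ψ h.choose n else Classical.arbitrary M
    with hΨ
  have hΦi : ∀ i, ∀ m ∈ U i, Φ m = φ i m := fun i m hm => by
    have hex : ∃ i, m ∈ U i := ⟨i, hm⟩
    rw [hΦ]
    simp only [dif_pos hex]
    rw [hdis _ _ m (hUA _ hex.choose_spec) (hUA i hm)]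
  have hΨi : ∀ i, ∀ n ∈ U' i, Ψ n = ψ i n := fun i m hm => by
    have hex : ∃ i, m ∈ U' i := ⟨i, hm⟩
    rw [hΨ]
    simp only [dif_pos hex]
    rw [hdis' _ _ m (hUA' _ hex.choose_spec) (hUA' i hm)]
  refine ⟨⋃ i, U i, ⋃ i, U' i, Φ, Ψ, isDenseOpenIn_iff.2 ⟨⟨_, IsZariskiClosed.iInter fun i =>
    (hD i).union (hC i), ?_⟩, ?_⟩, isDenseOpenIn_iff.2 ⟨⟨_, IsZariskiClosed.iInter fun i =>
    (hD' i).union (hC' i), ?_⟩, ?_⟩, ?_, ?_, ?_, ?_, ?_, ?_, ?_, ?_, ?_⟩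
  · rw [Set.sdiff_iInter]; exact Set.iUnion_congr hUZ
  · exact subset_zcl_trans hZ (Set.iUnion_subset fun i =>
      (hUd i).trans (zcl_mono (Set.subset_iUnion U i)))
  · rw [Set.sdiff_iInter]; exact Set.iUnion_congr hUZ'
  · exact subset_zcl_trans hZ' (Set.iUnion_subset fun i =>
      (hUd' i).trans (zcl_mono (Set.subset_iUnion U' i)))
  · intro m hm
    obtain ⟨i, hi⟩ := Set.mem_iUnion.1 hm
    exact Set.mem_iUnion.2 ⟨i, by rw [hΦi i m hi]; exact hφ i hi⟩
  · intro m hm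
    obtain ⟨i, hi⟩ := Set.mem_iUnion.1 hm
    exact Set.mem_iUnion.2 ⟨i, by rw [hΨi i m hi]; exact hψ i hi⟩
  · intro m hm
    obtain ⟨i, hi⟩ := Set.mem_iUnion.1 hm
    rw [hΦi i m hi, hΨi i _ (hφ i hi), hl i hi]
  · intro m hm
    obtain ⟨i, hi⟩ := Set.mem_iUnion.1 hm
    rw [hΨi i m hi, hΦi i _ (hψ i hi), hr i hi]
  · intro m hm
    obtain ⟨i, hi⟩ := Set.mem_iUnion.1 hm
    obtain ⟨B, hB, hmB, P, hP, hPφ⟩ := hφr i m hi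
    -- Removing the closed set that cuts out `U i` forces nearby points into the same piece, where
    -- `Φ` is `φ i`.
    refine ⟨(D i ∪ C i) ∪ B, ((hD i).union (hC i)).union hB, ?_, P, hP, ?_⟩
    · rintro (h | h)
      · exact (hUZ i ▸ hi).2 h
      · exact hmB h
    · rintro m' ⟨hm', hm'B⟩ x hx
      rw [Set.mem_union, not_or] at hm'B
      obtain ⟨j, hj⟩ := Set.mem_iUnion.1 hm'
      have hm'i : m' ∈ U i := by
        rw [hUZ i]
        rw [hUZ j] at hj
        exact ⟨hj.1, hm'B.1⟩
      rw [hΦi i m' hm'i]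
      exact hPφ m' ⟨hm'i, hm'B.2⟩ x hx
  · intro m hm
    obtain ⟨i, hi⟩ := Set.mem_iUnion.1 hm
    obtain ⟨B, hB, hmB, P, hP, hPψ⟩ := hψr i m hi
    refine ⟨(D' i ∪ C' i) ∪ B, ((hD' i).union (hC' i)).union hB, ?_, P, hP, ?_⟩
    · rintro (h | h)
      · exact (hUZ' i ▸ hi).2 h
      · exact hmB h
    · rintro m' ⟨hm', hm'B⟩ x hx
      rw [Set.mem_union, not_or] at hm'B
      obtain ⟨j, hj⟩ := Set.mem_iUnion.1 hm'
      have hm'i : m' ∈ U' i := by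
        rw [hUZ' i]
        rw [hUZ' j] at hj
        exact ⟨hj.1, hm'B.1⟩
      rw [hΨi i m' hm'i]
      exact hPψ m' ⟨hm'i, hm'B.2⟩ x hx
  · intro g m hm
    obtain ⟨i, hi⟩ := Set.mem_iUnion.1 hm
    exact Set.mem_iUnion.2 ⟨i, hs i g m hi⟩
  · intro g m hm
    obtain ⟨i, hi⟩ := Set.mem_iUnion.1 hm
    exact Set.mem_iUnion.2 ⟨i, hs' i g m hi⟩
  · intro g m hm
    obtain ⟨i, hi⟩ := Set.mem_iUnion.1 hm
    rw [hΦi i m hi, hΦi i _ (hs i g m hi), he i g m hi]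

/-- The interior of a stable subset `A` of a stable set `Z`. -/
theorem isDenseOpenIn_interior {A Z : Set M} (hAZ : A ⊆ Z)
    (hd : A ⊆ zcl k (A \ zcl k (Z \ A))) : IsDenseOpenIn k (A \ zcl k (Z \ A)) A ∧
      A \ zcl k (Z \ A) = Z \ zcl k (Z \ A) := by
  refine ⟨isDenseOpenIn_iff.2 ⟨⟨_, isZariskiClosed_zcl _, rfl⟩, hd⟩, ?_⟩
  ext m
  refine ⟨fun h => ⟨hAZ h.1, h.2⟩, fun h => ⟨?_, h.2⟩⟩
  by_contra hm
  exact h.2 (subset_zcl _ ⟨h.1, hm⟩)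

/-- Translation by `g⁻¹` preserves `Z \ A`, hence maps its closure into itself, so `g` cannot move
an interior point into that closure. -/
theorem IsPolyAction.interior_stable (hα : IsPolyAction (k := k) α) {A Z : Set M}
    (hA : ∀ g, ∀ m ∈ A, α g m ∈ A) (hZ : ∀ g, ∀ m ∈ Z, α g m ∈ Z) (g : G) :
    ∀ m ∈ A \ zcl k (Z \ A), α g m ∈ A \ zcl k (Z \ A) := by
  rintro m ⟨hm, hmz⟩
  refine ⟨hA g m hm, fun h => hmz ?_⟩
  have key : ∀ m' ∈ Z \ A, α g⁻¹ m' ∈ Z \ A := by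
    refine fun m' hm' => ⟨hZ _ _ hm'.1, fun h2 => hm'.2 ?_⟩
    have h3 := hA g _ h2
    rwa [← Equiv.Perm.mul_apply, ← map_mul, mul_inv_cancel, map_one, Equiv.Perm.one_apply] at h3
  have h1 := hα.map_zcl g⁻¹ key h
  rwa [← Equiv.Perm.mul_apply, ← map_mul, inv_mul_cancel, map_one, Equiv.Perm.one_apply] at h1

/-- Equivariant birational equivalences between disjoint stable pieces, each of which is generically
open in the whole, glue if the pieces are dense. -/
theorem equivBirational_glue [Nonempty M] [Nonempty N] {ι : Type*} {Z : Set M} {Z' : Set N}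
    (hα : IsPolyAction (k := k) α) (hβ : IsPolyAction (k := k) β)
    (hZs : ∀ g, ∀ m ∈ Z, α g m ∈ Z) (hZs' : ∀ g, ∀ m ∈ Z', β g m ∈ Z')
    {A : ι → Set M} {A' : ι → Set N} (hAZ : ∀ i, A i ⊆ Z) (hAZ' : ∀ i, A' i ⊆ Z')
    (hAs : ∀ i g, ∀ m ∈ A i, α g m ∈ A i) (hAs' : ∀ i g, ∀ m ∈ A' i, β g m ∈ A' i)
    (hdis : ∀ i j m, m ∈ A i → m ∈ A j → i = j) (hdis' : ∀ i j m, m ∈ A' i → m ∈ A' j → i = j)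
    (ho : ∀ i, A i ⊆ zcl k (A i \ zcl k (Z \ A i)))
    (ho' : ∀ i, A' i ⊆ zcl k (A' i \ zcl k (Z' \ A' i)))
    (hZ : Z ⊆ zcl k (⋃ i, A i)) (hZ' : Z' ⊆ zcl k (⋃ i, A' i))
    (h : ∀ i, EquivBirational k α (A i) β (A' i)) : EquivBirational k α Z β Z' := by
  refine equivBirational_iUnion (A := fun i => A i \ zcl k (Z \ A i))
    (A' := fun i => A' i \ zcl k (Z' \ A' i))
    (fun i => ⟨_, isZariskiClosed_zcl _, (isDenseOpenIn_interior (hAZ i) (ho i)).2⟩)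
    (fun i => ⟨_, isZariskiClosed_zcl _, (isDenseOpenIn_interior (hAZ' i) (ho' i)).2⟩)
    (fun i j m hi hj => hdis i j m hi.1 hj.1) (fun i j m hi hj => hdis' i j m hi.1 hj.1)
    (subset_zcl_trans hZ (Set.iUnion_subset fun i => (ho i).trans (zcl_mono
      (Set.subset_iUnion (fun i => A i \ zcl k (Z \ A i)) i))))
    (subset_zcl_trans hZ' (Set.iUnion_subset fun i => (ho' i).trans (zcl_mono
      (Set.subset_iUnion (fun i => A' i \ zcl k (Z' \ A' i)) i)))) fun i => ?_
  exact ((equivBirational_of_isDenseOpenIn (isDenseOpenIn_interior (hAZ i) (ho i)).1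
    (hα.interior_stable (hAs i) hZs)).trans (h i)).trans (equivBirational_of_isDenseOpenIn
    (isDenseOpenIn_interior (hAZ' i) (ho' i)).1 (hβ.interior_stable (hAs' i) hZs')).symm

end Glue

/-! ### Homogeneous coordinates and projective actions -/

section ProjectiveCoordinates

variable {k : Type*} [Field k] {E F : Type*} [AddCommGroup E] [Module k E]
  [AddCommGroup F] [Module k F]

theorem isCoord_rep (m : ℙ k E) : HomCoords.IsCoord k m.rep m :=
  ⟨m.rep_nonzero, m.mk_rep.symm⟩

theorem isCoord_mk {x : E} (hx : x ≠ 0) : HomCoords.IsCoord k x (Projectivization.mk k x hx) :=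
  ⟨hx, rfl⟩

theorem isCoord_smul {x : E} {m : ℙ k E} (h : HomCoords.IsCoord k x m) {c : k} (hc : c ≠ 0) :
    HomCoords.IsCoord k (c • x) m := by
  obtain ⟨hx, rfl⟩ := h
  refine ⟨smul_ne_zero hc hx, ?_⟩
  rw [Projectivization.mk_eq_mk_iff]
  exact ⟨(Units.mk0 c hc)⁻¹, by simp [Units.smul_def, hc]⟩

theorem isCoord_eq_smul {x y : E} {m : ℙ k E} (hx : HomCoords.IsCoord k x m)
    (hy : HomCoords.IsCoord k y m) : ∃ c : k, c ≠ 0 ∧ y = c • x := by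
  obtain ⟨hx, rfl⟩ := hx
  obtain ⟨hy, h⟩ := hy
  rw [eq_comm, Projectivization.mk_eq_mk_iff] at h
  obtain ⟨c, hc⟩ := h
  exact ⟨c, c.ne_zero, hc.symm⟩

/-- The point with given coordinates, with a default value at the zero vector. -/
def pointOf [Nontrivial E] (x : E) : ℙ k E :=
  open Classical in
  if hx : x ≠ 0 then Projectivization.mk k x hx
  else Projectivization.mk k (exists_ne (0 : E)).choose (exists_ne (0 : E)).choose_spec

theorem isCoord_pointOf [Nontrivial E] {x : E} (hx : x ≠ 0) :
    HomCoords.IsCoord k x (pointOf x : ℙ k E) :=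
  ⟨hx, by rw [pointOf, dif_pos hx]⟩

variable {G Gt : Type*} [Group G] [Group Gt] {ext : GmExtension k G Gt}

theorem isCoord_projAction {ρ : Gt →* (E ≃ₗ[k] E)} (h : GmActsByScalars ext ρ) (g : Gt) {x : E}
    {m : ℙ k E} (hx : HomCoords.IsCoord k x m) :
    HomCoords.IsCoord k (ρ g x) (projAction ext h (ext.proj g) m) := by
  obtain ⟨hx, rfl⟩ := hx
  rw [projAction_proj]
  refine ⟨(ρ g).map_ne_zero_iff.2 hx, ?_⟩
  rfl

theorem isPolyAction_projAction {ρ : Gt →* (E ≃ₗ[k] E)} (h : GmActsByScalars ext ρ) :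
    IsPolyAction (k := k) (projAction ext h) := fun γ => by
  obtain ⟨g, rfl⟩ := ext.proj_surjective γ
  exact ⟨fun x => ρ g x, isPolyMap_linear (ρ g).toLinearMap, fun x m hx =>
    isCoord_projAction h g hx⟩

end ProjectiveCoordinates

/-! ### Degeneracy loci over a base times parameters -/

section Degeneracy

variable {k : Type*} [Field k] {E T W R Q : Type*} [AddCommGroup E] [Module k E]
  [AddCommGroup T] [Module k T] [AddCommGroup W] [Module k W] [AddCommGroup R] [Module k R]
  [HomCoords k R Q] [NiceCoords k R Q]

/-- `Ind` stands for the independence of a system of sections and `δ` for its minors. Coordinate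
invariance of `Ind` allows the condition, stated at representatives, to be tested at any coordinate
vectors. -/
theorem isZariskiClosed_degeneracy
    {Ind : E → T → W → Prop} {ι : Type*} (δ : ι → E → T → W → k)
    (hδp : ∀ l, (fun z : E × (T × W) => δ l z.1 z.2.1 z.2.2) ∈ PolyFun k (E × (T × W)))
    (hInd_iff : ∀ x t w, Ind x t w ↔ ∃ l, δ l x t w ≠ 0)
    (hIndcoord : ∀ {x t w x' t' w'} {m : ℙ k E} {p : ℙ k T} {q : ℙ k W},
      HomCoords.IsCoord k x m → HomCoords.IsCoord k x' m → HomCoords.IsCoord k t p →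
      HomCoords.IsCoord k t' p → HomCoords.IsCoord k w q → HomCoords.IsCoord k w' q →
      Ind x t w → Ind x' t' w') :
    IsZariskiClosed k {q : ℙ k E × (Q × (ℙ k T × ℙ k W)) |
      ¬ Ind q.1.rep q.2.2.1.rep q.2.2.2.rep} := by
  refine ⟨Set.range fun l => fun z : E × (R × (T × W)) => δ l z.1 z.2.2.1 z.2.2.2, ?_, ?_⟩
  · rintro _ ⟨l, rfl⟩
    exact comp_mem_polyFun (P := fun z : E × (R × (T × W)) => (z.1, z.2.2))
      (isPolyMap_id.fst.prodMk isPolyMap_id.snd.snd) (hδp l)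
  · rintro ⟨x, y, t, w⟩ q ⟨hx, hy, ht, hw⟩
    have h1 : Ind q.1.rep q.2.2.1.rep q.2.2.2.rep ↔ Ind x t w :=
      ⟨hIndcoord (isCoord_rep _) hx (isCoord_rep _) ht (isCoord_rep _) hw,
        hIndcoord hx (isCoord_rep _) ht (isCoord_rep _) hw (isCoord_rep _)⟩
    rw [Set.mem_ofPred_eq, h1, hInd_iff]
    push Not
    simp

/-- Density is checked fibre by fibre: above each `m ∈ S` some parameters are nondegenerate, and the
line from the given parameters to those leaves the bad locus generically. Hence `S` may be
reducible. -/
theorem subset_zcl_sdiff_degeneracy [Infinite k]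
    {Ind : E → T → W → Prop} {ι : Type*} (δ : ι → E → T → W → k)
    (hδp : ∀ l, (fun z : E × (T × W) => δ l z.1 z.2.1 z.2.2) ∈ PolyFun k (E × (T × W)))
    (hInd_iff : ∀ x t w, Ind x t w ↔ ∃ l, δ l x t w ≠ 0)
    (hIndcoord : ∀ {x t w x' t' w'} {m : ℙ k E} {p : ℙ k T} {q : ℙ k W},
      HomCoords.IsCoord k x m → HomCoords.IsCoord k x' m → HomCoords.IsCoord k t p →
      HomCoords.IsCoord k t' p → HomCoords.IsCoord k w q → HomCoords.IsCoord k w' q →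
      Ind x t w → Ind x' t' w')
    {S : Set (ℙ k E)} (hsi : ∀ m ∈ S, ∃ t w, t ≠ 0 ∧ w ≠ 0 ∧ Ind m.rep t w)
    {Z : Set (ℙ k E × (Q × (ℙ k T × ℙ k W)))}
    (hZS : ∀ q ∈ Z, q.1 ∈ S) (hZ : ∀ m n p p', (m, n, p) ∈ Z → (m, n, p') ∈ Z) :
    Z ⊆ zcl k (Z \ {q | ¬ Ind q.1.rep q.2.2.1.rep q.2.2.2.rep}) := by
  rintro ⟨m, n, p⟩ hq P hP hPU ⟨x, y, t, w⟩ ⟨hx, hy, ht, hw⟩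
  obtain ⟨t', w', ht', hw', hi⟩ := hsi m (hZS _ hq)
  have hi2 : Ind x t' w' :=
    hIndcoord (isCoord_rep m) hx (isCoord_mk ht') (isCoord_mk ht') (isCoord_mk hw')
      (isCoord_mk hw') hi
  obtain ⟨l, hl⟩ := (hInd_iff _ _ _).1 hi2
  -- The functionals `lt` and `lw` enter the test polynomial to keep both parameter vectors nonzero,
  -- so that they define points of the projective spaces.
  obtain ⟨lt, hlt⟩ : ∃ f : Module.Dual k T, f t' ≠ 0 := by
    by_contra! hc
    exact ht' ((Module.forall_dual_apply_eq_zero_iff k t').1 hc)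
  obtain ⟨lw, hlw⟩ : ∃ f : Module.Dual k W, f w' ≠ 0 := by
    by_contra! hc
    exact hw' ((Module.forall_dual_apply_eq_zero_iff k w').1 hc)
  refine eq_zero_of_line (h := fun z : E × (R × (T × W)) =>
    (δ l z.1 z.2.2.1 z.2.2.2 * lt z.2.2.1) * lw z.2.2.2) hP ?_ (x, y, t, w) (x, y, t', w')
    (mul_ne_zero (mul_ne_zero hl hlt) hlw) fun σ hσ => ?_
  · refine mul_mem_polyFun (mul_mem_polyFun (comp_mem_polyFun
      (P := fun z : E × (R × (T × W)) => (z.1, z.2.2))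
      (isPolyMap_id.fst.prodMk isPolyMap_id.snd.snd) (hδp l)) ?_) ?_
    · exact isPolyMap_id.snd.snd.fst lt
    · exact isPolyMap_id.snd.snd.snd lw
  · have he : ((x, y, t, w) : E × (R × (T × W))) + σ • ((x, y, t', w') - (x, y, t, w)) =
        (x, y, t + σ • (t' - t), w + σ • (w' - w)) := by
      simp
    rw [he] at hσ ⊢
    simp only [mul_ne_zero_iff] at hσ
    obtain ⟨⟨h1, h2⟩, h3⟩ := hσ
    have ht0 : t + σ • (t' - t) ≠ 0 := fun h => h2 (by rw [h, map_zero])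
    have hw0 : w + σ • (w' - w) ≠ 0 := fun h => h3 (by rw [h, map_zero])
    refine hPU (m, n, Projectivization.mk k _ ht0, Projectivization.mk k _ hw0)
      ⟨hZ _ _ _ _ hq, ?_⟩ _ ⟨hx, hy, isCoord_mk ht0, isCoord_mk hw0⟩
    rw [Set.mem_ofPred_eq, not_not]
    exact hIndcoord hx (isCoord_rep _) (isCoord_mk ht0) (isCoord_rep _) (isCoord_mk hw0)
      (isCoord_rep _) ((hInd_iff _ _ _).2 ⟨l, h1⟩)

end Degeneracy

/-! ### Trivializing a projective bundle by sections -/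

section Trivialization

variable {k : Type*} [Field k] {F : Type*} [AddCommGroup F] [Module k F]

/-- This turns independence into the nonvanishing of a minor, an open polynomial condition. The
functionals come from a left inverse of the linear combination map. -/
theorem linearIndependent_iff_exists_det {r : ℕ} (s : Fin r → F) :
    LinearIndependent k s ↔
      ∃ l : Fin r → Module.Dual k F, (Matrix.of fun i j => l i (s j)).det ≠ 0 := by
  constructor
  · intro h
    obtain ⟨g, hg⟩ := (Finsupp.linearCombination k s).exists_leftInverse_of_injective
      (LinearMap.ker_eq_bot.2 h)
    refine ⟨fun i => (Finsupp.lapply i) ∘ₗ g, ?_⟩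
    have : (Matrix.of fun i j => ((Finsupp.lapply i : (Fin r →₀ k) →ₗ[k] k) ∘ₗ g) (s j)) = 1 := by
      ext i j
      have h1 : g (s j) = Finsupp.single j 1 := by
        have := LinearMap.congr_fun hg (Finsupp.single j 1)
        simpa using this
      simp [h1, Matrix.one_apply, Finsupp.single_apply, eq_comm]
    rw [this, Matrix.det_one]
    exact one_ne_zero
  · rintro ⟨l, hl⟩
    rw [Fintype.linearIndependent_iff]
    intro c hc
    have h1 : (Matrix.of fun i j => l i (s j)).mulVec c = 0 := by
      ext i
      have := congrArg (l i) hc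
      simpa [Matrix.mulVec, dotProduct, mul_comm] using this
    have h2 := Matrix.eq_zero_of_mulVec_eq_zero hl h1
    intro i
    rw [h2]; rfl

theorem linearIndependent_smul_iff {r : ℕ} (s : Fin r → F) {c : k} (hc : c ≠ 0) :
    LinearIndependent k (fun j => c • s j) ↔ LinearIndependent k s := by
  constructor
  · intro h
    have := h.units_smul (fun _ => (Units.mk0 c hc)⁻¹)
    convert this using 1
    ext j
    simp [Units.smul_def, hc]
  · intro h
    exact h.units_smul (fun _ => Units.mk0 c hc)

variable {E T W : Type*} [AddCommGroup E] [Module k E] [AddCommGroup T] [Module k T]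
  [AddCommGroup W] [Module k W]
variable {G Gt : Type*} [Group G] [Group Gt] {ext : GmExtension k G Gt}

/-- Trivialization of a projective bundle by sections depending on additional parameters. -/
theorem equivBirational_of_sections [Infinite k] [Nontrivial F] {ε : Gt →* (E ≃ₗ[k] E)}
    {φ : Gt →* (F ≃ₗ[k] F)}
    {τ : Gt →* (W ≃ₗ[k] W)} (hε : GmActsByScalars ext ε) (hφ : GmActsByScalars ext φ)
    (hτ : GmActsByScalars ext τ) {S : Set (ℙ k E)} (hS : ∀ g, ∀ m ∈ S, projAction ext hε g m ∈ S)
    (L : E → Submodule k F) (hLc : ∀ (c : k) (x : E), c ≠ 0 → L (c • x) = L x)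
    (hLg : ∀ (g : Gt) (x : E), ∀ y ∈ L x, φ g y ∈ L (ε g x)) {r : ℕ} (hr : 0 < r)
    (hrank : ∀ m ∈ S, Module.finrank k (L m.rep) = r)
    (s : Fin r → E → T → W → F)
    (hsp : ∀ j, IsPolyMap k fun z : E × (T × W) => s j z.1 z.2.1 z.2.2) {d₁ d₂ d₃ : ℕ}
    (hsh : ∀ j (a b c : k) x t w,
      s j (a • x) (b • t) (c • w) = (a ^ d₁ * b ^ d₂ * c ^ d₃) • s j x t w)
    (hsg : ∀ h : Gt, ∃ c : k, c ≠ 0 ∧ ∀ j x t w, s j (ε h x) t (τ h w) = c • φ h (s j x t w))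
    (hsL : ∀ j, ∀ m ∈ S, ∀ t w, s j m.rep t w ∈ L m.rep)
    (hsi : ∀ m ∈ S, ∃ t w, t ≠ 0 ∧ w ≠ 0 ∧ LinearIndependent k fun j => s j m.rep t w) :
    EquivBirational k
      (prodAction (projAction ext hε) (prodAction (1 : G →* Equiv.Perm (ℙ k (Fin r → k)))
        (prodAction (1 : G →* Equiv.Perm (ℙ k T)) (projAction ext hτ))))
      (S ×ˢ (Set.univ : Set (ℙ k (Fin r → k) × (ℙ k T × ℙ k W))))
      (prodAction (projAction ext hε) (prodAction (projAction ext hφ)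
        (prodAction (1 : G →* Equiv.Perm (ℙ k T)) (projAction ext hτ))))
      {q : ℙ k E × (ℙ k F × (ℙ k T × ℙ k W)) | q.1 ∈ S ∧ q.2.1.rep ∈ L q.1.rep} := by
  classical
  have : Nonempty (Fin r) := ⟨⟨0, hr⟩⟩
  set Ind : E → T → W → Prop := fun x t w => LinearIndependent k fun j => s j x t w with hInd
  set δ : (Fin r → Module.Dual k F) → E → T → W → k :=
    fun l x t w => (Matrix.of fun i j => l i (s j x t w)).det with hδ
  have hInd_iff : ∀ x t w, Ind x t w ↔ ∃ l, δ l x t w ≠ 0 := fun x t w =>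
    linearIndependent_iff_exists_det _
  have hInd_smul : ∀ {a b c : k} {x t w}, a ≠ 0 → b ≠ 0 → c ≠ 0 →
      (Ind (a • x) (b • t) (c • w) ↔ Ind x t w) := by
    intro a b c x t w ha hb hc
    simp only [hInd, hsh]
    exact linearIndependent_smul_iff _
      (mul_ne_zero (mul_ne_zero (pow_ne_zero _ ha) (pow_ne_zero _ hb)) (pow_ne_zero _ hc))
  have hIndcoord : ∀ {x t w x' t' w'} {m : ℙ k E} {p : ℙ k T} {q : ℙ k W},
      HomCoords.IsCoord k x m → HomCoords.IsCoord k x' m → HomCoords.IsCoord k t p →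
      HomCoords.IsCoord k t' p → HomCoords.IsCoord k w q → HomCoords.IsCoord k w' q →
      Ind x t w → Ind x' t' w' := by
    intro x t w x' t' w' m p q hx hx' ht ht' hw hw' h
    obtain ⟨a, ha, rfl⟩ := isCoord_eq_smul hx hx'
    obtain ⟨b, hb, rfl⟩ := isCoord_eq_smul ht ht'
    obtain ⟨c, hc, rfl⟩ := isCoord_eq_smul hw hw'
    exact (hInd_smul ha hb hc).2 h
  have hLcoord : ∀ {x x'} {m : ℙ k E}, HomCoords.IsCoord k x m → HomCoords.IsCoord k x' m →
      L x = L x' := by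
    intro x x' m hx hx'
    obtain ⟨a, ha, rfl⟩ := isCoord_eq_smul hx hx'
    rw [hLc a x ha]
  have hsL' : ∀ {x t w} {m : ℙ k E}, m ∈ S → HomCoords.IsCoord k x m → ∀ j, s j x t w ∈ L x := by
    intro x t w m hm hx j
    obtain ⟨a, ha, rfl⟩ := isCoord_eq_smul (isCoord_rep m) hx
    have := hsh j a 1 1 m.rep t w
    simp only [one_smul] at this
    rw [this, hLc a _ ha]
    exact (L m.rep).smul_mem _ (hsL j m hm t w)
  have hspan : ∀ {x t w} {m : ℙ k E}, m ∈ S → HomCoords.IsCoord k x m → Ind x t w →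
      ∀ y ∈ L x, ∃ c : Fin r → k, ∑ j, c j • s j x t w = y := by
    intro x t w m hm hx hi y hy
    have h1 : Submodule.span k (Set.range fun j => s j x t w) = L x := by
      have hfr : Module.finrank k (L x) = r := by
        rw [hLcoord hx (isCoord_rep m)]; exact hrank m hm
      have : Module.Finite k (L x) := Module.finite_of_finrank_pos (by omega)
      apply Submodule.eq_of_le_of_finrank_eq
      · rw [Submodule.span_le]
        rintro _ ⟨j, rfl⟩
        exact hsL' hm hx j
      · rw [finrank_span_eq_card hi, hfr, Fintype.card_fin]
    rw [← h1, Submodule.mem_span_range_iff_exists_fun] at hy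
    exact hy
  have hδp : ∀ l, (fun z : E × (T × W) => δ l z.1 z.2.1 z.2.2) ∈ PolyFun k (E × (T × W)) :=
    fun l => det_mem_polyFun fun i j => hsp j (l i)
  -- the map and its inverse
  set Φ : ℙ k E × (ℙ k (Fin r → k) × (ℙ k T × ℙ k W)) → ℙ k E × (ℙ k F × (ℙ k T × ℙ k W)) :=
    fun q => (q.1, pointOf (∑ j, q.2.1.rep j • s j q.1.rep q.2.2.1.rep q.2.2.2.rep), q.2.2)
    with hΦ
  -- The fibre coordinates of a point are its coefficients with respect to the sections. The default
  -- `0` is reached only off the domain, because the sections span every fibre on it.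
  set Ψ : ℙ k E × (ℙ k F × (ℙ k T × ℙ k W)) → ℙ k E × (ℙ k (Fin r → k) × (ℙ k T × ℙ k W)) :=
    fun q => (q.1, pointOf (if h : ∃ c : Fin r → k,
      ∑ j, c j • s j q.1.rep q.2.2.1.rep q.2.2.2.rep = q.2.1.rep then h.choose else 0), q.2.2)
    with hΨ
  have hsum_smul : ∀ (a b c e : k) (v : Fin r → k) x t w,
      ∑ j, (e • v) j • s j (a • x) (b • t) (c • w) =
        (e * (a ^ d₁ * b ^ d₂ * c ^ d₃)) • ∑ j, v j • s j x t w := by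
    intro a b c e v x t w
    rw [Finset.smul_sum]
    refine Finset.sum_congr rfl fun j _ => ?_
    rw [hsh, Pi.smul_apply, smul_smul, smul_smul, smul_eq_mul]
    ring_nf
  have hΦc : ∀ q, ∀ x v t w, HomCoords.IsCoord k x q.1 → HomCoords.IsCoord k v q.2.1 →
      HomCoords.IsCoord k t q.2.2.1 → HomCoords.IsCoord k w q.2.2.2 → Ind x t w →
      HomCoords.IsCoord k (∑ j, v j • s j x t w) (Φ q).2.1 := by
    intro q x v t w hx hv ht hw hi
    have hi' : Ind q.1.rep q.2.2.1.rep q.2.2.2.rep :=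
      hIndcoord hx (isCoord_rep _) ht (isCoord_rep _) hw (isCoord_rep _) hi
    obtain ⟨a, ha, rfl⟩ := isCoord_eq_smul (isCoord_rep q.1) hx
    obtain ⟨b, hb, rfl⟩ := isCoord_eq_smul (isCoord_rep q.2.2.1) ht
    obtain ⟨c, hc, rfl⟩ := isCoord_eq_smul (isCoord_rep q.2.2.2) hw
    obtain ⟨e, he, rfl⟩ := isCoord_eq_smul (isCoord_rep q.2.1) hv
    rw [hsum_smul]
    refine isCoord_smul (isCoord_pointOf ?_) (mul_ne_zero he
      (mul_ne_zero (mul_ne_zero (pow_ne_zero _ ha) (pow_ne_zero _ hb)) (pow_ne_zero _ hc)))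
    intro h0
    exact q.2.1.rep_nonzero (funext fun j => Fintype.linearIndependent_iff.1 hi' _ h0 j)
  have hΨc : ∀ q, ∀ x y t w (v : Fin r → k), q.1 ∈ S → HomCoords.IsCoord k x q.1 →
      HomCoords.IsCoord k y q.2.1 →
      HomCoords.IsCoord k t q.2.2.1 → HomCoords.IsCoord k w q.2.2.2 → Ind x t w →
      ∑ j, v j • s j x t w = y → HomCoords.IsCoord k v (Ψ q).2.1 := by
    intro q x y t w v hq hx hy ht hw hi hv
    have hi' : Ind q.1.rep q.2.2.1.rep q.2.2.2.rep :=
      hIndcoord hx (isCoord_rep _) ht (isCoord_rep _) hw (isCoord_rep _) hi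
    obtain ⟨a, ha, rfl⟩ := isCoord_eq_smul (isCoord_rep q.1) hx
    obtain ⟨b, hb, rfl⟩ := isCoord_eq_smul (isCoord_rep q.2.2.1) ht
    obtain ⟨c, hc, rfl⟩ := isCoord_eq_smul (isCoord_rep q.2.2.2) hw
    obtain ⟨e, he, rfl⟩ := isCoord_eq_smul (isCoord_rep q.2.1) hy
    have hu : a ^ d₁ * b ^ d₂ * c ^ d₃ ≠ 0 :=
      mul_ne_zero (mul_ne_zero (pow_ne_zero _ ha) (pow_ne_zero _ hb)) (pow_ne_zero _ hc)
    set u := a ^ d₁ * b ^ d₂ * c ^ d₃ with hudef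
    have hv1 : ∑ j, (e⁻¹ * u) • v j • s j q.1.rep q.2.2.1.rep q.2.2.2.rep = q.2.1.rep := by
      have h1 := hsum_smul a b c 1 v q.1.rep q.2.2.1.rep q.2.2.2.rep
      rw [one_smul, hv, one_mul] at h1
      rw [← Finset.smul_sum, mul_smul, ← h1, smul_smul, inv_mul_cancel₀ he, one_smul]
    have hex : ∃ c : Fin r → k, ∑ j, c j • s j q.1.rep q.2.2.1.rep q.2.2.2.rep = q.2.1.rep :=
      ⟨(e⁻¹ * u) • v, by simpa only [Pi.smul_apply, smul_eq_mul, mul_smul] using hv1⟩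
    have hch : hex.choose = (e⁻¹ * u) • v := by
      have h2 : ∑ j, (hex.choose j - (e⁻¹ * u) * v j) •
          s j q.1.rep q.2.2.1.rep q.2.2.2.rep = 0 := by
        simp only [sub_smul, Finset.sum_sub_distrib]
        rw [hex.choose_spec, sub_eq_zero, ← hv1]
        refine Finset.sum_congr rfl fun j _ => ?_
        rw [mul_smul (e⁻¹ * u)]
      funext j
      exact sub_eq_zero.1 (Fintype.linearIndependent_iff.1 hi' _ h2 j)
    have h0 : hex.choose ≠ 0 := by
      intro h0
      have := hex.choose_spec
      rw [h0] at this
      simp only [Pi.zero_apply, zero_smul, Finset.sum_const_zero] at this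
      exact q.2.1.rep_nonzero this.symm
    have h3 : HomCoords.IsCoord k hex.choose (Ψ q).2.1 := by
      have : (Ψ q).2.1 = pointOf hex.choose := by
        simp only [hΨ, dif_pos hex]
      rw [this]
      exact isCoord_pointOf h0
    have h4 := isCoord_smul h3 (inv_ne_zero (mul_ne_zero (inv_ne_zero he) hu))
    rwa [hch, smul_smul, inv_mul_cancel₀ (mul_ne_zero (inv_ne_zero he) hu), one_smul] at h4
  have hsi' : ∀ m ∈ S, ∃ t w, t ≠ 0 ∧ w ≠ 0 ∧ Ind m.rep t w := hsi
  have hIndg : ∀ (h : Gt) {x t w}, Ind x t w → Ind (ε h x) t (τ h w) := by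
    intro h x t w hi
    obtain ⟨c, hc, hcs⟩ := hsg h
    simp only [hInd, hcs]
    rw [linearIndependent_smul_iff _ hc]
    exact hi.map' (φ h).toLinearMap (LinearMap.ker_eq_bot.2 (φ h).injective)
  refine ⟨_, _, Φ, Ψ, isDenseOpenIn_iff.2 ⟨⟨_, isZariskiClosed_degeneracy δ hδp hInd_iff hIndcoord, rfl⟩, subset_zcl_sdiff_degeneracy δ hδp hInd_iff hIndcoord hsi' ?_ ?_⟩,
    isDenseOpenIn_iff.2 ⟨⟨_, isZariskiClosed_degeneracy δ hδp hInd_iff hIndcoord, rfl⟩, subset_zcl_sdiff_degeneracy δ hδp hInd_iff hIndcoord hsi' ?_ ?_⟩, ?_, ?_, ?_, ?_, ?_, ?_, ?_, ?_,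
    ?_⟩
  · exact fun q hq => hq.1
  · exact fun m n p p' hq => ⟨hq.1, trivial⟩
  · exact fun q hq => hq.1
  · exact fun m n p p' hq => hq
  · rintro q ⟨⟨hq, -⟩, hi⟩
    rw [Set.mem_ofPred_eq, not_not] at hi
    refine ⟨⟨hq, ?_⟩, by rw [Set.mem_ofPred_eq, not_not]; exact hi⟩
    have h1 := hΦc q _ _ _ _ (isCoord_rep _) (isCoord_rep _) (isCoord_rep _) (isCoord_rep _) hi
    obtain ⟨a, ha, h2⟩ := isCoord_eq_smul h1 (isCoord_rep _)
    rw [h2]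
    exact (L _).smul_mem _ ((L _).sum_mem fun j _ => (L _).smul_mem _ (hsL j _ hq _ _))
  · rintro q ⟨⟨hq, -⟩, hi⟩
    exact ⟨⟨hq, trivial⟩, hi⟩
  · rintro q ⟨⟨hq, -⟩, hi⟩
    rw [Set.mem_ofPred_eq, not_not] at hi
    have h1 := hΦc q _ _ _ _ (isCoord_rep _) (isCoord_rep _) (isCoord_rep _) (isCoord_rep _) hi
    have h2 := hΨc (Φ q) _ _ _ _ q.2.1.rep hq (isCoord_rep _) h1 (isCoord_rep _) (isCoord_rep _)
      hi rfl
    refine Prod.ext rfl (Prod.ext ?_ rfl)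
    exact NiceCoords.unique _ _ _ h2 (isCoord_rep _)
  · rintro q ⟨⟨hq, hy⟩, hi⟩
    rw [Set.mem_ofPred_eq, not_not] at hi
    obtain ⟨v, hv⟩ := hspan hq (isCoord_rep _) hi _ hy
    have h1 := hΨc q _ _ _ _ v hq (isCoord_rep _) (isCoord_rep _) (isCoord_rep _) (isCoord_rep _)
      hi hv
    have h2 := hΦc (Ψ q) _ _ _ _ (isCoord_rep _) h1 (isCoord_rep _) (isCoord_rep _) hi
    refine Prod.ext rfl (Prod.ext ?_ rfl)
    refine NiceCoords.unique _ _ _ h2 ?_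
    have : ∑ j, v j • s j (Ψ q).1.rep (Ψ q).2.2.1.rep (Ψ q).2.2.2.rep = q.2.1.rep := hv
    rw [this]
    exact isCoord_rep _
  · rintro q ⟨⟨hq, -⟩, hi⟩
    refine ⟨∅, isZariskiClosed_empty, by simp,
      fun z => (z.1, ∑ j, z.2.1 j • s j z.1 z.2.2.1 z.2.2.2, z.2.2), ?_, ?_⟩
    · refine isPolyMap_id.fst.prodMk ((IsPolyMap.sum _ fun j _ => IsPolyMap.smul ?_ ?_).prodMk
        isPolyMap_id.snd.snd)
      · exact isPolyMap_id.snd.fst (LinearMap.proj j : Module.Dual k (Fin r → k))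
      · exact (hsp j).comp (P := fun z : E × ((Fin r → k) × (T × W)) => (z.1, z.2.2))
          (isPolyMap_id.fst.prodMk isPolyMap_id.snd.snd)
    · rintro q' ⟨⟨⟨hq', -⟩, hi'⟩, -⟩ ⟨x, v, t, w⟩ ⟨hx, hv, ht, hw⟩
      rw [Set.mem_ofPred_eq, not_not] at hi'
      exact ⟨hx, hΦc q' x v t w hx hv ht hw (hIndcoord (isCoord_rep _) hx (isCoord_rep _) ht
        (isCoord_rep _) hw hi'), ht, hw⟩
  · rintro q ⟨⟨hq, hy⟩, hi⟩
    rw [Set.mem_ofPred_eq, not_not, hInd_iff] at hi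
    obtain ⟨l, hl⟩ := hi
    have hδc : ∀ {a b c : k} {x t w}, δ l (a • x) (b • t) (c • w) =
        (a ^ d₁ * b ^ d₂ * c ^ d₃) ^ r * δ l x t w := by
      intro a b c x t w
      simp only [hδ, hsh, map_smul]
      have h := Matrix.det_smul (Matrix.of fun i j => l i (s j x t w)) (a ^ d₁ * b ^ d₂ * c ^ d₃)
      rw [Fintype.card_fin] at h
      exact h
    -- Cramer's rule: where the minor chosen by `l` is nonzero, its adjugate returns the
    -- coefficients multiplied by `δ l`, so the inverse is given by polynomials in the coordinates.
    refine ⟨{q' | δ l q'.1.rep q'.2.2.1.rep q'.2.2.2.rep = 0},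
      ⟨{fun z => δ l z.1 z.2.2.1 z.2.2.2}, ?_, ?_⟩, hl, fun z => (z.1,
        (Matrix.of fun i j => l i (s j z.1 z.2.2.1 z.2.2.2)).adjugate.mulVec fun i => l i z.2.1,
        z.2.2), ?_, ?_⟩
    · rintro _ rfl
      exact comp_mem_polyFun (P := fun z : E × (F × (T × W)) => (z.1, z.2.2))
        (isPolyMap_id.fst.prodMk isPolyMap_id.snd.snd) (hδp l)
    · rintro ⟨x, y, t, w⟩ q' ⟨hx, hy, ht, hw⟩
      obtain ⟨a, ha, h1⟩ := isCoord_eq_smul (isCoord_rep q'.1) hx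
      obtain ⟨b, hb, h2⟩ := isCoord_eq_smul (isCoord_rep q'.2.2.1) ht
      obtain ⟨c, hc, h3⟩ := isCoord_eq_smul (isCoord_rep q'.2.2.2) hw
      simp only at h1 h2 h3
      simp only [Set.mem_singleton_iff, forall_eq, h1, h2, h3, hδc]
      simp [ha, hb, hc]
    · refine isPolyMap_id.fst.prodMk ((IsPolyMap.pi fun i => ?_).prodMk isPolyMap_id.snd.snd)
      simp only [Matrix.mulVec, dotProduct]
      refine sum_mem_polyFun _ fun j _ => mul_mem_polyFun ?_ ?_
      · exact adjugate_mem_polyFun (fun i j => comp_mem_polyFun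
          (P := fun z : E × (F × (T × W)) => (z.1, z.2.2))
          (isPolyMap_id.fst.prodMk isPolyMap_id.snd.snd) (hsp j (l i))) _ _
      · exact isPolyMap_id.snd.fst (l j)
    · rintro q' ⟨⟨⟨hq', hy'⟩, hi'⟩, hδ'⟩ ⟨x, y, t, w⟩ ⟨hx, hy2, ht, hw⟩
      rw [Set.mem_ofPred_eq, not_not] at hi'
      refine ⟨hx, ?_, ht, hw⟩
      have hi2 : Ind x t w := hIndcoord (isCoord_rep _) hx (isCoord_rep _) ht
        (isCoord_rep _) hw hi'
      have hyL : y ∈ L x := by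
        obtain ⟨a, ha, h1⟩ := isCoord_eq_smul (isCoord_rep q'.2.1) hy2
        simp only at h1
        rw [hLcoord hx (isCoord_rep _), h1]
        exact (L _).smul_mem _ hy'
      obtain ⟨v, hv⟩ := hspan hq' hx hi2 y hyL
      have h1 := hΨc q' x y t w v hq' hx hy2 ht hw hi2 hv
      have hδ2 : δ l x t w ≠ 0 := by
        obtain ⟨a, ha, h1⟩ := isCoord_eq_smul (isCoord_rep q'.1) hx
        obtain ⟨b, hb, h2⟩ := isCoord_eq_smul (isCoord_rep q'.2.2.1) ht
        obtain ⟨c, hc, h3⟩ := isCoord_eq_smul (isCoord_rep q'.2.2.2) hw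
        simp only at h1 h2 h3
        rw [h1, h2, h3, hδc]
        exact mul_ne_zero (pow_ne_zero _ (mul_ne_zero (mul_ne_zero (pow_ne_zero _ ha)
          (pow_ne_zero _ hb)) (pow_ne_zero _ hc))) hδ'
      have h2 : (fun i => l i y) = (Matrix.of fun i j => l i (s j x t w)).mulVec v := by
        funext i
        rw [← hv]
        simp [Matrix.mulVec, dotProduct, mul_comm]
      simp only [h2]
      rw [Matrix.mulVec_mulVec, Matrix.adjugate_mul, Matrix.smul_mulVec, Matrix.one_mulVec]
      exact isCoord_smul h1 hδ2
  · rintro γ q ⟨⟨hq, -⟩, hi⟩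
    obtain ⟨g, rfl⟩ := ext.proj_surjective γ
    rw [Set.mem_ofPred_eq, not_not] at hi
    refine ⟨⟨hS _ _ hq, trivial⟩, ?_⟩
    rw [Set.mem_ofPred_eq, not_not]
    exact hIndcoord (isCoord_projAction hε g (isCoord_rep _)) (isCoord_rep _) (isCoord_rep _)
      (isCoord_rep _) (isCoord_projAction hτ g (isCoord_rep _)) (isCoord_rep _) (hIndg g hi)
  · rintro γ q ⟨⟨hq, hy⟩, hi⟩
    obtain ⟨g, rfl⟩ := ext.proj_surjective γ
    rw [Set.mem_ofPred_eq, not_not] at hi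
    refine ⟨⟨hS _ _ hq, ?_⟩, ?_⟩
    · have h1 := hLg g _ _ hy
      rw [hLcoord (isCoord_projAction hε g (isCoord_rep _)) (isCoord_rep _)] at h1
      obtain ⟨a, ha, h2⟩ := isCoord_eq_smul (isCoord_projAction hφ g (isCoord_rep q.2.1))
        (isCoord_rep _)
      have h3 := (L (projAction ext hε (ext.proj g) q.1).rep).smul_mem a h1
      rw [← h2] at h3
      exact h3
    · rw [Set.mem_ofPred_eq, not_not]
      exact hIndcoord (isCoord_projAction hε g (isCoord_rep _)) (isCoord_rep _) (isCoord_rep _)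
        (isCoord_rep _) (isCoord_projAction hτ g (isCoord_rep _)) (isCoord_rep _) (hIndg g hi)
  · rintro γ q ⟨⟨hq, -⟩, hi⟩
    obtain ⟨g, rfl⟩ := ext.proj_surjective γ
    rw [Set.mem_ofPred_eq, not_not] at hi
    refine Prod.ext rfl (Prod.ext ?_ rfl)
    have h1 := hΦc q _ _ _ _ (isCoord_rep _) (isCoord_rep _) (isCoord_rep _) (isCoord_rep _) hi
    have h2 := isCoord_projAction hφ g h1
    have h3 := hΦc (prodAction (projAction ext hε)
      (prodAction (1 : G →* Equiv.Perm (ℙ k (Fin r → k)))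
        (prodAction (1 : G →* Equiv.Perm (ℙ k T)) (projAction ext hτ))) (ext.proj g) q) _ _ _ _
      (isCoord_projAction hε g (isCoord_rep q.1)) (isCoord_rep q.2.1) (isCoord_rep q.2.2.1)
      (isCoord_projAction hτ g (isCoord_rep q.2.2.2)) (hIndg g hi)
    obtain ⟨c, hc, hcs⟩ := hsg g
    have h4 : ∑ j, q.2.1.rep j • s j (ε g q.1.rep) q.2.2.1.rep (τ g q.2.2.2.rep) =
        c • φ g (∑ j, q.2.1.rep j • s j q.1.rep q.2.2.1.rep q.2.2.2.rep) := by
      simp only [hcs, map_sum, map_smul, Finset.smul_sum]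
      refine Finset.sum_congr rfl fun j _ => smul_comm _ _ _
    rw [h4] at h3
    exact NiceCoords.unique _ _ _ h3 (isCoord_smul h2 hc)

end Trivialization

/-! ### Central weights of a faithful representation -/

section Weights

variable {k G Gt : Type*} [Field k] [Group G] [Group Gt] {ext : GmExtension k G Gt}
variable {W : Type*} [AddCommGroup W] [Module k W]

/-- The central character of a faithful representation has weight `1` or `-1`. -/
theorem weight_sq_eq_one [IsAlgClosed k] [CharZero k] {τ : Gt →* (W ≃ₗ[k] W)}
    (hτi : Function.Injective τ) {m : ℤ}
    (hm : ∀ (z : kˣ) (v : W), τ (ext.incl z) v = ((z ^ m : kˣ) : k) • v) : m * m = 1 := by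
  have key : ∀ z : kˣ, z ^ m = 1 → z = 1 := by
    intro z hz
    apply ext.incl_injective
    rw [map_one]
    apply hτi
    rw [map_one]
    ext v
    rw [hm, hz]
    simp
  have hm0 : m ≠ 0 := by
    rintro rfl
    have h := key (Units.mk0 (2 : k) two_ne_zero) (by simp)
    have h2 : (2 : k) = 1 := congrArg Units.val h
    norm_num at h2
  have hn : m.natAbs ≠ 0 := Int.natAbs_ne_zero.2 hm0
  have : NeZero (m.natAbs : k) := ⟨Nat.cast_ne_zero.2 hn⟩
  have : NeZero m.natAbs := ⟨hn⟩
  -- A primitive root of unity of order `|m|` is killed by the central character, so faithfulness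
  -- forces it to be `1` and `|m| = 1`.
  obtain ⟨z, hz⟩ := HasEnoughRootsOfUnity.exists_primitiveRoot k m.natAbs
  have hzu : z ^ m.natAbs = 1 := hz.pow_eq_one
  have hz0 : z ≠ 0 := hz.ne_zero hn
  have h1 : (Units.mk0 z hz0) ^ m = 1 := by
    have h2 : (Units.mk0 z hz0) ^ m.natAbs = 1 := Units.ext (by simpa using hzu)
    rcases Int.natAbs_eq m with h | h
    · rw [h, zpow_natCast, h2]
    · rw [h, zpow_neg, zpow_natCast, h2, inv_one]
  have h3 : z = 1 := congrArg Units.val (key _ h1)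
  have h4 : m.natAbs = 1 := by
    rw [h3] at hz
    exact hz.unique IsPrimitiveRoot.one
  rcases Int.natAbs_eq m with h | h <;> rw [h, h4] <;> norm_num

theorem nontrivial_of_faithful [CharZero k] {τ : Gt →* (W ≃ₗ[k] W)}
    (hτi : Function.Injective τ) (ext : GmExtension k G Gt) : Nontrivial W := by
  by_contra hW
  rw [not_nontrivial_iff_subsingleton] at hW
  have h : ext.incl (Units.mk0 (2 : k) two_ne_zero) = ext.incl 1 := by
    apply hτi
    ext v
    exact Subsingleton.elim _ _
  have h2 : (2 : k) = 1 := congrArg Units.val (ext.incl_injective h)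
  norm_num at h2

/-- Powers of the determinant of a faithful representation correct the central weights. -/
theorem exists_twist [IsAlgClosed k] [CharZero k] [FiniteDimensional k W]
    {τ : Gt →* (W ≃ₗ[k] W)} (hτi : Function.Injective τ) {m : ℤ}
    (hm : ∀ (z : kˣ) (v : W), τ (ext.incl z) v = ((z ^ m : kˣ) : k) • v) (N : ℕ) (a : ℤ) :
    ∃ d : ℕ, N ≤ d ∧ ∃ χ : Gt →* kˣ, ∀ z : kˣ, χ (ext.incl z) = z ^ (a - m * d) := by
  have hmm := weight_sq_eq_one hτi hm
  have := nontrivial_of_faithful hτi ext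
  have hn : 0 < Module.finrank k W := Module.finrank_pos
  set n := Module.finrank k W with hndef
  -- The determinant has central weight `m * n`. Since `m * m = 1`, taking `d = m * a + n * Q` gives
  -- `a - m * d = -(m * n * Q)`, the weight of `det ^ (-Q)`; this `Q` is large enough for `d ≥ N`.
  set Q : ℕ := N + (m * a).natAbs with hQ
  have hnonneg : (N : ℤ) ≤ m * a + n * Q := by
    have h1 : (Q : ℤ) ≤ n * Q := by
      have : (1 : ℤ) ≤ n := by exact_mod_cast hn
      nlinarith [Int.natCast_nonneg Q]
    have h2 : (Q : ℤ) = N + |m * a| := by rw [hQ]; push_cast; simp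
    have h3 := neg_abs_le (m * a)
    linarith
  refine ⟨(m * a + n * Q).toNat, by omega,
    (zpowGroupHom (-(Q : ℤ))).comp (LinearEquiv.det.comp τ), fun z => ?_⟩
  have hdet : LinearEquiv.det (τ (ext.incl z)) = (z ^ m) ^ n := by
    apply Units.ext
    rw [LinearEquiv.coe_det, show ((τ (ext.incl z) : W ≃ₗ[k] W) : W →ₗ[k] W) =
      ((z ^ m : kˣ) : k) • LinearMap.id from LinearMap.ext (hm z), LinearMap.det_smul]
    simp [hndef]
  have hd : (((m * a + n * Q).toNat : ℕ) : ℤ) = m * a + n * Q :=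
    Int.toNat_of_nonneg (le_trans (Int.natCast_nonneg N) hnonneg)
  change (LinearEquiv.det (τ (ext.incl z))) ^ (-(Q : ℤ)) = _
  rw [hdet, hd, ← zpow_natCast, ← zpow_mul, ← zpow_mul]
  congr 1
  linear_combination (a) * hmm

end Weights

/-! ### Separating a free orbit by a polynomial -/

section Separation

variable {k G Gt : Type*} [Field k] [Group G] [Group Gt] {ext : GmExtension k G Gt}
variable {W : Type*} [AddCommGroup W] [Module k W]

/-- A chosen lift of a group element. -/
def GmExtension.lift (ext : GmExtension k G Gt) : G → Gt :=
  Function.surjInv ext.proj_surjective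

@[simp]
theorem GmExtension.proj_lift (ext : GmExtension k G Gt) (γ : G) : ext.proj (ext.lift γ) = γ :=
  Function.surjInv_eq ext.proj_surjective γ

theorem GmExtension.exists_of_proj_eq (ext : GmExtension k G Gt) {g h : Gt}
    (hgh : ext.proj g = ext.proj h) : ∃ z : kˣ, h = g * ext.incl z := by
  have h1 : g⁻¹ * h ∈ ext.proj.ker := by
    rw [MonoidHom.mem_ker, map_mul, map_inv, hgh, inv_mul_cancel]
  rw [ext.ker_proj] at h1
  obtain ⟨z, hz⟩ := h1
  exact ⟨z, by rw [hz, mul_inv_cancel_left]⟩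

/-- A generic orbit can be separated by homogeneous polynomials of every large degree. -/
theorem exists_separating_polynomial [Finite G] [Nontrivial W] {τ : Gt →* (W ≃ₗ[k] W)}
    (hτ : GmActsByScalars ext τ) (hfree : GenericallyFree k (projAction ext hτ) Set.univ) :
    ∃ w₀ : W, w₀ ≠ 0 ∧ ∀ d : ℕ, Nat.card G ≤ d → ∃ p : W → k, p ∈ PolyFun k W ∧
      (∀ (c : k) (w : W), p (c • w) = c ^ d * p w) ∧ p w₀ ≠ 0 ∧
      ∀ g : Gt, ext.proj g ≠ 1 → p ((τ g).symm w₀) = 0 := by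
  classical
  have := Fintype.ofFinite G
  obtain ⟨U, hU, hUf⟩ := hfree
  obtain ⟨m, hm⟩ : U.Nonempty := by
    by_contra hU0
    rw [Set.not_nonempty_iff_eq_empty] at hU0
    have h1 := hU.2 ∅ isZariskiClosed_empty hU0.le
    obtain ⟨w, hw⟩ := exists_ne (0 : W)
    exact h1 (Set.mem_univ (Projectivization.mk k w hw))
  have hsep : ∀ γ : G, ∃ l : Module.Dual k W, l m.rep ≠ 0 ∧
      (γ ≠ 1 → l ((τ (ext.lift γ)).symm m.rep) = 0) := by
    intro γ
    -- If the two vectors were proportional, `γ` would fix the point `m`, whose stabilizer is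
    -- trivial.
    have hγ : γ ≠ 1 → m.rep ∉ Submodule.span k {(τ (ext.lift γ)).symm m.rep} := by
      intro hγ hmem
      obtain ⟨c, hc⟩ := Submodule.mem_span_singleton.1 hmem
      apply hγ
      apply hUf m hm
      have h1 := isCoord_projAction hτ (ext.lift γ) (isCoord_rep m)
      rw [ext.proj_lift] at h1
      have hc0 : c ≠ 0 := by
        rintro rfl
        rw [zero_smul] at hc
        exact m.rep_nonzero hc.symm
      have h2 : τ (ext.lift γ) m.rep = c • m.rep := by
        conv_lhs => rw [← hc, map_smul, LinearEquiv.apply_symm_apply]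
      rw [h2] at h1
      exact NiceCoords.unique _ _ _ h1 (isCoord_smul (isCoord_rep m) hc0)
    by_cases h : γ = 1
    · obtain ⟨l, hl⟩ : ∃ f : Module.Dual k W, f m.rep ≠ 0 := by
        by_contra! hc
        exact m.rep_nonzero ((Module.forall_dual_apply_eq_zero_iff k _).1 hc)
      exact ⟨l, hl, fun h' => absurd h h'⟩
    · obtain ⟨l, hl, hl'⟩ := Submodule.exists_le_ker_of_notMem (hγ h)
      exact ⟨l, hl, fun _ => hl' (Submodule.mem_span_singleton_self _)⟩
  choose l hl hl' using hsep
  -- There is one linear form per group element, the form of `γ ≠ 1` vanishing on the translate of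
  -- `m.rep` by `γ⁻¹`. The power of `l 1` pads the degree up to `d`.
  refine ⟨m.rep, m.rep_nonzero, fun d hd => ⟨fun w => (∏ γ, l γ w) * l 1 w ^ (d - Nat.card G),
    ?_, ?_, ?_, ?_⟩⟩
  · exact mul_mem_polyFun (prod_mem_polyFun _ fun γ _ => dual_mem_polyFun _)
      (pow_mem_polyFun (dual_mem_polyFun _) _)
  · intro c w
    simp only [map_smul, smul_eq_mul, Finset.prod_mul_distrib, Finset.prod_const,
      Finset.card_univ, mul_pow]
    rw [← Nat.card_eq_fintype_card]
    conv_rhs => rw [← Nat.add_sub_cancel' hd, pow_add]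
    rw [Nat.add_sub_cancel_left]
    ring
  · exact mul_ne_zero (Finset.prod_ne_zero_iff.2 fun γ _ => hl γ) (pow_ne_zero _ (hl 1))
  · intro g hg
    obtain ⟨z, hz⟩ := ext.exists_of_proj_eq (ext.proj_lift (ext.proj g))
    obtain ⟨n, hn⟩ := hτ
    have h1 : (τ g).symm m.rep = ((z ^ n : kˣ) : k)⁻¹ • (τ (ext.lift (ext.proj g))).symm m.rep := by
      have h2 : ∀ v, τ g v = ((z ^ n : kˣ) : k) • τ (ext.lift (ext.proj g)) v := by
        intro v
        conv_lhs => rw [hz, map_mul, LinearEquiv.mul_apply, hn, map_smul]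
      rw [LinearEquiv.symm_apply_eq, h2, map_smul, LinearEquiv.apply_symm_apply, smul_smul,
        mul_inv_cancel₀ (Units.ne_zero _), one_smul]
    refine mul_eq_zero_of_left (Finset.prod_eq_zero (Finset.mem_univ (ext.proj g)) ?_) _
    rw [h1, map_smul, hl' _ hg, smul_zero]

end Separation

/-! ### Generic combinations along a monomial curve -/

section Independence

variable {k : Type*} [Field k] {F : Type*} [AddCommGroup F] [Module k F]

/-- Vectors on a suitable monomial curve are generically independent. -/
theorem exists_linearIndependent_monomial [Infinite k] {n r : ℕ} (v : Fin n → F)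
    (hr : Module.finrank k (Submodule.span k (Set.range v)) = r) :
    ∃ u : k, LinearIndependent k fun j : Fin r => ∑ a : Fin n, u ^ ((a : ℕ) * n ^ (j : ℕ)) • v a := by
  classical
  have : Module.Finite k (Submodule.span k (Set.range v)) :=
    FiniteDimensional.span_of_finite k (Set.finite_range v)
  obtain ⟨f, hf, hfi⟩ : ∃ f : Fin r → F, (∀ j, f j ∈ Set.range v) ∧ LinearIndependent k f := by
    subst hr
    obtain ⟨f, hf, -, hfi⟩ := Submodule.exists_fun_fin_finrank_span_eq k (Set.range v)
    exact ⟨f, hf, hfi⟩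
  choose b hb using hf
  have hb' : f = fun j => v (b j) := funext fun j => (hb j).symm
  rw [hb'] at hfi
  obtain ⟨l, hl⟩ := (linearIndependent_iff_exists_det _).1 hfi
  set D : (Fin r → Fin n) → k := fun α => (Matrix.of fun j i => l i (v (α j))).det with hD
  -- The multilinear expansion of the determinant gives the term of `α` the exponent with base `n`
  -- digits `α j`. Distinct `α` have distinct exponents, so the nonzero minor `D b` survives as a
  -- coefficient.
  set P : Polynomial k := ∑ α : Fin r → Fin n,
    Polynomial.C (D α) * Polynomial.X ^ (finFunctionFinEquiv α : ℕ) with hP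
  have hP0 : P ≠ 0 := by
    intro h0
    have h1 : P.coeff (finFunctionFinEquiv b : ℕ) = D b := by
      rw [hP, Polynomial.finsetSum_coeff]
      simp only [Polynomial.coeff_C_mul_X_pow]
      rw [Finset.sum_eq_single b]
      · simp
      · intro α _ hα
        rw [if_neg]
        intro h
        exact hα (finFunctionFinEquiv.injective (Fin.ext h)).symm
      · simp
    rw [h0, Polynomial.coeff_zero] at h1
    apply hl
    rw [← Matrix.det_transpose]
    exact h1.symm
  obtain ⟨u, hu⟩ : ∃ u, P.eval u ≠ 0 := by
    by_contra! hc
    exact hP0 (Polynomial.funext fun x => by rw [hc x, Polynomial.eval_zero])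
  refine ⟨u, (linearIndependent_iff_exists_det _).2 ⟨l, ?_⟩⟩
  rw [← Matrix.det_transpose]
  convert hu using 1
  rw [hP, Polynomial.eval_finsetSum]
  have h1 := (Matrix.detRowAlternating : (Fin r → k) [⋀^Fin r]→ₗ[k] k).toMultilinearMap.map_sum
    (fun (j : Fin r) (a : Fin n) => fun i => u ^ ((a : ℕ) * n ^ (j : ℕ)) • l i (v a))
  have h2 : (Matrix.of fun i (j : Fin r) => l i (∑ a : Fin n, u ^ ((a : ℕ) * n ^ (j : ℕ)) • v a)).transpose =
      fun (j : Fin r) => ∑ a : Fin n, fun i => u ^ ((a : ℕ) * n ^ (j : ℕ)) • l i (v a) := by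
    ext j i
    simp [Finset.sum_apply]
  rw [h2]
  refine h1.trans (Finset.sum_congr rfl fun α _ => ?_)
  have h3 := (Matrix.detRowAlternating : (Fin r → k) [⋀^Fin r]→ₗ[k] k).toMultilinearMap.map_smul_univ
    (fun j => u ^ ((α j : ℕ) * n ^ (j : ℕ))) (fun j i => l i (v (α j)))
  refine h3.trans ?_
  rw [Polynomial.eval_mul, Polynomial.eval_C, Polynomial.eval_pow, Polynomial.eval_X, mul_comm,
    finFunctionFinEquiv_apply, smul_eq_mul, Finset.prod_pow_eq_pow_sum]
  rfl

end Independence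

/-! ### The equivariant no-name lemma -/

section NoName

variable {k G Gt : Type*} [Field k] [Group G] [Group Gt] {ext : GmExtension k G Gt}
variable {E F W : Type*} [AddCommGroup E] [Module k E] [AddCommGroup F] [Module k F]
  [AddCommGroup W] [Module k W]

/-- One summand of the averaged section: the transform by `g` of a section `κ` weighted by the
polynomial `p`. -/
def translatedSection (ε : Gt →* (E ≃ₗ[k] E)) (φ : Gt →* (F ≃ₗ[k] F)) (τ : Gt →* (W ≃ₗ[k] W))
    (χ : Gt →* kˣ) (p : W → k) {n : ℕ} (κ : Fin n → E → F) (r : ℕ) (g : Gt) (j : ℕ)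
    (x : E) (t : Fin 2 → k) (w : W) : F :=
  (((χ g)⁻¹ : kˣ) * p ((τ g).symm w) : k) •
    φ g (∑ a : Fin n, (t 0 ^ (n ^ r - (a : ℕ) * n ^ j) * t 1 ^ ((a : ℕ) * n ^ j)) • κ a ((ε g).symm x))

variable {ε : Gt →* (E ≃ₗ[k] E)} {φ : Gt →* (F ≃ₗ[k] F)} {τ : Gt →* (W ≃ₗ[k] W)}
  {χ : Gt →* kˣ} {p : W → k} {n : ℕ} {κ : Fin n → E → F}

theorem symm_apply_of_scalar {ε : Gt →* (E ≃ₗ[k] E)} {e : ℤ}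
    (he : ∀ (z : kˣ) (v : E), ε (ext.incl z) v = ((z ^ e : kˣ) : k) • v) (g : Gt) (z : kˣ) (x : E) :
    (ε (g * ext.incl z)).symm x = ((z ^ (-e) : kˣ) : k) • (ε g).symm x := by
  rw [LinearEquiv.symm_apply_eq, map_mul, LinearEquiv.mul_apply, he, map_smul, map_smul, smul_smul,
    LinearEquiv.apply_symm_apply, ← Units.val_mul, ← zpow_add, add_neg_cancel, zpow_zero,
    Units.val_one, one_smul]

/-- The central weights of `χ`, `p`, `κ` and `φ` cancel. The summand thus depends only on the image
of the group element in the finite group `G`, over which one can sum. -/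
theorem translatedSection_mul_incl {e f m : ℤ} {d D : ℕ}
    (he : ∀ (z : kˣ) (v : E), ε (ext.incl z) v = ((z ^ e : kˣ) : k) • v)
    (hf : ∀ (z : kˣ) (v : F), φ (ext.incl z) v = ((z ^ f : kˣ) : k) • v)
    (hm : ∀ (z : kˣ) (v : W), τ (ext.incl z) v = ((z ^ m : kˣ) : k) • v)
    (hχ : ∀ z : kˣ, χ (ext.incl z) = z ^ (f - e * D - m * d))
    (hp : ∀ (c : k) (w : W), p (c • w) = c ^ d * p w)
    (hκ : ∀ a (c : k) x, κ a (c • x) = c ^ D • κ a x) (r : ℕ) (g : Gt) (z : kˣ) (j : ℕ)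
    (x : E) (t : Fin 2 → k) (w : W) :
    translatedSection ε φ τ χ p κ r (g * ext.incl z) j x t w =
      translatedSection ε φ τ χ p κ r g j x t w := by
  have h1 : ∀ y, φ (g * ext.incl z) y = ((z ^ f : kˣ) : k) • φ g y := by
    intro y
    rw [map_mul, LinearEquiv.mul_apply, hf, map_smul]
  simp only [translatedSection]
  rw [h1, symm_apply_of_scalar hm, hp, symm_apply_of_scalar he]
  simp only [hκ]
  simp_rw [smul_comm _ (((z ^ (-e) : kˣ) : k) ^ D)]
  rw [← Finset.smul_sum, map_smul, smul_smul, smul_smul]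
  congr 1
  have h2 : ((χ (g * ext.incl z))⁻¹ * (z ^ (-m)) ^ d * z ^ f * (z ^ (-e)) ^ D : kˣ) = (χ g)⁻¹ := by
    rw [map_mul, hχ, mul_inv, mul_assoc, mul_assoc, mul_assoc, ← zpow_natCast, ← zpow_natCast,
      ← zpow_mul, ← zpow_mul, ← zpow_neg, ← zpow_add, ← zpow_add, ← zpow_add]
    rw [show -(f - e * (D : ℤ) - m * d) + (-m * d + (f + -e * D)) = 0 by ring, zpow_zero, mul_one]
  have h3 := congrArg Units.val h2
  push_cast at h3 ⊢
  rw [← h3]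
  ring

/-- The exponents of `t 0` and `t 1` add up to `n ^ r` for every `a` and `j`, so all sections have
the same degree in `t`. The bound `j < r` keeps the natural subtraction honest. -/
theorem translatedSection_smul {d D : ℕ} (hp : ∀ (c : k) (w : W), p (c • w) = c ^ d * p w)
    (hκ : ∀ a (c : k) x, κ a (c • x) = c ^ D • κ a x) {r : ℕ} (g : Gt) {j : ℕ} (hj : j < r)
    (a b c : k) (x : E) (t : Fin 2 → k) (w : W) :
    translatedSection ε φ τ χ p κ r g j (a • x) (b • t) (c • w) =
      (a ^ D * b ^ (n ^ r) * c ^ d) • translatedSection ε φ τ χ p κ r g j x t w := by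
  simp only [translatedSection, map_smul, hp, hκ, Pi.smul_apply, smul_eq_mul]
  have h : ∀ i : Fin n, ((b * t 0) ^ (n ^ r - i * n ^ j) * (b * t 1) ^ ((i : ℕ) * n ^ j)) •
      a ^ D • κ i ((ε g).symm x) =
      (a ^ D * b ^ n ^ r) • ((t 0 ^ (n ^ r - i * n ^ j) * t 1 ^ ((i : ℕ) * n ^ j)) •
        κ i ((ε g).symm x)) := by
    intro i
    have hle : (i : ℕ) * n ^ j ≤ n ^ r := by
      calc (i : ℕ) * n ^ j ≤ n * n ^ j := Nat.mul_le_mul_right _ i.2.le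
        _ = n ^ (j + 1) := by rw [pow_succ, mul_comm]
        _ ≤ n ^ r := Nat.pow_le_pow_right (Nat.lt_of_le_of_lt (Nat.zero_le _) i.2) hj
    rw [smul_smul, smul_smul]
    congr 1
    rw [mul_pow, mul_pow]
    conv_rhs => rw [← Nat.sub_add_cancel hle, pow_add]
    rw [Nat.sub_add_cancel hle]
    ring
  simp_rw [h]
  rw [← Finset.smul_sum, map_smul, smul_smul, smul_smul]
  congr 1
  ring

theorem symm_apply_apply_of_mul (σ : Gt →* (E ≃ₗ[k] E)) (g h : Gt) (u : E) :
    (σ g).symm (σ h u) = (σ (h⁻¹ * g)).symm u := by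
  rw [LinearEquiv.symm_apply_eq]
  have h2 : ∀ y, σ g y = σ h (σ (h⁻¹ * g) y) := by
    intro y
    rw [← LinearEquiv.mul_apply, ← map_mul, mul_inv_cancel_left]
  rw [h2, LinearEquiv.apply_symm_apply]

/-- Moving the arguments by `h` permutes the summands up to the factor `χ(h)⁻¹`. This factor is the
same for all `j`, hence invisible in projective coordinates. -/
theorem translatedSection_equivariant (r : ℕ) (g h : Gt) (j : ℕ) (x : E) (t : Fin 2 → k) (w : W) :
    translatedSection ε φ τ χ p κ r g j (ε h x) t (τ h w) =
      (((χ h)⁻¹ : kˣ) : k) • φ h (translatedSection ε φ τ χ p κ r (h⁻¹ * g) j x t w) := by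
  have h2 : ∀ y, φ g y = φ h (φ (h⁻¹ * g) y) := by
    intro y
    rw [← LinearEquiv.mul_apply, ← map_mul, mul_inv_cancel_left]
  simp only [translatedSection]
  rw [symm_apply_apply_of_mul, symm_apply_apply_of_mul, h2, map_smul, smul_smul]
  congr 1
  rw [← mul_assoc, ← Units.val_mul, ← mul_inv, ← map_mul, mul_inv_cancel_left]

theorem isPolyMap_translatedSection (hp : p ∈ PolyFun k W) (hκ : ∀ a, IsPolyMap k (κ a)) (r : ℕ)
    (g : Gt) (j : ℕ) : IsPolyMap k fun z : E × ((Fin 2 → k) × W) =>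
      translatedSection ε φ τ χ p κ r g j z.1 z.2.1 z.2.2 := by
  refine IsPolyMap.smul (mul_mem_polyFun (const_mem_polyFun _) (comp_mem_polyFun
    ((isPolyMap_linear (τ g).symm.toLinearMap).comp isPolyMap_id.snd.snd) hp))
    ((isPolyMap_linear (φ g).toLinearMap).comp (IsPolyMap.sum _ fun a _ => IsPolyMap.smul ?_
      ((hκ a).comp ((isPolyMap_linear (ε g).symm.toLinearMap).comp isPolyMap_id.fst))))
  have h : ∀ i : Fin 2, (fun z : E × ((Fin 2 → k) × W) => z.2.1 i) ∈ PolyFun k _ := fun i =>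
    (isPolyMap_id (k := k) (E := E × ((Fin 2 → k) × W))).snd.fst
      (LinearMap.proj (R := k) (φ := fun _ : Fin 2 => k) i)
  exact mul_mem_polyFun (pow_mem_polyFun (h 0) _) (pow_mem_polyFun (h 1) _)

/-- The sections `translatedSection` averaged over the group. -/
def averagedSection [Fintype G] (ext : GmExtension k G Gt) (ε : Gt →* (E ≃ₗ[k] E))
    (φ : Gt →* (F ≃ₗ[k] F)) (τ : Gt →* (W ≃ₗ[k] W)) (χ : Gt →* kˣ) (p : W → k) {n : ℕ}
    (κ : Fin n → E → F) (r : ℕ) (j : ℕ) (x : E) (t : Fin 2 → k) (w : W) : F :=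
  ∑ γ : G, translatedSection ε φ τ χ p κ r (ext.lift γ) j x t w

/-- The spanning maps `κ` are averaged over `G`. At `w₀` the weight `p` kills every summand except
that of the identity, which leaves combinations of the `κ a` along a monomial curve in `t`. Because
the `κ a` span the fibre, these are independent for a suitable `t`, and this works over each point
of `S` separately. -/
theorem equivBirational_noName [IsAlgClosed k] [CharZero k] [Finite G] [FiniteDimensional k W]
    [Nontrivial F] (hε : GmActsByScalars ext ε) (hφ : GmActsByScalars ext φ)
    (hτ : GmActsByScalars ext τ) (hτi : Function.Injective τ)
    (hfree : GenericallyFree k (projAction ext hτ) Set.univ)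
    {S : Set (ℙ k E)} (hS : ∀ g, ∀ m ∈ S, projAction ext hε g m ∈ S)
    (L : E → Submodule k F) (hLc : ∀ (c : k) (x : E), c ≠ 0 → L (c • x) = L x)
    (hLg : ∀ (g : Gt) (x : E), ∀ y ∈ L x, φ g y ∈ L (ε g x)) {r : ℕ} (hr : 0 < r)
    (hrank : ∀ m ∈ S, Module.finrank k (L m.rep) = r) {D : ℕ}
    (hκ : ∀ a, IsPolyMap k (κ a)) (hκh : ∀ a (c : k) x, κ a (c • x) = c ^ D • κ a x)
    (hκL : ∀ a, ∀ m ∈ S, κ a m.rep ∈ L m.rep)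
    (hκs : ∀ m ∈ S, L m.rep ≤ Submodule.span k (Set.range fun a => κ a m.rep)) :
    EquivBirational k
      (prodAction (projAction ext hε) (prodAction (1 : G →* Equiv.Perm (ℙ k (Fin r → k)))
        (prodAction (1 : G →* Equiv.Perm (ℙ k (Fin 2 → k))) (projAction ext hτ))))
      (S ×ˢ (Set.univ : Set (ℙ k (Fin r → k) × (ℙ k (Fin 2 → k) × ℙ k W))))
      (prodAction (projAction ext hε) (prodAction (projAction ext hφ)
        (prodAction (1 : G →* Equiv.Perm (ℙ k (Fin 2 → k))) (projAction ext hτ))))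
      {q : ℙ k E × (ℙ k F × (ℙ k (Fin 2 → k) × ℙ k W)) | q.1 ∈ S ∧ q.2.1.rep ∈ L q.1.rep} := by
  classical
  have := Fintype.ofFinite G
  have := nontrivial_of_faithful hτi ext
  obtain ⟨e, he⟩ := id hε
  obtain ⟨f, hf⟩ := id hφ
  obtain ⟨m, hm⟩ := id hτ
  obtain ⟨w₀, hw₀, hsep⟩ := exists_separating_polynomial hτ hfree
  obtain ⟨d, hd, χ, hχ⟩ := exists_twist hτi hm (Nat.card G) (f - e * D)
  obtain ⟨p, hp, hph, hp0, hpg⟩ := hsep d hd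
  have hlift : ∀ g : Gt, translatedSection ε φ τ χ p κ r (ext.lift (ext.proj g)) =
      translatedSection ε φ τ χ p κ r g := by
    intro g
    obtain ⟨z, hz⟩ := ext.exists_of_proj_eq (ext.proj_lift (ext.proj g)).symm
    rw [hz]
    funext j x t w
    exact translatedSection_mul_incl he hf hm hχ hph hκh r g z j x t w
  have hκL' : ∀ a, ∀ m ∈ S, ∀ g, κ a ((ε g).symm m.rep) ∈ L ((ε g).symm m.rep) := by
    intro a m hm g
    have h1 : HomCoords.IsCoord k ((ε g).symm m.rep) (projAction ext hε (ext.proj g⁻¹) m) := by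
      have := isCoord_projAction hε g⁻¹ (isCoord_rep m)
      rwa [map_inv] at this
    obtain ⟨c, hc, hc'⟩ := isCoord_eq_smul (isCoord_rep _) h1
    rw [hc', hκh, hLc _ _ hc]
    exact Submodule.smul_mem _ _ (hκL a _ (hS _ m hm))
  refine equivBirational_of_sections hε hφ hτ hS L hLc hLg hr hrank
    (fun j x t w => averagedSection ext ε φ τ χ p κ r j x t w) ?_ (d₁ := D) (d₂ := n ^ r)
    (d₃ := d) ?_ ?_ ?_ ?_
  · intro j
    exact IsPolyMap.sum _ fun γ _ => isPolyMap_translatedSection hp hκ r _ _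
  · intro j a b c x t w
    simp only [averagedSection, Finset.smul_sum]
    exact Finset.sum_congr rfl fun γ _ => translatedSection_smul hph hκh _ j.2 a b c x t w
  · intro h
    refine ⟨(((χ h)⁻¹ : kˣ) : k), Units.ne_zero _, fun j x t w => ?_⟩
    simp only [averagedSection, translatedSection_equivariant]
    rw [← Finset.smul_sum, ← map_sum]
    congr 2
    -- The sum is reindexed by translation in `G`. The chosen lifts are not multiplicative, but
    -- `hlift` shows that the summand does not depend on the lift.
    rw [← Equiv.sum_comp (Equiv.mulLeft (ext.proj h))]
    refine Finset.sum_congr rfl fun γ _ => ?_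
    rw [← hlift (h⁻¹ * _)]
    simp
  · intro j m hm t w
    refine Submodule.sum_mem _ fun γ _ => Submodule.smul_mem _ _ ?_
    have := hLg (ext.lift γ) ((ε (ext.lift γ)).symm m.rep)
      (∑ a : Fin n, (t 0 ^ (n ^ r - (a : ℕ) * n ^ (j : ℕ)) * t 1 ^ ((a : ℕ) * n ^ (j : ℕ))) •
        κ a ((ε (ext.lift γ)).symm m.rep))
      (Submodule.sum_mem _ fun a _ => Submodule.smul_mem _ _ (hκL' a m hm _))
    rwa [LinearEquiv.apply_symm_apply] at this
  · intro m hm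
    have hspan : Submodule.span k (Set.range fun a => κ a m.rep) = L m.rep := by
      refine le_antisymm (Submodule.span_le.2 ?_) (hκs m hm)
      rintro _ ⟨a, rfl⟩
      exact hκL a m hm
    obtain ⟨u, hu⟩ := exists_linearIndependent_monomial (r := r) (fun a => κ a m.rep)
      (by rw [hspan, hrank m hm])
    refine ⟨![1, u], w₀, fun h => one_ne_zero (congrFun h 0), hw₀, ?_⟩
    have h1 : ∀ j : Fin r, averagedSection ext ε φ τ χ p κ r j m.rep ![1, u] w₀ =
        p w₀ • ∑ a : Fin n, u ^ ((a : ℕ) * n ^ (j : ℕ)) • κ a m.rep := by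
      intro j
      rw [averagedSection, Finset.sum_eq_single 1]
      · have := hlift 1
        rw [map_one] at this
        rw [this]
        have h2 : ∀ x, (LinearEquiv.symm (1 : E ≃ₗ[k] E)) x = x := fun _ => rfl
        have h3 : ∀ x, (LinearEquiv.symm (1 : W ≃ₗ[k] W)) x = x := fun _ => rfl
        simp [translatedSection, h2, h3]
      · intro γ _ hγ
        rw [translatedSection, hpg _ (by rwa [ext.proj_lift]), mul_zero, zero_smul]
      · simp
    simp_rw [h1]
    exact (linearIndependent_smul_iff _ hp0).2 hu

end NoName

/-! ### Splittings and adjugates of linear maps -/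

section Splitting

variable {k P Q R : Type*} [Field k] [AddCommGroup P] [Module k P] [AddCommGroup Q] [Module k Q]
  [AddCommGroup R] [Module k R]

theorem exists_comp_eq_of_ker_le (T : P →ₗ[k] Q) (f : P →ₗ[k] R)
    (h : LinearMap.ker T ≤ LinearMap.ker f) : ∃ g : Q →ₗ[k] R, ∀ p, g (T p) = f p := by
  obtain ⟨g, hg⟩ := LinearMap.exists_extend
    (((LinearMap.ker T).liftQ f h) ∘ₗ T.quotKerEquivRange.symm.toLinearMap)
  refine ⟨g, fun p => ?_⟩
  have h1 := LinearMap.congr_fun hg ⟨T p, p, rfl⟩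
  rw [LinearMap.comp_apply, LinearMap.comp_apply] at h1
  refine h1.trans ?_
  have h2 : T.quotKerEquivRange.symm ⟨T p, p, rfl⟩ = Submodule.Quotient.mk p := by
    rw [LinearEquiv.symm_apply_eq]
    rfl
  change (LinearMap.ker T).liftQ f h (T.quotKerEquivRange.symm ⟨T p, p, rfl⟩) = f p
  rw [h2]
  rfl

/-- A linear map differs from an isomorphism by a projection onto its kernel. -/
theorem exists_splitting (T : P →ₗ[k] Q) : ∃ (ψ : Q →ₗ[k] P) (μ : P →ₗ[k] P),
    (∀ p, ψ (T p) + μ p = p) ∧ LinearMap.range μ = LinearMap.ker T ∧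
      ∀ p ∈ LinearMap.ker T, μ p = p := by
  obtain ⟨C, hC⟩ := Submodule.exists_isCompl (LinearMap.ker T)
  set μ : P →ₗ[k] P := (LinearMap.ker T).subtype ∘ₗ (LinearMap.ker T).projectionOnto C hC with hμ
  have h1 : ∀ p ∈ LinearMap.ker T, μ p = p := by
    intro p hp
    have := Submodule.projectionOnto_apply_left hC ⟨p, hp⟩
    rw [hμ, LinearMap.comp_apply, this]
    rfl
  obtain ⟨ψ, hψ⟩ := exists_comp_eq_of_ker_le T (LinearMap.id - μ) (by
    intro p hp
    rw [LinearMap.mem_ker, LinearMap.sub_apply, h1 p hp, LinearMap.id_apply, sub_self])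
  refine ⟨ψ, μ, fun p => by rw [hψ]; simp, le_antisymm ?_ fun p hp => ⟨p, h1 p hp⟩, h1⟩
  rintro _ ⟨p, rfl⟩
  exact Subtype.property _

/-- The adjugate of an endomorphism. -/
def linAdj {n : Type*} [Fintype n] [DecidableEq n] (b : Module.Basis n k P) (T : P →ₗ[k] P) :
    P →ₗ[k] P :=
  Matrix.toLin b b (LinearMap.toMatrix b b T).adjugate

variable {n : Type*} [Fintype n] [DecidableEq n] (b : Module.Basis n k P)

theorem linAdj_apply_self (T : P →ₗ[k] P) (p : P) :
    linAdj b T (T p) = (LinearMap.toMatrix b b T).det • p := by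
  have h : linAdj b T ∘ₗ T = (LinearMap.toMatrix b b T).det • LinearMap.id := by
    apply (LinearMap.toMatrix b b).injective
    rw [LinearMap.toMatrix_comp b b b, linAdj, LinearMap.toMatrix_toLin, Matrix.adjugate_mul,
      map_smul, LinearMap.toMatrix_id]
  exact LinearMap.congr_fun h p

theorem self_linAdj_apply (T : P →ₗ[k] P) (p : P) :
    T (linAdj b T p) = (LinearMap.toMatrix b b T).det • p := by
  have h : T ∘ₗ linAdj b T = (LinearMap.toMatrix b b T).det • LinearMap.id := by
    apply (LinearMap.toMatrix b b).injective
    rw [LinearMap.toMatrix_comp b b b, linAdj, LinearMap.toMatrix_toLin, Matrix.mul_adjugate,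
      map_smul, LinearMap.toMatrix_id]
  exact LinearMap.congr_fun h p

theorem linAdj_eq_sum (T : P →ₗ[k] P) (p : P) : linAdj b T p =
    ∑ i, (∑ j, (LinearMap.toMatrix b b T).adjugate i j * b.repr p j) • b i := by
  rw [linAdj, Matrix.toLin_apply]
  rfl

end Splitting

/-! ### Homogeneous polynomial maps of a fixed degree -/

section HomogeneousFunctions

variable {k E P : Type*} [Field k] [AddCommGroup E] [Module k E] [AddCommGroup P] [Module k P]

variable (k E) in
/-- Linear functionals as functions. -/
def linFun : Submodule k (E → k) :=
  LinearMap.range (LinearMap.ltoFun k E k k)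

theorem linFun_fg [FiniteDimensional k E] : (linFun k E).FG := by
  rw [linFun, LinearMap.range_eq_map]
  exact Module.Finite.fg_top.map _

theorem prod_mem_pow_card {A : Type*} [CommRing A] [Algebra k A] (M : Submodule k A) {ι : Type*}
    (s : Finset ι) {f : ι → A} (h : ∀ i ∈ s, f i ∈ M) : ∏ i ∈ s, f i ∈ M ^ s.card := by
  classical
  induction s using Finset.induction_on with
  | empty => simp [Submodule.one_le.1 le_rfl]
  | insert a s ha ih =>
    rw [Finset.prod_insert ha, Finset.card_insert_of_notMem ha, pow_succ']
    exact Submodule.mul_mem_mul (h a (Finset.mem_insert_self _ _))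
      (ih fun i hi => h i (Finset.mem_insert_of_mem hi))

theorem det_mem_linFun_pow {n : ℕ} {M : E → Matrix (Fin n) (Fin n) k}
    (hM : ∀ i j, (fun x => M x i j) ∈ linFun k E) : (fun x => (M x).det) ∈ linFun k E ^ n := by
  have h : (fun x => (M x).det) = ∑ σ : Equiv.Perm (Fin n),
      ((Equiv.Perm.sign σ : ℤ) : k) • ∏ i, (fun x => M x (σ i) i) := by
    funext x
    rw [Matrix.det_apply', Finset.sum_apply]
    refine Finset.sum_congr rfl fun σ _ => ?_
    simp
  rw [h]
  refine Submodule.sum_mem _ fun σ _ => Submodule.smul_mem _ _ ?_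
  have := prod_mem_pow_card (linFun k E) Finset.univ (f := fun i => fun x => M x (σ i) i)
    fun i _ => hM _ _
  rwa [Finset.card_fin] at this

theorem adjugate_mem_linFun_pow {n : ℕ} {M : E → Matrix (Fin (n + 1)) (Fin (n + 1)) k}
    (hM : ∀ i j, (fun x => M x i j) ∈ linFun k E) (i j : Fin (n + 1)) :
    (fun x => (M x).adjugate i j) ∈ linFun k E ^ n := by
  simp only [Matrix.adjugate_fin_succ_eq_det_submatrix]
  have h := det_mem_linFun_pow (M := fun x => (M x).submatrix j.succAbove i.succAbove)
    fun _ _ => hM _ _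
  have h2 := Submodule.smul_mem _ ((-1 : k) ^ ((j : ℕ) + i)) h
  exact h2

variable (k E P) in
/-- Polynomial maps all of whose components are homogeneous of degree `D`. -/
def homMaps (D : ℕ) : Submodule k (E → P) :=
  Submodule.map₂ (LinearMap.mk₂ k (fun (q : E → k) (p : P) => fun x => q x • p)
    (fun _ _ _ => by funext x; simp [add_smul]) (fun _ _ _ => by funext x; simp [mul_smul])
    (fun _ _ _ => by funext x; simp) (fun c q p => funext fun x => smul_comm (q x) c p))
    (linFun k E ^ D) ⊤

/-- Finite generation is what allows all kernel sections of one degree to be replaced by finitely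
many of them. -/
theorem homMaps_fg [FiniteDimensional k E] [FiniteDimensional k P] (D : ℕ) :
    (homMaps k E P D).FG :=
  Submodule.FG.map₂ _ (linFun_fg.pow D) Module.Finite.fg_top

theorem smul_mem_homMaps {D : ℕ} {q : E → k} (hq : q ∈ linFun k E ^ D) (p : P) :
    (fun x => q x • p) ∈ homMaps k E P D :=
  Submodule.apply_mem_map₂ _ hq Submodule.mem_top

theorem linFun_pow_induction {D : ℕ} {q : E → k} (hq : q ∈ linFun k E ^ D) :
    q ∈ PolyFun k E ∧ ∀ (c : k) x, q (c • x) = c ^ D * q x := by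
  induction hq using Submodule.pow_induction_on_left' with
  | algebraMap r => exact ⟨const_mem_polyFun r, fun c x => by simp⟩
  | add x y i hx hy ihx ihy =>
    exact ⟨add_mem_polyFun ihx.1 ihy.1, fun c z => by
      rw [Pi.add_apply, Pi.add_apply, ihx.2, ihy.2, mul_add]⟩
  | mem_mul m hm i x hx ih =>
    obtain ⟨l, rfl⟩ := hm
    refine ⟨mul_mem_polyFun (dual_mem_polyFun l) ih.1, fun c z => ?_⟩
    rw [Pi.mul_apply, Pi.mul_apply, ih.2]
    simp only [LinearMap.ltoFun_apply, map_smul, smul_eq_mul, Nat.succ_eq_add_one]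
    ring

theorem mem_homMaps {D : ℕ} {f : E → P} (hf : f ∈ homMaps k E P D) :
    IsPolyMap k f ∧ ∀ (c : k) x, f (c • x) = c ^ D • f x := by
  let r : Submodule k (E → P) :=
    { carrier := {f | IsPolyMap k f ∧ ∀ (c : k) x, f (c • x) = c ^ D • f x}
      add_mem' := fun hf hg => ⟨hf.1.add hg.1, fun c x => by
        rw [Pi.add_apply, Pi.add_apply, hf.2, hg.2, smul_add]⟩
      zero_mem' := ⟨isPolyMap_const 0, fun c x => by simp⟩
      smul_mem' := fun a f hf => ⟨IsPolyMap.smul (const_mem_polyFun a) hf.1, fun c x => by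
        rw [Pi.smul_apply, Pi.smul_apply, hf.2, smul_comm]⟩ }
  have h : homMaps k E P D ≤ r := by
    refine Submodule.map₂_le.2 fun q hq p _ => ?_
    have h1 := linFun_pow_induction hq
    refine ⟨IsPolyMap.smul h1.1 (isPolyMap_const p), fun c x => ?_⟩
    simp only [LinearMap.mk₂_apply, h1.2, mul_smul]
  exact h hf

end HomogeneousFunctions

/-! ### Polynomial sections of kernel bundles -/

section KernelSections

variable {k E P Q : Type*} [Field k] [AddCommGroup E] [Module k E] [AddCommGroup P] [Module k P]
  [AddCommGroup Q] [Module k Q]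

/-- The kernel of a linear family of linear maps along the locus of constant nullity admits
local sections that are homogeneous polynomial maps. -/
theorem exists_kernel_section {n : ℕ} (b : Module.Basis (Fin (n + 1)) k P)
    (Φ : E →ₗ[k] P →ₗ[k] Q) {x₀ : E} (hx₀ : x₀ ≠ 0) {p₀ : P} (hp₀ : Φ x₀ p₀ = 0) :
    ∃ κ ∈ homMaps k E P (n + 1 + n), κ x₀ = p₀ ∧
      ∀ x, Module.finrank k (LinearMap.ker (Φ x)) = Module.finrank k (LinearMap.ker (Φ x₀)) →
        Φ x (κ x) = 0 := by
  have : Module.Finite k P := Module.Finite.of_basis b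
  obtain ⟨ψ, μ, hψ, hμr, hμ⟩ := exists_splitting (Φ x₀)
  obtain ⟨l, hl⟩ : ∃ l : Module.Dual k E, l x₀ = 1 := by
    obtain ⟨l, hl⟩ : ∃ f : Module.Dual k E, f x₀ ≠ 0 := by
      by_contra! hc
      exact hx₀ ((Module.forall_dual_apply_eq_zero_iff k _).1 hc)
    exact ⟨(l x₀)⁻¹ • l, by simp [hl]⟩
  -- `Θ x₀` is the identity, and on `ker Φ x` the map `Θ x` reduces to `l x • μ`, with values in
  -- `ker Φ x₀`. The weight `l` makes `Θ` linear in `x`, hence its minors homogeneous.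
  set Θ : E →ₗ[k] P →ₗ[k] P :=
    (LinearMap.llcomp k P Q P ψ) ∘ₗ Φ + l.smulRight μ with hΘ
  have hΘx : ∀ x p, Θ x p = ψ (Φ x p) + l x • μ p := fun x p => rfl
  have hΘ0 : Θ x₀ = LinearMap.id := by
    ext p
    rw [hΘx, hl, one_smul, hψ]
    rfl
  set M : E → Matrix (Fin (n + 1)) (Fin (n + 1)) k := fun x => LinearMap.toMatrix b b (Θ x) with hM
  have hMl : ∀ i j, (fun x => M x i j) ∈ linFun k E := by
    intro i j
    refine ⟨(b.coord i) ∘ₗ (LinearMap.applyₗ (b j)) ∘ₗ Θ, ?_⟩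
    funext x
    simp [hM, LinearMap.toMatrix_apply]
  -- The adjugate carries `p₀` back into `ker Φ x` where `Θ x` is invertible; the extra determinant
  -- makes the section vanish where it is not. The degree is `n + 1` from the determinant plus `n`
  -- from the adjugate.
  refine ⟨fun x => (M x).det • linAdj b (Θ x) p₀, ?_, ?_, ?_⟩
  · have h : (fun x => (M x).det • linAdj b (Θ x) p₀) = ∑ i, ∑ j, b.repr p₀ j •
        fun x => ((M x).det * (M x).adjugate i j) • b i := by
      funext x
      rw [linAdj_eq_sum, Finset.smul_sum, Finset.sum_apply]
      refine Finset.sum_congr rfl fun i _ => ?_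
      rw [Finset.sum_apply, Finset.sum_smul, Finset.smul_sum]
      refine Finset.sum_congr rfl fun j _ => ?_
      rw [Pi.smul_apply, smul_smul, smul_smul]
      congr 1
      ring
    rw [h]
    refine Submodule.sum_mem _ fun i _ => Submodule.sum_mem _ fun j _ => Submodule.smul_mem _ _ ?_
    refine smul_mem_homMaps ?_ _
    rw [pow_add]
    exact Submodule.mul_mem_mul (det_mem_linFun_pow hMl) (adjugate_mem_linFun_pow hMl i j)
  · simp only [hM, hΘ0]
    have := linAdj_apply_self b (LinearMap.id) p₀
    rw [LinearMap.id_apply] at this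
    rw [this]
    simp
  · intro x hx
    by_cases hd : (M x).det = 0
    · simp only [hd, zero_smul, map_zero]
    have hinj : Function.Injective (Θ x) := by
      rw [← LinearMap.ker_eq_bot, LinearMap.ker_eq_bot']
      intro p hp
      have := linAdj_apply_self b (Θ x) p
      rw [hp, map_zero] at this
      exact (smul_eq_zero.1 this.symm).resolve_left hd
    -- Injectivity of `Θ x` and the equality of nullities turn the inclusion of kernels into an
    -- equality.
    have hmap : (LinearMap.ker (Φ x)).map (Θ x) = LinearMap.ker (Φ x₀) := by
      refine Submodule.eq_of_le_of_finrank_eq ?_ ?_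
      · rintro _ ⟨p, hp, rfl⟩
        rw [hΘx, show Φ x p = 0 from hp, map_zero, zero_add, ← hμr]
        exact Submodule.smul_mem _ _ ⟨p, rfl⟩
      · rw [← hx]
        exact (Submodule.equivMapOfInjective _ hinj _).finrank_eq.symm
    have hp : p₀ ∈ (LinearMap.ker (Φ x)).map (Θ x) := by
      rw [hmap]
      exact hp₀
    obtain ⟨q, hq, rfl⟩ := hp
    simp only [linAdj_apply_self, map_smul]
    rw [show Φ x q = 0 from hq, smul_zero, smul_zero]

/-- Along the locus of constant nullity the kernel of a linear family of linear maps is spanned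
by finitely many homogeneous polynomial maps of the same degree. -/
theorem exists_kernel_sections [FiniteDimensional k E] [FiniteDimensional k P] [Nontrivial P]
    (Φ : E →ₗ[k] P →ₗ[k] Q) (j : ℕ) :
    ∃ (n D : ℕ) (κ : Fin n → E → P), (∀ a, IsPolyMap k (κ a)) ∧
      (∀ a (c : k) x, κ a (c • x) = c ^ D • κ a x) ∧
      ∀ x ≠ 0, Module.finrank k (LinearMap.ker (Φ x)) = j →
        (∀ a, Φ x (κ a x) = 0) ∧
        LinearMap.ker (Φ x) ≤ Submodule.span k (Set.range fun a => κ a x) := by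
  obtain ⟨n, hn⟩ := Nat.exists_eq_succ_of_ne_zero (Module.finrank_pos (R := k) (M := P)).ne'
  set b : Module.Basis (Fin (n + 1)) k P := Module.finBasisOfFinrankEq k P hn with hb
  -- These are all the maps of this single degree that are sections over the whole locus. They span
  -- a finite-dimensional space, so finitely many of them already span every fibre.
  set K : Set (E → P) := {κ | κ ∈ homMaps k E P (n + 1 + n) ∧
    ∀ x ≠ 0, Module.finrank k (LinearMap.ker (Φ x)) = j → Φ x (κ x) = 0} with hK
  have hfg : (Submodule.span k K).FG := by
    have hle : Submodule.span k K ≤ homMaps k E P (n + 1 + n) :=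
      Submodule.span_le.2 fun κ hκ => hκ.1
    have := Module.Finite.iff_fg.2 (homMaps_fg (k := k) (E := E) (P := P) (n + 1 + n))
    exact Module.Finite.iff_fg.1 (Submodule.finiteDimensional_of_le hle)
  obtain ⟨s, hs, hsp⟩ := (Submodule.fg_span_iff_fg_span_finset_subset K).1 hfg
  refine ⟨s.card, n + 1 + n, fun a => (s.equivFin.symm a : E → P), fun a => ?_, fun a => ?_, ?_⟩
  · exact (mem_homMaps (hs (s.equivFin.symm a).2).1).1
  · exact (mem_homMaps (hs (s.equivFin.symm a).2).1).2
  · intro x hx hxj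
    refine ⟨fun a => (hs (s.equivFin.symm a).2).2 x hx hxj, fun p hp => ?_⟩
    obtain ⟨κ, hκ, hκx, hκ'⟩ := exists_kernel_section b Φ hx hp
    have h1 : κ ∈ Submodule.span k (s : Set (E → P)) := by
      rw [← hsp]
      exact Submodule.subset_span ⟨hκ, fun y _ hy => hκ' y (hy.trans hxj.symm)⟩
    have h2 : κ x ∈ (Submodule.span k (s : Set (E → P))).map (LinearMap.proj x) :=
      ⟨κ, h1, rfl⟩
    rw [hκx, Submodule.map_span] at h2
    refine Submodule.span_mono ?_ h2
    rintro _ ⟨κ', hκ'', rfl⟩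
    exact ⟨s.equivFin ⟨κ', hκ''⟩, by simp⟩

end KernelSections

/-! ### The no-name lemma for kernel bundles -/

section NoNameKernel

variable {k G Gt : Type*} [Field k] [IsAlgClosed k] [CharZero k] [Group G] [Finite G] [Group Gt]
  {ext : GmExtension k G Gt}
variable {E F W P Q : Type*} [AddCommGroup E] [Module k E] [AddCommGroup F] [Module k F]
  [AddCommGroup W] [Module k W] [AddCommGroup P] [Module k P] [AddCommGroup Q] [Module k Q]

/-- The no-name lemma for the bundle of kernels of a linear family of linear maps. -/
theorem equivBirational_noName_ker [FiniteDimensional k W] [FiniteDimensional k E]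
    [FiniteDimensional k P] [Nontrivial P]
    {ε : Gt →* (E ≃ₗ[k] E)} {φ : Gt →* (F ≃ₗ[k] F)} {τ : Gt →* (W ≃ₗ[k] W)}
    (hε : GmActsByScalars ext ε) (hφ : GmActsByScalars ext φ)
    (hτ : GmActsByScalars ext τ) (hτi : Function.Injective τ)
    (hfree : GenericallyFree k (projAction ext hτ) Set.univ)
    {S : Set (ℙ k E)} (hS : ∀ g, ∀ m ∈ S, projAction ext hε g m ∈ S)
    (Φ : E →ₗ[k] P →ₗ[k] Q) (ι : P →ₗ[k] F) (hι : Function.Injective ι)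
    (hLg : ∀ (g : Gt) (x : E), ∀ y ∈ (LinearMap.ker (Φ x)).map ι,
      φ g y ∈ (LinearMap.ker (Φ (ε g x))).map ι) {r : ℕ} (hr : 0 < r)
    (hrank : ∀ m ∈ S, Module.finrank k (LinearMap.ker (Φ m.rep)) = r) :
    EquivBirational k
      (prodAction (projAction ext hε) (prodAction (1 : G →* Equiv.Perm (ℙ k (Fin r → k)))
        (prodAction (1 : G →* Equiv.Perm (ℙ k (Fin 2 → k))) (projAction ext hτ))))
      (S ×ˢ (Set.univ : Set (ℙ k (Fin r → k) × (ℙ k (Fin 2 → k) × ℙ k W))))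
      (prodAction (projAction ext hε) (prodAction (projAction ext hφ)
        (prodAction (1 : G →* Equiv.Perm (ℙ k (Fin 2 → k))) (projAction ext hτ))))
      {q : ℙ k E × (ℙ k F × (ℙ k (Fin 2 → k) × ℙ k W)) |
        q.1 ∈ S ∧ q.2.1.rep ∈ (LinearMap.ker (Φ q.1.rep)).map ι} := by
  have : Nontrivial F := hι.nontrivial
  obtain ⟨n, D, κ, hκ, hκh, hκL⟩ := exists_kernel_sections Φ r
  refine equivBirational_noName (κ := fun a x => ι (κ a x)) (D := D) hε hφ hτ hτi hfree hS
    (fun x => (LinearMap.ker (Φ x)).map ι) (fun c x hc => ?_) hLg hr (fun m hm => ?_)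
    (fun a => (isPolyMap_linear ι).comp (hκ a)) (fun a c x => by rw [hκh, map_smul])
    (fun a m hm => ⟨_, (hκL m.rep m.rep_nonzero (hrank m hm)).1 a, rfl⟩) (fun m hm => ?_)
  · congr 1
    ext p
    simp [hc]
  · rw [← hrank m hm]
    exact (Submodule.equivMapOfInjective _ hι _).finrank_eq.symm
  · rintro _ ⟨p, hp, rfl⟩
    have h := (hκL m.rep m.rep_nonzero (hrank m hm)).2 hp
    have h2 := Submodule.mem_map_of_mem (f := ι) h
    rwa [Submodule.map_span, ← Set.range_comp] at h2

end NoNameKernel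

/-! ### Closures and irreducible subsets of vector spaces -/

section AffineClosure

variable (k : Type*) [Field k] {E F K : Type*} [AddCommGroup E] [Module k E]
  [AddCommGroup F] [Module k F] [AddCommGroup K] [Module k K]

/-- The Zariski closure of a subset of a vector space. -/
def acl (T : Set E) : Set E :=
  {x | ∀ p ∈ PolyFun k E, (∀ y ∈ T, p y = 0) → p x = 0}

/-- A subset of a vector space whose Zariski closure is irreducible. -/
def AIrr (T : Set E) : Prop :=
  T.Nonempty ∧ ∀ p ∈ PolyFun k E, ∀ q ∈ PolyFun k E, (∀ x ∈ T, p x * q x = 0) →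
    (∀ x ∈ T, p x = 0) ∨ ∀ x ∈ T, q x = 0

variable {k}

theorem subset_acl (T : Set E) : T ⊆ acl k T := fun x hx _ _ h => h x hx

theorem acl_mono {T T' : Set E} (h : T ⊆ T') : acl k T ⊆ acl k T' :=
  fun _ hx p hp hT => hx p hp fun y hy => hT y (h hy)

theorem subset_acl_trans {T U Z : Set E} (h : T ⊆ acl k U) (h' : U ⊆ acl k Z) : T ⊆ acl k Z :=
  fun _ hx p hp hZ => h hx p hp fun _ hy => h' hy p hp hZ

theorem acl_image {φ : E → F} (hφ : IsPolyMap k φ) {T U : Set E} (h : T ⊆ acl k U) :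
    φ '' T ⊆ acl k (φ '' U) := by
  rintro _ ⟨x, hx, rfl⟩ p hp hU
  exact h hx (fun x => p (φ x)) (comp_mem_polyFun hφ hp) fun y hy => hU _ ⟨y, hy, rfl⟩

theorem nonempty_of_subset_acl {T U : Set E} (h : T ⊆ acl k U) (hT : T.Nonempty) :
    U.Nonempty := by
  obtain ⟨x, hx⟩ := hT
  by_contra hU
  rw [Set.not_nonempty_iff_eq_empty] at hU
  subst hU
  exact one_ne_zero (h hx (fun _ => (1 : k)) (const_mem_polyFun 1) (by simp))

theorem AIrr.image {T : Set E} (hT : AIrr k T) {φ : E → F} (hφ : IsPolyMap k φ) :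
    AIrr k (φ '' T) := by
  refine ⟨hT.1.image _, fun p hp q hq h => ?_⟩
  simp only [Set.forall_mem_image] at h ⊢
  exact hT.2 _ (comp_mem_polyFun hφ hp) _ (comp_mem_polyFun hφ hq) fun x hx => h hx

theorem AIrr.congr {T U : Set E} (hT : AIrr k T) (h : T ⊆ acl k U) (h' : U ⊆ acl k T) :
    AIrr k U := by
  refine ⟨nonempty_of_subset_acl h hT.1, fun p hp q hq hpq => ?_⟩
  rcases hT.2 p hp q hq fun x hx => h hx _ (mul_mem_polyFun hp hq) hpq with h1 | h1
  · exact Or.inl fun x hx => h' hx p hp h1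
  · exact Or.inr fun x hx => h' hx q hq h1

theorem aIrr_univ [Infinite k] : AIrr k (Set.univ : Set E) :=
  ⟨⟨0, trivial⟩, fun p hp q hq h => by
    simpa using polyFun_mul_eq_zero hp hq fun x => h x trivial⟩

/-- For each `y`, irreducibility of `T` makes one of the slices of `p` and `q` at `y` vanish on `T`.
The product of `p(t₁, y)` and `q(t₂, y)` is therefore identically zero in `y`, although neither
factor is. -/
theorem AIrr.prod_univ [Infinite k] {T : Set E} (hT : AIrr k T) :
    AIrr k (T ×ˢ (Set.univ : Set K)) := by
  refine ⟨hT.1.prod ⟨0, trivial⟩, fun p hp q hq h => ?_⟩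
  have hs : ∀ t : E, IsPolyMap k fun y : K => (t, y) := fun t =>
    (isPolyMap_const t).prodMk isPolyMap_id
  have hs' : ∀ y : K, IsPolyMap k fun t : E => (t, y) := fun y =>
    isPolyMap_id.prodMk (isPolyMap_const y)
  by_contra! hc
  obtain ⟨⟨⟨t₁, y₁⟩, ⟨ht₁, -⟩, h₁⟩, ⟨t₂, y₂⟩, ⟨ht₂, -⟩, h₂⟩ := hc
  rcases polyFun_mul_eq_zero (k := k) (p := fun y => p (t₁, y)) (q := fun y => q (t₂, y))
    (comp_mem_polyFun (hs t₁) hp) (comp_mem_polyFun (hs t₂) hq) (fun y => by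
      rcases hT.2 _ (comp_mem_polyFun (hs' y) hp) _ (comp_mem_polyFun (hs' y) hq)
        fun t ht => h (t, y) ⟨ht, trivial⟩ with h3 | h3
      · exact mul_eq_zero_of_left (h3 t₁ ht₁) _
      · exact mul_eq_zero_of_right _ (h3 t₂ ht₂)) with h3 | h3
  · exact h₁ (h3 y₁)
  · exact h₂ (h3 y₂)

/-- If `p` vanishes wherever `h` does not, then `p * h` vanishes on `T`, and irreducibility cancels
`h`. -/
theorem AIrr.subset_acl_ne {T : Set E} (hT : AIrr k T) {h : E → k} (hh : h ∈ PolyFun k E)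
    {x₀ : E} (hx₀ : x₀ ∈ T) (h0 : h x₀ ≠ 0) : T ⊆ acl k {x ∈ T | h x ≠ 0} := by
  intro x hx p hp hpT
  refine ((hT.2 p hp h hh fun y hy => ?_).resolve_right fun h1 => h0 (h1 x₀ hx₀)) x hx
  by_cases hy' : h y = 0
  · rw [hy', mul_zero]
  · rw [hpT y ⟨hy, hy'⟩, zero_mul]

theorem AIrr.ne {T : Set E} (hT : AIrr k T) {h : E → k} (hh : h ∈ PolyFun k E)
    {x₀ : E} (hx₀ : x₀ ∈ T) (h0 : h x₀ ≠ 0) : AIrr k {x ∈ T | h x ≠ 0} :=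
  hT.congr (hT.subset_acl_ne hh hx₀ h0) fun _ hx => subset_acl _ hx.1

/-- An irreducible set in the closure of a finite union lies in the closure of a member. -/
theorem AIrr.exists_subset_acl {T : Set E} (hT : AIrr k T) {ι : Type*} (s : Finset ι)
    {C : ι → Set E} (h : T ⊆ acl k (⋃ i ∈ s, C i)) : ∃ i ∈ s, T ⊆ acl k (C i) := by
  classical
  induction s using Finset.induction_on with
  | empty =>
    obtain ⟨x, hx⟩ := nonempty_of_subset_acl h hT.1
    simp at hx
  | insert a s ha ih =>
    by_cases h1 : T ⊆ acl k (C a)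
    · exact ⟨a, Finset.mem_insert_self _ _, h1⟩
    obtain ⟨x₀, hx₀, hx₀'⟩ := Set.not_subset.1 h1
    simp only [acl, Set.mem_ofPred_eq, not_forall] at hx₀'
    obtain ⟨p, hp, hpC, hpx⟩ := hx₀'
    obtain ⟨i, hi, hi'⟩ := ih fun x hx q hq hqs => by
      refine ((hT.2 p hp q hq fun y hy => ?_).resolve_left fun h2 => hpx (h2 _ hx₀)) x hx
      refine h hy _ (mul_mem_polyFun hp hq) fun z hz => ?_
      rw [Finset.set_biUnion_insert] at hz
      rcases hz with hz | hz
      · rw [hpC z hz, zero_mul]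
      · rw [hqs z hz, mul_zero]
    exact ⟨i, Finset.mem_insert_of_mem hi, hi'⟩

/-- One of the members of a finite decomposition of an irreducible set is dense in it. -/
theorem AIrr.exists_dense {T : Set E} (hT : AIrr k T) {ι : Type*} (s : Finset ι)
    {C : ι → Set E} (h : T = ⋃ i ∈ s, C i) :
    ∃ i ∈ s, T ⊆ acl k (C i) ∧ C i ⊆ T ∧ AIrr k (C i) := by
  obtain ⟨i, hi, hi'⟩ := hT.exists_subset_acl s (C := C) (h ▸ subset_acl _)
  have h1 : C i ⊆ T := by
    rw [h]
    exact Set.subset_biUnion_of_mem (u := C) (show i ∈ (s : Set ι) from hi)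
  exact ⟨i, hi, hi', h1, hT.congr hi' (h1.trans (subset_acl T))⟩

theorem exists_mvPolynomial {ι : Type*} (b : Module.Basis ι k E) [Finite ι] {p : E → k}
    (hp : p ∈ PolyFun k E) :
    ∃ P : MvPolynomial ι k, ∀ x, p x = MvPolynomial.aeval (fun i => b.repr x i) P := by
  have := Fintype.ofFinite ι
  induction hp using Algebra.adjoin_induction with
  | mem q hq =>
    obtain ⟨l, rfl⟩ := hq
    refine ⟨∑ i, MvPolynomial.C (l (b i)) * MvPolynomial.X i, fun x => ?_⟩
    change l x = _
    conv_lhs => rw [← b.sum_repr x, map_sum]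
    simp [mul_comm]
  | algebraMap c => exact ⟨MvPolynomial.C c, fun x => by simp⟩
  | add p q _ _ hp hq =>
    obtain ⟨P, hP⟩ := hp
    obtain ⟨Q, hQ⟩ := hq
    exact ⟨P + Q, fun s => by simp [hP, hQ]⟩
  | mul p q _ _ hp hq =>
    obtain ⟨P, hP⟩ := hp
    obtain ⟨Q, hQ⟩ := hq
    exact ⟨P * Q, fun s => by simp [hP, hQ]⟩

theorem aeval_mem_polyFun {ι : Type*} {f : ι → E → k} (hf : ∀ i, f i ∈ PolyFun k E)
    (P : MvPolynomial ι k) : (fun x => MvPolynomial.aeval (fun i => f i x) P) ∈ PolyFun k E := by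
  induction P using MvPolynomial.induction_on with
  | C a => simpa using const_mem_polyFun a
  | add p q hp hq => simpa using add_mem_polyFun hp hq
  | mul_X p i hp => simpa using mul_mem_polyFun hp (hf i)

/-- Every subset of a finite-dimensional vector space is a finite union of irreducible sets. -/
theorem exists_irreducible_decomposition [FiniteDimensional k E] (Z : Set E) :
    ∃ (n : ℕ) (C : Fin n → Set E), (∀ i, AIrr k (C i)) ∧ Z = ⋃ i, C i := by
  set b := Module.finBasis k E
  let I : Set E → Ideal (MvPolynomial (Fin (Module.finrank k E)) k) := fun Z =>
    MvPolynomial.vanishingIdeal k ((fun x i => b.repr x i) '' Z)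
  have hI : ∀ Z P, P ∈ I Z ↔ ∀ x ∈ Z, MvPolynomial.aeval (fun i => b.repr x i) P = 0 := by
    intro Z P
    simp [I, MvPolynomial.mem_vanishingIdeal_iff]
  suffices H : ∀ J, ∀ Z, I Z = J → ∃ (n : ℕ) (C : Fin n → Set E),
      (∀ i, AIrr k (C i)) ∧ Z = ⋃ i, C i from H _ Z rfl
  intro J
  -- Noetherian induction on the vanishing ideal: splitting `Z` along `p * q = 0` strictly enlarges
  -- the ideal of both parts.
  induction J using WellFoundedGT.induction with
  | ind J ih =>
    rintro Z rfl
    by_cases hZ : Z.Nonempty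
    swap
    · rw [Set.not_nonempty_iff_eq_empty] at hZ
      exact ⟨0, fun _ => ∅, fun i => i.elim0, by simp [hZ]⟩
    by_cases hirr : AIrr k Z
    · exact ⟨1, fun _ => Z, fun _ => hirr, (Set.iUnion_const Z).symm⟩
    have hsplit : ∃ p ∈ PolyFun k E, ∃ q ∈ PolyFun k E, (∀ x ∈ Z, p x * q x = 0) ∧
        (∃ x ∈ Z, p x ≠ 0) ∧ ∃ x ∈ Z, q x ≠ 0 := by
      by_contra! hc
      refine hirr ⟨hZ, fun p hp q hq hpq => ?_⟩
      by_cases h1 : ∀ x ∈ Z, p x = 0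
      · exact Or.inl h1
      · push Not at h1
        exact Or.inr (hc p hp q hq hpq h1)
    obtain ⟨p, hp, q, hq, hpq, hpZ, hqZ⟩ := hsplit
    have hlt : ∀ r ∈ PolyFun k E, (∃ x ∈ Z, r x ≠ 0) → I Z < I {x ∈ Z | r x = 0} := by
      rintro r hr ⟨x, hx, hrx⟩
      obtain ⟨P, hP⟩ := exists_mvPolynomial b hr
      refine lt_of_le_of_ne (fun Q hQ => (hI _ _).2 fun y hy => (hI _ _).1 hQ y hy.1) fun h => ?_
      have h1 : P ∈ I {x ∈ Z | r x = 0} := (hI _ _).2 fun y hy => by rw [← hP, hy.2]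
      rw [← h, hI] at h1
      exact hrx (by rw [hP, h1 x hx])
    obtain ⟨n, C, hC, hZC⟩ := ih _ (hlt p hp hpZ) _ rfl
    obtain ⟨m, D, hD, hZD⟩ := ih _ (hlt q hq hqZ) _ rfl
    refine ⟨n + m, Fin.append C D, fun i => ?_, ?_⟩
    · refine Fin.addCases (fun i => ?_) (fun i => ?_) i
      · rw [Fin.append_left]
        exact hC i
      · rw [Fin.append_right]
        exact hD i
    · have h1 : Z = {x ∈ Z | p x = 0} ∪ {x ∈ Z | q x = 0} := by
        ext x
        constructor
        · intro hx
          rcases mul_eq_zero.1 (hpq x hx) with h | h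
          · exact Or.inl ⟨hx, h⟩
          · exact Or.inr ⟨hx, h⟩
        · rintro (h | h) <;> exact h.1
      conv_lhs => rw [h1, hZC, hZD]
      ext x
      simp only [Set.mem_union, Set.mem_iUnion]
      constructor
      · rintro (⟨i, hi⟩ | ⟨i, hi⟩)
        · exact ⟨Fin.castAdd m i, by rwa [Fin.append_left]⟩
        · exact ⟨Fin.natAdd n i, by rwa [Fin.append_right]⟩
      · rintro ⟨i, hi⟩
        revert hi
        refine Fin.addCases (fun i hi => ?_) (fun i hi => ?_) i
        · rw [Fin.append_left] at hi
          exact Or.inl ⟨i, hi⟩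
        · rw [Fin.append_right] at hi
          exact Or.inr ⟨i, hi⟩

end AffineClosure

/-! ### Dimension through algebraic independence -/

section Dimension

variable (k : Type*) [Field k] {E F K : Type*} [AddCommGroup E] [Module k E]
  [AddCommGroup F] [Module k F] [AddCommGroup K] [Module k K]

/-- The closure of `T` has dimension at least `d`: there are `d` polynomial functions that are
algebraically independent on `T`. -/
def DimGE (T : Set E) (d : ℕ) : Prop :=
  ∃ f : E → (Fin d → k), IsPolyMap k f ∧
    ∀ q ∈ PolyFun k (Fin d → k), (∀ x ∈ T, q (f x) = 0) → ∀ y, q y = 0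

variable {k}

/-- This allows the witness to be any dominant polynomial map to a `d`-dimensional space, free of
coordinates. -/
theorem dimGE_of_dominant [FiniteDimensional k F] {T : Set E} {f : E → F} (hf : IsPolyMap k f)
    (h : ∀ q ∈ PolyFun k F, (∀ x ∈ T, q (f x) = 0) → ∀ y, q y = 0) {d : ℕ}
    (hd : Module.finrank k F = d) : DimGE k T d := by
  let e : F ≃ₗ[k] (Fin d → k) := (Module.finBasisOfFinrankEq k F hd).equivFun
  refine ⟨fun x => e (f x), (isPolyMap_linear e.toLinearMap).comp hf, fun q hq hqT y => ?_⟩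
  have := h (fun y => q (e y)) (comp_mem_polyFun (isPolyMap_linear e.toLinearMap) hq) hqT (e.symm y)
  simpa using this

theorem DimGE.of_image {T : Set E} {φ : E → F} (hφ : IsPolyMap k φ) {d : ℕ}
    (h : DimGE k (φ '' T) d) : DimGE k T d := by
  obtain ⟨f, hf, h⟩ := h
  exact ⟨fun x => f (φ x), hf.comp hφ, fun q hq hqT => h q hq (by simpa using hqT)⟩

theorem DimGE.of_subset_acl {T U : Set E} {d : ℕ} (h : DimGE k T d) (hTU : T ⊆ acl k U) :
    DimGE k U d := by
  obtain ⟨f, hf, h⟩ := h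
  exact ⟨f, hf, fun q hq hqT => h q hq fun x hx =>
    hTU hx (fun x => q (f x)) (comp_mem_polyFun hf hq) hqT⟩

theorem dimGE_zero {T : Set E} (hT : T.Nonempty) : DimGE k T 0 := by
  obtain ⟨x, hx⟩ := hT
  exact ⟨fun _ => 0, isPolyMap_const 0, fun q _ h y => by
    rw [Subsingleton.elim y 0]; exact h x hx⟩

theorem DimGE.prod_univ [FiniteDimensional k K] {T : Set E} {d : ℕ} (h : DimGE k T d) :
    DimGE k (T ×ˢ (Set.univ : Set K)) (d + Module.finrank k K) := by
  obtain ⟨f, hf, h⟩ := h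
  have h1 : IsPolyMap k fun x : E × K => (f x.1, x.2) :=
    (hf.comp (isPolyMap_linear (LinearMap.fst k E K))).prodMk
      (isPolyMap_linear (LinearMap.snd k E K))
  refine dimGE_of_dominant h1 (fun q hq hqT y => ?_)
    (by rw [Module.finrank_prod, Module.finrank_fin_fun])
  exact h (fun z => q (z, y.2)) (comp_mem_polyFun (isPolyMap_id.prodMk (isPolyMap_const y.2)) hq)
    (fun x hx => hqT (x, y.2) ⟨hx, trivial⟩) y.1

/-- Evaluation of polynomial functions at a point. -/
def evalPoly (x : F) : PolyFun k F →+* k :=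
  (Pi.evalRingHom (fun _ : F => k) x).comp (PolyFun k F).val.toRingHom

@[simp]
theorem evalPoly_mk (x : F) (p : F → k) (hp : p ∈ PolyFun k F) : evalPoly x ⟨p, hp⟩ = p x := rfl

/-- A polynomial function on a product with a line is a polynomial in the last coordinate. -/
theorem exists_polynomial_of_prod {q : F × k → k} (hq : q ∈ PolyFun k (F × k)) :
    ∃ P : Polynomial (PolyFun k F), ∀ x y, q (x, y) = P.eval₂ (evalPoly x) y := by
  induction hq using Algebra.adjoin_induction with
  | mem q hq =>
    obtain ⟨l, rfl⟩ := hq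
    refine ⟨Polynomial.C ⟨_, dual_mem_polyFun (l ∘ₗ LinearMap.inl k F k)⟩ +
      Polynomial.C ⟨_, const_mem_polyFun (l (0, 1))⟩ * Polynomial.X, fun x y => ?_⟩
    have h : l (x, y) = l (x, 0) + l (0, 1) * y := by
      rw [mul_comm, ← smul_eq_mul, ← map_smul, ← map_add]
      simp
    rw [Polynomial.eval₂_add, Polynomial.eval₂_mul, Polynomial.eval₂_C, Polynomial.eval₂_C,
      Polynomial.eval₂_X]
    exact h
  | algebraMap c =>
    refine ⟨Polynomial.C ⟨_, const_mem_polyFun c⟩, fun x y => ?_⟩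
    rw [Polynomial.eval₂_C]
    rfl
  | add p q _ _ hp hq =>
    obtain ⟨P, hP⟩ := hp
    obtain ⟨Q, hQ⟩ := hq
    exact ⟨P + Q, fun x y => by rw [Pi.add_apply, Polynomial.eval₂_add, hP, hQ]⟩
  | mul p q _ _ hp hq =>
    obtain ⟨P, hP⟩ := hp
    obtain ⟨Q, hQ⟩ := hq
    exact ⟨P * Q, fun x y => by rw [Pi.mul_apply, Polynomial.eval₂_mul, hP, hQ]⟩

/-- A proper closed subset of an irreducible set has smaller dimension. -/
theorem DimGE.succ_of_lt {T U : Set E} {d : ℕ} (h : DimGE k T d) (hU : AIrr k U)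
    (hTU : T ⊆ acl k U) {g : E → k} (hg : g ∈ PolyFun k E) (hgT : ∀ x ∈ T, g x = 0)
    (hgU : ∃ x ∈ U, g x ≠ 0) : DimGE k U (d + 1) := by
  obtain ⟨f, hf, h⟩ := h
  have hg' : IsPolyMap k g := fun l => by
    have h1 : ∀ x, l (g x) = g x * l 1 := fun x => by
      rw [← smul_eq_mul, ← map_smul, smul_eq_mul, mul_one]
    simpa only [h1] using mul_mem_polyFun hg (const_mem_polyFun (l 1))
  refine dimGE_of_dominant (hf.prodMk hg') ?_
    (by rw [Module.finrank_prod, Module.finrank_fin_fun, Module.finrank_self])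
  have hpoly : ∀ P : Polynomial (PolyFun k (Fin d → k)),
      (fun x => P.eval₂ (evalPoly (f x)) (g x)) ∈ PolyFun k E := by
    intro P
    simp only [Polynomial.eval₂_eq_sum_range]
    exact sum_mem_polyFun _ fun i _ => mul_mem_polyFun
      (comp_mem_polyFun hf (P.coeff i).2) (pow_mem_polyFun hg i)
  -- Induction on the degree in `g` of a relation between `f` and `g`. On `T`, where `g` vanishes,
  -- the constant term becomes a relation among the components of `f`, so it is zero; then one
  -- factor `g` is cancelled by irreducibility of `U`.
  have key : ∀ n, ∀ P : Polynomial (PolyFun k (Fin d → k)), P.natDegree ≤ n →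
      (∀ x ∈ U, P.eval₂ (evalPoly (f x)) (g x) = 0) → P = 0 := by
    intro n
    induction n with
    | zero =>
      intro P hn hP
      rw [Polynomial.eq_C_of_natDegree_le_zero hn] at hP ⊢
      have h1 : P.coeff 0 = 0 := Subtype.ext (funext fun y => h _ (P.coeff 0).2 (fun x hx =>
        hTU hx _ (comp_mem_polyFun hf (P.coeff 0).2) fun z hz => by
          have h2 := hP z hz
          rwa [Polynomial.eval₂_C] at h2) y)
      rw [h1, Polynomial.C_0]
    | succ n ih =>
      intro P hn hP
      have hdec := P.divX_mul_X_add
      have h1 : P.coeff 0 = 0 := by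
        refine Subtype.ext (funext fun y => h _ (P.coeff 0).2 (fun x hx => ?_) y)
        have h2 := hTU hx _ (hpoly P) hP
        rw [← hdec, Polynomial.eval₂_add, Polynomial.eval₂_mul, Polynomial.eval₂_X, hgT x hx,
          mul_zero, zero_add, Polynomial.eval₂_C] at h2
        exact h2
      rw [h1, Polynomial.C_0, add_zero] at hdec
      have h2 : P.divX = 0 := by
        refine ih _ (by rw [Polynomial.natDegree_divX_eq_natDegree_tsub_one]; omega) ?_
        refine (hU.2 _ (hpoly _) g hg fun x hx => ?_).resolve_right fun h3 => ?_
        · have h3 := hP x hx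
          rwa [← hdec, Polynomial.eval₂_mul, Polynomial.eval₂_X] at h3
        · obtain ⟨x, hx, hx'⟩ := hgU
          exact hx' (h3 x hx)
      rw [← hdec, h2, zero_mul]
  intro q hq hqU y
  obtain ⟨P, hP⟩ := exists_polynomial_of_prod hq
  have h1 : P = 0 := key _ P le_rfl fun x hx => by rw [← hP]; exact hqU x hx
  rw [show y = (y.1, y.2) from rfl, hP, h1, Polynomial.eval₂_zero]

end Dimension

/-! ### Coordinate rings and the dimension of fibres -/

section RestrictedFunctions

variable (k : Type*) [Field k] {E F : Type*} [AddCommGroup E] [Module k E]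
  [AddCommGroup F] [Module k F]

/-- Restriction of functions to a subset. -/
def restrictHom (C : Set E) : (E → k) →ₐ[k] (C → k) where
  toFun f x := f x
  map_one' := rfl
  map_mul' _ _ := rfl
  map_zero' := rfl
  map_add' _ _ := rfl
  commutes' _ := rfl

variable {k} in
@[simp]
theorem restrictHom_apply (C : Set E) (f : E → k) (x : C) : restrictHom k C f x = f x := rfl

/-- The ring of polynomial functions on a subset of a vector space. -/
def coordRing (C : Set E) : Subalgebra k (C → k) := (PolyFun k E).map (restrictHom k C)

variable {k}

/-- The restriction of a polynomial function. -/
def toCoordRing (C : Set E) {p : E → k} (hp : p ∈ PolyFun k E) : coordRing k C :=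
  ⟨restrictHom k C p, p, hp, rfl⟩

theorem toCoordRing_eq_iff {C : Set E} {p q : E → k} (hp : p ∈ PolyFun k E)
    (hq : q ∈ PolyFun k E) : toCoordRing C hp = toCoordRing C hq ↔ ∀ x ∈ C, p x = q x :=
  ⟨fun h x hx => congrFun (congrArg Subtype.val h) ⟨x, hx⟩,
    fun h => Subtype.ext (funext fun x => h x x.2)⟩

theorem toCoordRing_eq_zero_iff {C : Set E} {p : E → k} (hp : p ∈ PolyFun k E) :
    toCoordRing C hp = 0 ↔ ∀ x ∈ C, p x = 0 :=
  toCoordRing_eq_iff hp (zero_mem _)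

theorem isDomain_coordRing {C : Set E} (hC : AIrr k C) : IsDomain (coordRing k C) := by
  have h1 : NoZeroDivisors (coordRing k C) := by
    refine ⟨fun {a b} hab => ?_⟩
    obtain ⟨_, p, hp, rfl⟩ := a
    obtain ⟨_, q, hq, rfl⟩ := b
    rcases hC.2 p hp q hq fun x hx => congrFun (congrArg Subtype.val hab) ⟨x, hx⟩ with h | h
    · exact Or.inl (Subtype.ext (funext fun x => h x x.2))
    · exact Or.inr (Subtype.ext (funext fun x => h x x.2))
  have h2 : Nontrivial (coordRing k C) := by
    obtain ⟨x, hx⟩ := hC.1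
    exact ⟨1, 0, fun h => one_ne_zero (congrFun (congrArg Subtype.val h) ⟨x, hx⟩)⟩
  exact (isDomain_iff_noZeroDivisors_and_nontrivial _).2 ⟨h1, h2⟩

theorem aeval_toCoordRing {C : Set E} {ι : Type*} {p : ι → E → k} (hp : ∀ i, p i ∈ PolyFun k E)
    (P : MvPolynomial ι k) : MvPolynomial.aeval (fun i => toCoordRing C (hp i)) P =
      toCoordRing C (aeval_mem_polyFun hp P) := by
  induction P using MvPolynomial.induction_on with
  | C a =>
    rw [MvPolynomial.aeval_C]
    exact Subtype.ext (funext fun x => by simp [toCoordRing])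
  | add p q hp hq =>
    rw [map_add, hp, hq]
    exact Subtype.ext (funext fun x => by simp [toCoordRing])
  | mul_X p i hp =>
    rw [map_mul, hp, MvPolynomial.aeval_X]
    exact Subtype.ext (funext fun x => by simp [toCoordRing])

/-- This gives access to transcendence bases. Infinitude of `k` is needed to pass from a polynomial
with zero values to the zero polynomial. -/
theorem dimGE_iff_exists_algebraicIndependent [Infinite k] {C : Set E} {d : ℕ} :
    DimGE k C d ↔ ∃ (p : Fin d → E → k) (hp : ∀ i, p i ∈ PolyFun k E),
      AlgebraicIndependent k fun i => toCoordRing C (hp i) := by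
  constructor
  · rintro ⟨f, hf, h⟩
    have hp : ∀ i, (fun x => f x i) ∈ PolyFun k E := fun i =>
      hf (LinearMap.proj (R := k) (φ := fun _ : Fin d => k) i)
    refine ⟨fun i x => f x i, hp, ?_⟩
    rw [algebraicIndependent_iff]
    intro P hP
    rw [aeval_toCoordRing, toCoordRing_eq_zero_iff] at hP
    refine MvPolynomial.funext fun y => ?_
    have hc : ∀ i, (fun y : Fin d → k => y i) ∈ PolyFun k (Fin d → k) := fun i =>
      dual_mem_polyFun (LinearMap.proj (R := k) (φ := fun _ : Fin d => k) i)
    have := h _ (aeval_mem_polyFun hc P) hP y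
    rw [map_zero]
    simpa using this
  · rintro ⟨p, hp, h⟩
    rw [algebraicIndependent_iff] at h
    refine ⟨fun x i => p i x, IsPolyMap.pi hp, fun q hq hqC y => ?_⟩
    obtain ⟨P, hP⟩ := exists_mvPolynomial (Pi.basisFun k (Fin d)) hq
    have h1 : P = 0 := by
      apply h
      rw [aeval_toCoordRing, toCoordRing_eq_zero_iff]
      intro x hx
      have h2 := hqC x hx
      rw [hP] at h2
      simpa using h2
    rw [hP, h1, map_zero]

theorem isAlgebraic_of_mul_eq {B A : Type*} [CommRing B] [CommRing A] [Algebra B A] {μ h : B}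
    {a : A} (hμ : μ ≠ 0) (hμa : algebraMap B A μ * a = algebraMap B A h) : IsAlgebraic B a := by
  refine ⟨Polynomial.C μ * Polynomial.X - Polynomial.C h, fun h0 => hμ ?_, ?_⟩
  · have h1 := congrArg (fun P => Polynomial.coeff P 1) h0
    simpa [Polynomial.coeff_C] using h1
  · rw [map_sub, map_mul, Polynomial.aeval_C, Polynomial.aeval_C, Polynomial.aeval_X, hμa, sub_self]

/-- The dimension of a set whose coordinates are algebraic over `j` functions and the functions
pulled back from its image exceeds the dimension of the image by at most `j`. -/
theorem DimGE.of_fibres [Infinite k] {C : Set E} (hC : AIrr k C) {φ : E → F}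
    (hφ : IsPolyMap k φ) {j : ℕ} {y : E → (Fin j → k)} (hy : IsPolyMap k y)
    (hgen : ∀ l : Module.Dual k E, ∃ μ ∈ PolyFun k F, (∃ x ∈ C, μ (φ x) ≠ 0) ∧
      ∃ h ∈ PolyFun k (F × (Fin j → k)), ∀ x ∈ C, μ (φ x) * l x = h (φ x, y x))
    {d : ℕ} (hd : DimGE k C d) : ∃ d', d ≤ d' + j ∧ DimGE k (φ '' C) d' := by
  classical
  have := isDomain_coordRing hC
  have hyi : ∀ i, (fun x => y x i) ∈ PolyFun k E := fun i =>
    hy (LinearMap.proj (R := k) (φ := fun _ : Fin j => k) i)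
  set S : Set (coordRing k C) := {a | ∃ (p : F → k) (hp : p ∈ PolyFun k F),
    a = toCoordRing C (comp_mem_polyFun hφ hp)} with hS
  set Y : Finset (coordRing k C) := Finset.univ.image fun i => toCoordRing C (hyi i) with hY
  set B := Algebra.adjoin k (S ∪ Y) with hB
  have hBS : ∀ (p : F → k) (hp : p ∈ PolyFun k F), toCoordRing C (comp_mem_polyFun hφ hp) ∈ B :=
    fun p hp => Algebra.subset_adjoin (Or.inl ⟨p, hp, rfl⟩)
  have hBY : ∀ i, toCoordRing C (hyi i) ∈ B := fun i =>
    Algebra.subset_adjoin (Or.inr (Finset.mem_coe.2 (Finset.mem_image_of_mem _ (Finset.mem_univ i))))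
  have hBh : ∀ (h : F × (Fin j → k) → k) (hh : h ∈ PolyFun k (F × (Fin j → k))),
      toCoordRing C (comp_mem_polyFun (hφ.prodMk hy) hh) ∈ B := by
    intro h hh
    induction hh using Algebra.adjoin_induction with
    | mem q hq =>
      obtain ⟨l, rfl⟩ := hq
      have h1 : toCoordRing C (comp_mem_polyFun (hφ.prodMk hy) (dual_mem_polyFun l)) =
          toCoordRing C (comp_mem_polyFun hφ (dual_mem_polyFun (l ∘ₗ LinearMap.inl k _ _))) +
          ∑ i, l (0, Pi.single i 1) • toCoordRing C (hyi i) := by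
        refine Subtype.ext (funext fun x => ?_)
        have h2 : l (φ x, y x) = l (φ x, 0) + ∑ i, l (0, Pi.single i 1) * y x i := by
          have h3 : (φ x, y x) = (φ (x : E), (0 : Fin j → k)) +
              ∑ i, y x i • ((0 : F), (Pi.single i 1 : Fin j → k)) := by
            refine Prod.ext ?_ ?_
            · simp [Prod.fst_sum]
            · simp only [Prod.snd_add, zero_add, Prod.snd_sum, Prod.smul_snd]
              exact pi_eq_sum_univ' (y x)
          rw [h3, map_add, map_sum]
          simp only [map_smul, smul_eq_mul, mul_comm]
        simpa [toCoordRing] using h2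
      rw [h1]
      exact B.add_mem (hBS _ (dual_mem_polyFun _)) (B.sum_mem fun i _ => B.smul_mem (hBY i) _)
    | algebraMap c => exact B.algebraMap_mem c
    | add p q hp' hq' hp hq => exact B.add_mem hp hq
    | mul p q hp' hq' hp hq => exact B.mul_mem hp hq
  -- By `hgen`, each linear coordinate solves an equation of degree one over `B` whose leading
  -- coefficient is nonzero.
  have halg : Algebra.IsAlgebraic B (coordRing k C) := by
    refine ⟨fun a => ?_⟩
    obtain ⟨_, p, hp, rfl⟩ := a
    change IsAlgebraic B (toCoordRing C hp)
    induction hp using Algebra.adjoin_induction with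
    | mem q hq =>
      obtain ⟨l, rfl⟩ := hq
      obtain ⟨μ, hμ, ⟨x, hx, hx'⟩, h, hh, hC⟩ := hgen l
      refine isAlgebraic_of_mul_eq (μ := (⟨_, hBS μ hμ⟩ : B)) (h := ⟨_, hBh h hh⟩) (fun h0 => ?_)
        (Subtype.ext (funext fun x => hC x x.2))
      exact hx' ((toCoordRing_eq_zero_iff (comp_mem_polyFun hφ hμ)).1 (congrArg Subtype.val h0) x hx)
    | algebraMap c => exact isAlgebraic_algebraMap (⟨_, B.algebraMap_mem c⟩ : B)
    | add p q hp' hq' hp hq => exact hp.add hq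
    | mul p q hp' hq' hp hq => exact hp.mul hq
  have hfaith : FaithfulSMul k (coordRing k C) :=
    (faithfulSMul_iff_algebraMap_injective k _).2 (algebraMap k (coordRing k C)).injective
  -- A transcendence basis can be taken among the pulled-back functions `S` and the at most `j`
  -- functions in `Y`. Discarding `Y` from `d` of its members leaves at least `d - j` independent
  -- functions on the image.
  obtain ⟨u, hu, hub⟩ := exists_isTranscendenceBasis_subset (R := k) (S ∪ (Y : Set (coordRing k C)))
  obtain ⟨p, hp, hpi⟩ := dimGE_iff_exists_algebraicIndependent.1 hd
  have hcard : (d : Cardinal) ≤ Cardinal.mk u := by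
    rw [hub.cardinalMk_eq_trdeg]
    simpa using hpi.lift_cardinalMk_le_trdeg
  obtain ⟨v, hv⟩ := Cardinal.exists_finset_eq_card hcard
  set v' : Finset (coordRing k C) := v.map (Function.Embedding.subtype _) \ Y with hv'
  have hv'u : ∀ a ∈ v', a ∈ u ∧ a ∈ S := by
    intro a ha
    rw [hv', Finset.mem_sdiff, Finset.mem_map] at ha
    obtain ⟨⟨⟨a, ha⟩, -, rfl⟩, haY⟩ := ha
    exact ⟨ha, (hu ha).resolve_right haY⟩
  have hv'c : d ≤ v'.card + j := by
    have h1 := Finset.le_card_sdiff Y (v.map (Function.Embedding.subtype _))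
    rw [Finset.card_map, ← hv] at h1
    have h2 : Y.card ≤ j := Finset.card_image_le.trans (by simp)
    rw [hv']
    omega
  refine ⟨v'.card, hv'c, dimGE_iff_exists_algebraicIndependent.2 ?_⟩
  choose q hq hqa using fun i : Fin v'.card => (hv'u _ (v'.equivFin.symm i).2).2
  refine ⟨q, hq, ?_⟩
  have h1 : AlgebraicIndependent k fun i => toCoordRing C (comp_mem_polyFun hφ (hq i)) := by
    have h2 := hub.1.comp (fun i : Fin v'.card =>
      (⟨_, (hv'u _ (v'.equivFin.symm i).2).1⟩ : u)) fun i i' hii => by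
        have := congrArg Subtype.val hii
        exact v'.equivFin.symm.injective (Subtype.ext this)
    convert h2 using 1
    funext i
    exact (hqa i).symm
  rw [algebraicIndependent_iff] at h1 ⊢
  intro P hP
  apply h1
  rw [aeval_toCoordRing, toCoordRing_eq_zero_iff] at hP ⊢
  exact fun x hx => hP _ ⟨x, hx, rfl⟩

end RestrictedFunctions

/-! ### Krull's height theorem for sets of points -/

section Krull

variable {k : Type*} [Field k] {E : Type*} [AddCommGroup E] [Module k E]

/-- The zero set of an ideal in coordinates. -/
def idealZeros {n : ℕ} (b : Module.Basis (Fin n) k E) (I : Ideal (MvPolynomial (Fin n) k)) :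
    Set E :=
  {x | ∀ P ∈ I, MvPolynomial.aeval (fun i => b.repr x i) P = 0}

/-- The ideal of polynomials in coordinates vanishing on a set. -/
def coordIdeal {n : ℕ} (b : Module.Basis (Fin n) k E) (T : Set E) :
    Ideal (MvPolynomial (Fin n) k) :=
  MvPolynomial.vanishingIdeal k ((fun x i => b.repr x i) '' T)

variable {n : ℕ} (b : Module.Basis (Fin n) k E)

theorem mem_coordIdeal {T : Set E} {P : MvPolynomial (Fin n) k} :
    P ∈ coordIdeal b T ↔ ∀ x ∈ T, MvPolynomial.aeval (fun i => b.repr x i) P = 0 := by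
  simp [coordIdeal, MvPolynomial.mem_vanishingIdeal_iff]

theorem coord_mem_polyFun (i : Fin n) : (fun x : E => b.repr x i) ∈ PolyFun k E :=
  dual_mem_polyFun (b.coord i)

theorem aeval_repr_mem_polyFun (P : MvPolynomial (Fin n) k) :
    (fun x : E => MvPolynomial.aeval (fun i => b.repr x i) P) ∈ PolyFun k E :=
  aeval_mem_polyFun (coord_mem_polyFun b) P

theorem coordIdeal_isPrime {T : Set E} (hT : AIrr k T) : (coordIdeal b T).IsPrime := by
  refine Ideal.isPrime_iff.2 ⟨fun h => ?_, fun {P Q} hPQ => ?_⟩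
  · obtain ⟨x, hx⟩ := hT.1
    have h1 := (mem_coordIdeal b).1 ((Ideal.eq_top_iff_one _).1 h) x hx
    simp at h1
  · rw [mem_coordIdeal] at hPQ
    rcases hT.2 _ (aeval_repr_mem_polyFun b P) _ (aeval_repr_mem_polyFun b Q)
      (fun x hx => by rw [← map_mul]; exact hPQ x hx) with h | h
    · exact Or.inl ((mem_coordIdeal b).2 h)
    · exact Or.inr ((mem_coordIdeal b).2 h)

/-- Hilbert's Nullstellensatz for a prime ideal, transported to `E` through the basis. -/
theorem coordIdeal_idealZeros [IsAlgClosed k] (I : Ideal (MvPolynomial (Fin n) k)) [I.IsPrime] :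
    coordIdeal b (idealZeros b I) = I := by
  have h : (fun x i => b.repr x i) '' idealZeros b I = MvPolynomial.zeroLocus k I := by
    ext y
    constructor
    · rintro ⟨x, hx, rfl⟩
      exact hx
    · intro hy
      have h1 : (fun i => b.repr (b.equivFun.symm y) i) = y := by
        funext i
        rw [← b.equivFun_apply, LinearEquiv.apply_symm_apply]
      refine ⟨b.equivFun.symm y, fun P hP => ?_, h1⟩
      rw [h1]
      exact hy P hP
  rw [coordIdeal, h, MvPolynomial.IsPrime.vanishingIdeal_zeroLocus]

theorem aIrr_idealZeros [IsAlgClosed k] (I : Ideal (MvPolynomial (Fin n) k)) [hI : I.IsPrime] :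
    AIrr k (idealZeros b I) := by
  refine ⟨?_, fun p hp q hq h => ?_⟩
  · by_contra hc
    rw [Set.not_nonempty_iff_eq_empty] at hc
    apply hI.ne_top
    rw [← coordIdeal_idealZeros b I, hc, Ideal.eq_top_iff_one, mem_coordIdeal]
    simp
  · obtain ⟨P, hP⟩ := exists_mvPolynomial b hp
    obtain ⟨Q, hQ⟩ := exists_mvPolynomial b hq
    have h1 : P * Q ∈ I := by
      rw [← coordIdeal_idealZeros b I, mem_coordIdeal]
      intro x hx
      rw [map_mul, ← hP, ← hQ, h x hx]
    rcases hI.mem_or_mem h1 with h2 | h2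
    · exact Or.inl fun x hx => by rw [hP]; exact hx P h2
    · exact Or.inr fun x hx => by rw [hQ]; exact hx Q h2

/-- The ideal of a point has height at least the dimension of the ambient space. -/
theorem le_height_coordIdeal_singleton [Infinite k] (x₀ : E) :
    (n : ℕ∞) ≤ (coordIdeal b {x₀}).height := by
  classical
  -- Fixing the first `i` coordinates gives a strictly decreasing chain of affine subspaces through
  -- `x₀`, hence `n` strict inclusions of primes below the ideal of the point.
  let T : ℕ → Set E := fun i => {x | ∀ l : Fin n, (l : ℕ) < i → b.repr x l = b.repr x₀ l}
  have hT : ∀ i, AIrr k (T i) := by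
    intro i
    let φ : E → E := fun x => b.equivFun.symm
      fun l => if (l : ℕ) < i then b.repr x₀ l else b.repr x l
    have hφ : IsPolyMap k φ := (isPolyMap_linear b.equivFun.symm.toLinearMap).comp
      (IsPolyMap.pi fun l => by
        by_cases hl : (l : ℕ) < i
        · simp only [hl, if_true]
          exact const_mem_polyFun _
        · simp only [hl, if_false]
          exact coord_mem_polyFun b l)
    have hφr : ∀ x l, b.repr (φ x) l = if (l : ℕ) < i then b.repr x₀ l else b.repr x l := by
      intro x l
      rw [← b.equivFun_apply, LinearEquiv.apply_symm_apply]
    have h1 : φ '' Set.univ = T i := by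
      ext x
      constructor
      · rintro ⟨y, -, rfl⟩ l hl
        rw [hφr, if_pos hl]
      · intro hx
        refine ⟨x, trivial, b.repr.injective (Finsupp.ext fun l => ?_)⟩
        rw [hφr]
        split_ifs with hl
        · exact (hx l hl).symm
        · rfl
    rw [← h1]
    exact aIrr_univ.image hφ
  have key : ∀ i ≤ n, (i : ℕ∞) ≤ (coordIdeal b (T i)).height := by
    intro i
    induction i with
    | zero => simp
    | succ i ih =>
      intro hi
      have := coordIdeal_isPrime b (hT i)
      have := coordIdeal_isPrime b (hT (i + 1))
      have hlt : coordIdeal b (T i) < coordIdeal b (T (i + 1)) := by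
        refine lt_of_le_of_ne (fun P hP => ?_) fun h => ?_
        · rw [mem_coordIdeal] at hP ⊢
          exact fun x hx => hP x fun l hl => hx l (hl.trans (Nat.lt_succ_self i))
        · set l : Fin n := ⟨i, hi⟩
          have h1 : MvPolynomial.X l - MvPolynomial.C (b.repr x₀ l) ∈ coordIdeal b (T (i + 1)) := by
            rw [mem_coordIdeal]
            intro x hx
            have := hx l (Nat.lt_succ_self i)
            simp [this]
          rw [← h, mem_coordIdeal] at h1
          have h2 := h1 (x₀ + b l) fun l' hl' => by
            rw [map_add, Finsupp.add_apply, b.repr_self, Finsupp.single_apply, if_neg, add_zero]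
            rintro rfl
            exact lt_irrefl _ hl'
          simp at h2
      have h1 := Ideal.height_add_one_le_of_lt_of_isPrime hlt
      push_cast
      exact (add_le_add_left (ih (by omega)) 1).trans h1
  have h1 : T n = {x₀} := by
    ext x
    constructor
    · intro hx
      exact b.repr.injective (Finsupp.ext fun l => hx l l.2)
    · rintro rfl l _
      rfl
  rw [← h1]
  exact key n le_rfl

/-- A chain of primes bounds the dimension of the zero set of the smallest one from below. -/
theorem dimGE_of_ltSeries [IsAlgClosed k] (l : LTSeries (PrimeSpectrum (MvPolynomial (Fin n) k))) :
    DimGE k (idealZeros b l.head.asIdeal) l.length := by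
  have hprime : ∀ i, AIrr k (idealZeros b (l i).asIdeal) := fun i => by
    have := (l i).2
    exact aIrr_idealZeros b _
  -- Descending from the largest prime, every step strictly enlarges an irreducible zero set and so
  -- raises the dimension by one.
  have key : ∀ i (hi : i ≤ l.length),
      DimGE k (idealZeros b (l ⟨l.length - i, by omega⟩).asIdeal) i := by
    intro i
    induction i with
    | zero => exact fun _ => dimGE_zero (hprime _).1
    | succ i ih =>
      intro hi
      have hlt : l ⟨l.length - (i + 1), by omega⟩ < l ⟨l.length - i, by omega⟩ :=
        l.strictMono (by rw [Fin.lt_def]; simp only; omega)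
      have hlt' : (l ⟨l.length - (i + 1), by omega⟩).asIdeal <
          (l ⟨l.length - i, by omega⟩).asIdeal := hlt
      obtain ⟨P, hP, hP'⟩ := Set.exists_of_ssubset hlt'
      refine (ih (by omega)).succ_of_lt (hprime _) ?_ (aeval_repr_mem_polyFun b P)
        (fun x hx => hx P hP) ?_
      · exact fun x hx => subset_acl _ fun Q hQ => hx Q (hlt'.le hQ)
      · by_contra! hc
        apply hP'
        have := (l ⟨l.length - (i + 1), by omega⟩).2
        have h1 := (mem_coordIdeal b).2 hc
        rwa [coordIdeal_idealZeros] at h1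
  have := key l.length le_rfl
  simpa [RelSeries.head] using this

/-- Krull's height theorem in terms of points: `r` equations cut the dimension by at most `r`. -/
theorem exists_aIrr_of_equations [IsAlgClosed k] [FiniteDimensional k E] {r : ℕ}
    {p : Fin r → E → k} (hp : ∀ i, p i ∈ PolyFun k E) {x₀ : E} (hx₀ : ∀ i, p i x₀ = 0) :
    ∃ C : Set E, AIrr k C ∧ x₀ ∈ C ∧ (∀ x ∈ C, ∀ i, p i x = 0) ∧
      ∃ d, Module.finrank k E ≤ d + r ∧ DimGE k C d := by
  have : Infinite k := IsAlgClosed.instInfinite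
  set b := Module.finBasis k E
  choose P hP using fun i => exists_mvPolynomial b (hp i)
  set J : Ideal (MvPolynomial (Fin (Module.finrank k E)) k) := Ideal.span (Set.range P) with hJ
  set m := coordIdeal b {x₀} with hm
  have hmp : m.IsPrime := coordIdeal_isPrime b
    ⟨⟨x₀, rfl⟩, fun p _ q _ h => by simpa using h x₀ rfl⟩
  have hJm : J ≤ m := by
    rw [hJ, Ideal.span_le]
    rintro _ ⟨i, rfl⟩
    refine (mem_coordIdeal b).2 ?_
    rintro x rfl
    rw [← hP, hx₀]
  have h1 := Ideal.height_le_height_add_spanFinrank_of_le hJm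
  have h2 := le_height_coordIdeal_singleton b x₀
  have h3 : J.spanFinrank ≤ r := by
    refine (Submodule.spanFinrank_span_le_ncard_of_finite (Set.finite_range P)).trans ?_
    rw [← Set.image_univ]
    refine (Set.ncard_image_le Set.finite_univ).trans ?_
    simp
  have hmq : (m.map (Ideal.Quotient.mk J)).IsPrime := Ideal.isPrime_map_quotientMk_of_isPrime hJm
  -- By `h1`, the point still has height at least `dim E - r` modulo the equations. A chain of
  -- primes realizing this height is pulled back to the polynomial ring; the zero set of its
  -- smallest member is the required set.
  obtain ⟨l, hl, hll⟩ := Ideal.exists_ltSeries_length_eq_height (m.map (Ideal.Quotient.mk J))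
  have hmono : StrictMono (PrimeSpectrum.comap (Ideal.Quotient.mk J)) := by
    refine Monotone.strictMono_of_injective (fun I I' h => Ideal.comap_mono h) ?_
    exact PrimeSpectrum.comap_injective_of_surjective _ Ideal.Quotient.mk_surjective
  set l' := l.map _ hmono with hl'
  refine ⟨idealZeros b l'.head.asIdeal, ?_, ?_, ?_, l'.length, ?_, dimGE_of_ltSeries b l'⟩
  · have := l'.head.2
    exact aIrr_idealZeros b _
  · have h4 : l'.head.asIdeal ≤ m := by
      have h5 : l'.head ≤ l'.last := l'.monotone (Fin.zero_le _)
      have h6 : l'.last.asIdeal = m := by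
        rw [hl', LTSeries.last_map, hl]
        change (m.map (Ideal.Quotient.mk J)).comap (Ideal.Quotient.mk J) = m
        rw [Ideal.comap_map_of_surjective _ Ideal.Quotient.mk_surjective, ← RingHom.ker_eq_comap_bot,
          Ideal.mk_ker, sup_eq_left]
        exact hJm
      rw [← h6]
      exact h5
    intro Q hQ
    exact (mem_coordIdeal b).1 (h4 hQ) x₀ rfl
  · intro x hx i
    rw [hP]
    apply hx
    have h4 : J ≤ l'.head.asIdeal := by
      rw [hl', LTSeries.head_map]
      intro Q hQ
      change Ideal.Quotient.mk J Q ∈ l.head.asIdeal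
      rw [Ideal.Quotient.eq_zero_iff_mem.2 hQ]
      exact zero_mem _
    exact h4 (Ideal.subset_span ⟨i, rfl⟩)
  · have h4 : ((Module.finrank k E : ℕ) : ℕ∞) ≤ l.length + r := by
      refine h2.trans (h1.trans ?_)
      rw [hll]
      gcongr
    exact_mod_cast h4

end Krull

/-! ### Local frames of kernels and dimension counts -/

section LocalFrames

variable {k V P Q : Type*} [Field k] [AddCommGroup V] [Module k V] [AddCommGroup P] [Module k P]
  [AddCommGroup Q] [Module k Q]

/-- The nullity of the members of a linear family of linear maps. -/
def nullity (Φ : V →ₗ[k] P →ₗ[k] Q) (v : V) : ℕ := Module.finrank k (LinearMap.ker (Φ v))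

/-- A linear family of linear maps has its kernels trivialized, near a given member, along the
locus of constant nullity. -/
theorem exists_local_frame [FiniteDimensional k P] (Φ : V →ₗ[k] P →ₗ[k] Q) (v₀ : V) :
    ∃ (D : V → k) (μ : P →ₗ[k] LinearMap.ker (Φ v₀)) (a : V → P →ₗ[k] P),
      D ∈ PolyFun k V ∧ D v₀ = 1 ∧ (∀ p, a v₀ p = p) ∧
      IsPolyMap k (fun z : V × P => a z.1 z.2) ∧
      (∀ v p, Φ v p = 0 → a v (μ p : P) = D v • p) ∧
      ∀ v, D v ≠ 0 → nullity Φ v = nullity Φ v₀ → ∀ q : LinearMap.ker (Φ v₀),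
        Φ v (a v q) = 0 ∧ μ (a v q) = D v • q := by
  obtain ⟨ψ, μ, hψ, hμr, hμ⟩ := exists_splitting (Φ v₀)
  -- No homogeneity is needed here, so `μ` carries no weight. As before, `Θ v₀` is the identity and
  -- `Θ v` restricts to `μ` on `ker Φ v`.
  set Θ : V → P →ₗ[k] P := fun v => ψ ∘ₗ Φ v + μ with hΘ
  have hΘx : ∀ x p, Θ x p = ψ (Φ x p) + μ p := fun x p => rfl
  have hΘ0 : Θ v₀ = LinearMap.id := by
    ext p
    rw [hΘx, hψ]
    rfl
  set b := Module.finBasis k P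
  set M := fun x => LinearMap.toMatrix b b (Θ x) with hM
  have hMl : ∀ i j, (fun x => M x i j) ∈ PolyFun k V := by
    intro i j
    have : (fun x => M x i j) = fun x =>
        ((b.coord i) ∘ₗ ψ ∘ₗ (LinearMap.applyₗ (b j)) ∘ₗ Φ) x + b.repr (μ (b j)) i := by
      funext x
      simp [hM, hΘ, LinearMap.toMatrix_apply]
    rw [this]
    exact add_mem_polyFun (dual_mem_polyFun _) (const_mem_polyFun _)
  have hμm : ∀ p, μ p ∈ LinearMap.ker (Φ v₀) := fun p => hμr ▸ ⟨p, rfl⟩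
  refine ⟨fun v => (M v).det, μ.codRestrict _ hμm, fun v => linAdj b (Θ v), det_mem_polyFun hMl,
    ?_, ?_, ?_, ?_, ?_⟩
  · simp [hM, hΘ0]
  · intro p
    simp only [hΘ0]
    have := linAdj_apply_self b (LinearMap.id) p
    rw [LinearMap.id_apply] at this
    rw [this]
    simp
  · simp only [linAdj_eq_sum]
    refine IsPolyMap.sum _ fun i _ => IsPolyMap.smul (sum_mem_polyFun _ fun j _ => ?_)
      (isPolyMap_const _)
    exact mul_mem_polyFun (comp_mem_polyFun (isPolyMap_linear (LinearMap.fst k V P))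
      (adjugate_mem_polyFun hMl i j)) (dual_mem_polyFun (b.coord j ∘ₗ LinearMap.snd k V P))
  · intro v p hp
    change linAdj b (Θ v) (μ p) = _
    rw [← linAdj_apply_self b (Θ v) p, hΘx, hp, map_zero, zero_add]
  · intro v hv hvn q
    have hinj : Function.Injective (Θ v) := by
      rw [← LinearMap.ker_eq_bot, LinearMap.ker_eq_bot']
      intro p hp
      have := linAdj_apply_self b (Θ v) p
      rw [hp, map_zero] at this
      exact (smul_eq_zero.1 this.symm).resolve_left hv
    have hmap : (LinearMap.ker (Φ v)).map (Θ v) = LinearMap.ker (Φ v₀) := by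
      refine Submodule.eq_of_le_of_finrank_eq ?_ ?_
      · rintro _ ⟨p, hp, rfl⟩
        rw [hΘx, show Φ v p = 0 from hp, map_zero, zero_add]
        exact hμm p
      · change _ = nullity Φ v₀
        rw [← hvn]
        exact (Submodule.equivMapOfInjective _ hinj _).finrank_eq.symm
    have hp : (q : P) ∈ (LinearMap.ker (Φ v)).map (Θ v) := by
      rw [hmap]
      exact q.2
    obtain ⟨p, hp, hpq⟩ := hp
    have h1 : Φ v (linAdj b (Θ v) q) = 0 := by
      rw [← hpq, linAdj_apply_self, map_smul, show Φ v p = 0 from hp, smul_zero]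
    refine ⟨h1, Subtype.ext ?_⟩
    change μ (linAdj b (Θ v) q) = (M v).det • (q : P)
    rw [← self_linAdj_apply b (Θ v) q, hΘx, h1, map_zero, zero_add]

variable [FiniteDimensional k P]

/-- The dimension of a family of kernel vectors of a linear family of maps of constant nullity is
bounded in terms of the dimension of the parameters. -/
theorem DimGE.of_kernels [Infinite k] (Φ : V →ₗ[k] P →ₗ[k] Q) {C : Set (V × P)}
    (hC : AIrr k C) {j : ℕ} (hCj : ∀ z ∈ C, Φ z.1 z.2 = 0 ∧ nullity Φ z.1 = j) {d : ℕ}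
    (hd : DimGE k C d) : ∃ d', d ≤ d' + j ∧ DimGE k (Prod.fst '' C) d' := by
  obtain ⟨z₀, hz₀⟩ := hC.1
  obtain ⟨D, μ, a, hD, hD0, -, ha, hμ, -⟩ := exists_local_frame Φ z₀.1
  set bK := Module.finBasisOfFinrankEq k (LinearMap.ker (Φ z₀.1)) (hCj z₀ hz₀).2
  -- A kernel vector, multiplied by `D`, is recovered from its parameter and its image under `μ` in
  -- the fixed kernel over `z₀`, that is, from `j` further coordinates.
  refine DimGE.of_fibres hC (φ := Prod.fst) (isPolyMap_linear (LinearMap.fst k V P))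
    (y := fun z => bK.equivFun (μ z.2))
    (isPolyMap_linear (bK.equivFun.toLinearMap ∘ₗ μ ∘ₗ LinearMap.snd k V P)) (fun l => ?_) hd
  refine ⟨D, hD, ⟨z₀, hz₀, by rw [hD0]; exact one_ne_zero⟩,
    fun u => D u.1 * l (u.1, 0) + l (0, a u.1 (bK.equivFun.symm u.2)), ?_, ?_⟩
  · refine add_mem_polyFun (mul_mem_polyFun (comp_mem_polyFun (isPolyMap_linear
      (LinearMap.fst k V (Fin j → k))) hD)
      (dual_mem_polyFun (l ∘ₗ LinearMap.inl k V P ∘ₗ LinearMap.fst k V (Fin j → k)))) ?_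
    have h1 : IsPolyMap k fun u : V × (Fin j → k) => (u.1, (bK.equivFun.symm u.2 : P)) :=
      isPolyMap_linear ((LinearMap.fst k V (Fin j → k)).prod
        ((LinearMap.ker (Φ z₀.1)).subtype ∘ₗ bK.equivFun.symm.toLinearMap ∘ₗ
          LinearMap.snd k V (Fin j → k)))
    exact (ha.comp h1) (l ∘ₗ LinearMap.inr k V P)
  · intro z hz
    simp only [LinearEquiv.symm_apply_apply]
    rw [hμ _ _ (hCj z hz).1]
    conv_lhs => rw [show z = (z.1, 0) + (0, z.2) by simp, map_add, mul_add]
    simp only [Prod.fst_add, add_zero]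
    congr 1
    rw [← smul_eq_mul, ← map_smul]
    simp

/-- The kernels of a linear family of maps of constant nullity over an irreducible set of
parameters form an irreducible set. -/
theorem exists_kernel_family [Infinite k] (Φ : V →ₗ[k] P →ₗ[k] Q) {T : Set V}
    (hT : AIrr k T) {j : ℕ} (hTj : ∀ v ∈ T, nullity Φ v = j) {v₀ : V} (hv₀ : v₀ ∈ T) :
    ∃ C : Set (V × P), AIrr k C ∧ (∀ z ∈ C, z.1 ∈ T ∧ Φ z.1 z.2 = 0) ∧
      (∀ p, Φ v₀ p = 0 → (v₀, p) ∈ C) ∧ T ⊆ acl k (Prod.fst '' C) ∧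
      ∀ d, DimGE k T d → DimGE k C (d + j) := by
  obtain ⟨D, μ, a, hD, hD0, ha0, ha, -, hμ⟩ := exists_local_frame Φ v₀
  have hD0' : D v₀ ≠ 0 := by rw [hD0]; exact one_ne_zero
  set T' := {v ∈ T | D v ≠ 0} with hT'
  set φ : V × LinearMap.ker (Φ v₀) → V × P := fun z => (z.1, a z.1 z.2) with hφ
  have hφp : IsPolyMap k φ := (isPolyMap_linear (LinearMap.fst k V _)).prodMk
    (ha.comp (isPolyMap_linear (LinearMap.prodMap LinearMap.id (LinearMap.ker (Φ v₀)).subtype)))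
  have hTT : T ⊆ acl k T' := hT.subset_acl_ne hD hv₀ hD0'
  have hn : ∀ v ∈ T, nullity Φ v = nullity Φ v₀ := fun v hv => by rw [hTj v hv, hTj v₀ hv₀]
  refine ⟨φ '' (T' ×ˢ Set.univ), ((hT.ne hD hv₀ hD0').prod_univ).image hφp, ?_, ?_, ?_, ?_⟩
  · rintro _ ⟨z, ⟨hz, -⟩, rfl⟩
    exact ⟨hz.1, (hμ z.1 hz.2 (hn _ hz.1) z.2).1⟩
  · intro p hp
    exact ⟨(v₀, ⟨p, hp⟩), ⟨⟨hv₀, hD0'⟩, trivial⟩, Prod.ext rfl (ha0 p)⟩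
  · refine hTT.trans (acl_mono ?_)
    intro v hv
    exact ⟨_, ⟨(v, 0), ⟨hv, trivial⟩, rfl⟩, rfl⟩
  · intro d hd
    have h1 := (hd.of_subset_acl hTT).prod_univ (K := LinearMap.ker (Φ v₀))
    rw [show Module.finrank k (LinearMap.ker (Φ v₀)) = j from hTj v₀ hv₀] at h1
    have h0 : IsPolyMap k fun z : V × P => (z.1, μ z.2) :=
      (isPolyMap_linear (LinearMap.fst k V P)).prodMk
        (isPolyMap_linear (μ ∘ₗ LinearMap.snd k V P))
    -- The map `(v, p) ↦ (v, μ p)` hits every point of `T'` times the fixed kernel: rescaling the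
    -- frame by `(D v)⁻¹` supplies a preimage.
    refine DimGE.of_image h0 (h1.of_subset_acl ?_)
    rintro ⟨v, q⟩ ⟨hv, -⟩
    refine subset_acl _ ⟨φ (v, (D v)⁻¹ • q), ⟨(v, (D v)⁻¹ • q), ⟨hv, trivial⟩, rfl⟩, Prod.ext rfl ?_⟩
    have h2 := (hμ v hv.2 (hn _ hv.1) ((D v)⁻¹ • q)).2
    rw [smul_smul, mul_inv_cancel₀ hv.2, one_smul] at h2
    exact h2

end LocalFrames

/-! ### Strata of constant nullity with maximal dimension -/

section Strata

variable {k V P Q : Type*} [Field k] [AddCommGroup V] [Module k V] [AddCommGroup P] [Module k P]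
  [AddCommGroup Q] [Module k Q]

variable (k) in
/-- The points of nullity `j` that lie in an irreducible set of points of nullity `j` of the
largest possible dimension. -/
def stratum (n : V → ℕ) (j : ℕ) : Set V :=
  {v | ∃ T : Set V, v ∈ T ∧ AIrr k T ∧ (∀ u ∈ T, u ≠ 0 ∧ n u = j) ∧
    ∃ d, Module.finrank k V ≤ d + j ∧ DimGE k T d}

theorem stratum_spec {n : V → ℕ} {j : ℕ} {v : V} (hv : v ∈ stratum k n j) : v ≠ 0 ∧ n v = j := by
  obtain ⟨T, hvT, -, hT, -⟩ := hv
  exact hT v hvT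

variable (k) in
/-- The dimension bound for the loci of constant nullity. -/
def StrataBound (n : V → ℕ) : Prop :=
  ∀ (j : ℕ) (T : Set V), 0 < j → AIrr k T → (∀ u ∈ T, u ≠ 0 ∧ n u = j) →
    ∀ d, DimGE k T d → d + j ≤ Module.finrank k V

/-- The family of kernels is locally given by at most `dim P` equations. -/
def LocallyFewEquations (Φ : V →ₗ[k] P →ₗ[k] Q) : Prop :=
  ∀ v₀ p₀, v₀ ≠ 0 → Φ v₀ p₀ = 0 → ∃ (r : ℕ) (p : Fin r → V × P → k) (h : V × P → k),
    r ≤ Module.finrank k P ∧ (∀ i, p i ∈ PolyFun k (V × P)) ∧ h ∈ PolyFun k (V × P) ∧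
    h (v₀, p₀) ≠ 0 ∧ (∀ i, p i (v₀, p₀) = 0) ∧
    ∀ z, h z ≠ 0 → (∀ i, p i z = 0) → Φ z.1 z.2 = 0

/-- Pairs of a nonzero parameter and a nonzero vector in the kernel. -/
def kernelPairs (Φ : V →ₗ[k] P →ₗ[k] Q) : Set (V × P) :=
  {z | z.1 ≠ 0 ∧ z.2 ≠ 0 ∧ Φ z.1 z.2 = 0}

/-- Pairs over a stratum. -/
def stratumPairs (Φ : V →ₗ[k] P →ₗ[k] Q) (j : ℕ) : Set (V × P) :=
  {z ∈ kernelPairs Φ | z.1 ∈ stratum k (nullity Φ) j}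

variable [FiniteDimensional k V] [FiniteDimensional k P] (Φ : V →ₗ[k] P →ₗ[k] Q)

theorem nullity_pos {z : V × P} (hz : z ∈ kernelPairs Φ) : 0 < nullity Φ z.1 := by
  have : Nontrivial (LinearMap.ker (Φ z.1)) :=
    ⟨⟨z.2, hz.2.2⟩, 0, fun h => hz.2.1 (congrArg Subtype.val h)⟩
  exact Module.finrank_pos

theorem nullity_le (v : V) : nullity Φ v ≤ Module.finrank k P := Submodule.finrank_le _

theorem exists_dual_ne_zero {u : V} (hu : u ≠ 0) : ∃ f : Module.Dual k V, f u ≠ 0 := by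
  by_contra! hc
  exact hu ((Module.forall_dual_apply_eq_zero_iff k _).1 hc)

/-- A polynomial function that forces both components of a pair to be nonzero. -/
theorem exists_nonzero_test {z : V × P} (h1 : z.1 ≠ 0) (h2 : z.2 ≠ 0) :
    ∃ h ∈ PolyFun k (V × P), h z ≠ 0 ∧ ∀ u, h u ≠ 0 → u.1 ≠ 0 ∧ u.2 ≠ 0 := by
  obtain ⟨f, hf⟩ := exists_dual_ne_zero (k := k) h1
  obtain ⟨g, hg⟩ := exists_dual_ne_zero (k := k) h2
  refine ⟨fun u => f u.1 * g u.2, mul_mem_polyFun (dual_mem_polyFun (f ∘ₗ LinearMap.fst k V P))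
    (dual_mem_polyFun (g ∘ₗ LinearMap.snd k V P)), mul_ne_zero hf hg, fun u hu => ⟨?_, ?_⟩⟩
  · intro h
    exact left_ne_zero_of_mul hu (by rw [h, map_zero])
  · intro h
    exact right_ne_zero_of_mul hu (by rw [h, map_zero])

/-- An irreducible set of pairs has a dense part over a locus of constant nullity. -/
theorem AIrr.exists_dense_nullity {C : Set (V × P)} (hC : AIrr k C) (hCB : C ⊆ kernelPairs Φ) :
    ∃ j, ∃ C' ⊆ C, 0 < j ∧ j ≤ Module.finrank k P ∧ AIrr k C' ∧ C ⊆ acl k C' ∧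
      ∀ z ∈ C', Φ z.1 z.2 = 0 ∧ nullity Φ z.1 = j := by
  obtain ⟨j, hj, h1, h2, h3⟩ := hC.exists_dense (Finset.range (Module.finrank k P + 1))
    (C := fun j => {z ∈ C | nullity Φ z.1 = j}) (by
      ext z
      simp only [Set.mem_iUnion, Finset.mem_range]
      exact ⟨fun hz => ⟨_, Nat.lt_succ_of_le (nullity_le Φ z.1), hz, rfl⟩,
        fun ⟨_, _, hz, _⟩ => hz⟩)
  obtain ⟨z, hz⟩ := h3.1
  exact ⟨j, _, h2, hz.2 ▸ nullity_pos Φ (hCB hz.1), Nat.le_of_lt_succ (Finset.mem_range.1 hj), h3,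
    h1, fun z hz => ⟨(hCB hz.1).2.2, hz.2⟩⟩

/-- The projection of `C` itself is the irreducible set of nullity `j` and large dimension that the
definition of a stratum demands. -/
theorem subset_stratumPairs {C : Set (V × P)} (hC : AIrr k C) (hCB : C ⊆ kernelPairs Φ) {j d : ℕ}
    (hCj : ∀ z ∈ C, Φ z.1 z.2 = 0 ∧ nullity Φ z.1 = j)
    (hd : Module.finrank k V ≤ d + j) (hTd : DimGE k (Prod.fst '' C) d) :
    C ⊆ stratumPairs Φ j := fun z hz => by
  refine ⟨hCB hz, Prod.fst '' C, ⟨z, hz, rfl⟩, hC.image (isPolyMap_linear (LinearMap.fst k V P)),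
    ?_, d, hd, hTd⟩
  rintro _ ⟨u, hu, rfl⟩
  exact ⟨(hCB hu).1, (hCj u hu).2⟩

/-- The pairs over the strata are dense. -/
theorem kernelPairs_subset_acl [IsAlgClosed k] (hK : LocallyFewEquations Φ) :
    kernelPairs Φ ⊆ acl k (⋃ i : Fin (Module.finrank k P), stratumPairs Φ (i + 1)) := by
  have : Infinite k := IsAlgClosed.instInfinite
  intro z hz
  obtain ⟨r, p, h, hr, hp, hh, hz0, hpz, hcut⟩ := hK z.1 z.2 hz.1 hz.2.2
  -- At most `dim P` equations in `V × P` leave an irreducible set through `z` of dimension at least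
  -- `dim V`.
  obtain ⟨C, hC, hzC, hCp, d, hd, hCd⟩ := exists_aIrr_of_equations hp hpz
  rw [Module.finrank_prod] at hd
  obtain ⟨t, ht, htz, ht'⟩ := exists_nonzero_test (k := k) hz.1 hz.2.1
  have hht := mul_mem_polyFun hh ht
  have hz1 : h z * t z ≠ 0 := mul_ne_zero hz0 htz
  have hC₁ := hC.ne hht hzC hz1
  have hC₁B : {x ∈ C | h x * t x ≠ 0} ⊆ kernelPairs Φ := by
    rintro u ⟨hu, hu0⟩
    have h1 := ht' u (right_ne_zero_of_mul hu0)
    exact ⟨h1.1, h1.2, hcut u (left_ne_zero_of_mul hu0) (hCp u hu)⟩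
  obtain ⟨j, C₂, hC₂, hj, hjP, hC₂i, hC₂d, hC₂j⟩ := hC₁.exists_dense_nullity Φ hC₁B
  -- Projecting the part of nullity `j` loses at most `j` dimensions, so the image has the dimension
  -- at least `dim V - j` that a stratum requires.
  obtain ⟨d', hd', hTd⟩ := DimGE.of_kernels Φ hC₂i hC₂j
    ((hCd.of_subset_acl (hC.subset_acl_ne hht hzC hz1)).of_subset_acl hC₂d)
  have h1 := subset_stratumPairs Φ hC₂i (hC₂.trans hC₁B) hC₂j (d := d') (by omega) hTd
  obtain ⟨i, rfl⟩ := Nat.exists_eq_succ_of_ne_zero hj.ne'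
  refine acl_mono ?_ (hC₂d (show z ∈ {x ∈ C | h x * t x ≠ 0} from ⟨hzC, hz1⟩))
  exact h1.trans (Set.subset_iUnion (fun i : Fin (Module.finrank k P) => stratumPairs Φ (i + 1))
    ⟨i, hjP⟩)

/-- Every stratum is generically disjoint from the closure of the rest. -/
theorem stratumPairs_subset_acl [IsAlgClosed k] (hU : StrataBound k (nullity Φ)) {j : ℕ}
    (hj : 0 < j) : stratumPairs Φ j ⊆
      acl k (stratumPairs Φ j \ acl k (kernelPairs Φ \ stratumPairs Φ j)) := by
  have : Infinite k := IsAlgClosed.instInfinite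
  rintro ⟨v₀, p₀⟩ hz q hq hqv
  by_contra hqz
  obtain ⟨hzB, T, hvT, hT, hTj, d, hd, hTd⟩ := id hz
  obtain ⟨C, hC, hCT, hCz, hTC, hCd⟩ := exists_kernel_family Φ hT (fun v hv => (hTj v hv).2) hvT
  obtain ⟨t, ht, htz, ht'⟩ := exists_nonzero_test (k := k) hzB.1 hzB.2.1
  have hqt := mul_mem_polyFun hq ht
  have hzC := hCz p₀ hzB.2.2
  have hz1 : q (v₀, p₀) * t (v₀, p₀) ≠ 0 := mul_ne_zero hqz htz
  set C₁ := {x ∈ C | q x * t x ≠ 0} with hC₁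
  have hC₁i : AIrr k C₁ := hC.ne hqt hzC hz1
  have hCC₁ : C ⊆ acl k C₁ := hC.subset_acl_ne hqt hzC hz1
  have hC₁d : DimGE k C₁ (d + j) := (hCd d hTd).of_subset_acl hCC₁
  -- `C₁` consists of pairs over the stratum at which `q` is nonzero. As `q` vanishes on the generic
  -- part of the stratum, `C₁` must lie in the closure of the remaining pairs.
  have hC₁B : C₁ ⊆ acl k (kernelPairs Φ \ stratumPairs Φ j) := by
    rintro u ⟨hu, hu0⟩
    by_contra hc
    have h1 := ht' u (right_ne_zero_of_mul hu0)
    exact left_ne_zero_of_mul hu0 (hqv u ⟨⟨⟨h1.1, h1.2, (hCT u hu).2⟩, T, (hCT u hu).1, hT, hTj, d,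
      hd, hTd⟩, hc⟩)
  obtain ⟨m, R, hR, hBR⟩ := exists_irreducible_decomposition (k := k)
    (kernelPairs Φ \ stratumPairs Φ j)
  obtain ⟨i, -, hi⟩ := hC₁i.exists_subset_acl Finset.univ (C := R) (by
    simpa [← hBR] using hC₁B)
  have hRB : R i ⊆ kernelPairs Φ \ stratumPairs Φ j := by
    rw [hBR]
    exact Set.subset_iUnion R i
  obtain ⟨j', C', hC'R, hj', -, hC'i, hRC', hC'j⟩ :=
    (hR i).exists_dense_nullity Φ fun z hz => (hRB hz).1
  have hC'B : C' ⊆ kernelPairs Φ := fun z hz => (hRB (hC'R hz)).1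
  have hC₁C' : C₁ ⊆ acl k C' := subset_acl_trans hi hRC'
  have hT'i : AIrr k (Prod.fst '' C') := hC'i.image (isPolyMap_linear (LinearMap.fst k V P))
  have hT'j : ∀ u ∈ Prod.fst '' C', u ≠ 0 ∧ nullity Φ u = j' := by
    rintro _ ⟨u, hu, rfl⟩
    exact ⟨(hC'B hu).1, (hC'j u hu).2⟩
  by_cases hex : ∃ g ∈ PolyFun k (V × P), (∀ x ∈ C₁, g x = 0) ∧ ∃ x ∈ C', g x ≠ 0
  -- If `C₁` is not dense in `C'`, then `C'` has dimension at least `d + j + 1 > dim V`, which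
  -- contradicts the bound for its projection.
  · obtain ⟨g, hg, hg1, hg2⟩ := hex
    obtain ⟨d', hd', hTd'⟩ := DimGE.of_kernels Φ hC'i hC'j
      (hC₁d.succ_of_lt hC'i hC₁C' hg hg1 hg2)
    have := hU j' _ hj' hT'i hT'j d' hTd'
    omega
  · push Not at hex
    have hC'C₁ : C' ⊆ acl k C₁ := fun x hx g hg hgC => hex g hg hgC x hx
    obtain ⟨d', hd', hTd'⟩ := DimGE.of_kernels Φ hC'i hC'j (hC₁d.of_subset_acl hC₁C')
    have hfst := isPolyMap_linear (LinearMap.fst k V P)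
    have h1 : Prod.fst '' C' ⊆ acl k T := by
      refine (acl_image hfst hC'C₁).trans (acl_mono ?_)
      rintro _ ⟨u, hu, rfl⟩
      exact (hCT u hu.1).1
    have h2 : T ⊆ acl k (Prod.fst '' C') :=
      subset_acl_trans hTC (acl_image hfst (subset_acl_trans hCC₁ hC₁C'))
    -- Otherwise the projections of `C₁` and `C'` have the same closure. Comparing dimensions
    -- through both bounds gives `j' = j`, so `C'` lies over the very stratum it was chosen to
    -- avoid.
    have h3 := hU j T hj hT hTj d' (hTd'.of_subset_acl h1)
    have h4 := hU j' _ hj' hT'i hT'j d (hTd.of_subset_acl h2)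
    have h5 : j' = j := by omega
    subst h5
    obtain ⟨u, hu⟩ := hC'i.1
    exact (hRB (hC'R hu)).2 (subset_stratumPairs Φ hC'i hC'B hC'j (d := d') (by omega) hTd' hu)

end Strata

/-! ### Auxiliary linear algebra: Pfaffians and pencils -/

/-- A singular skew matrix of size six, given by its entries above the diagonal, has vanishing
Pfaffian. -/
theorem pfaffian_mul_eq_zero {R : Type*} [CommRing R] {m01 m02 m03 m04 m05 m12 m13 m14 m15 m23
      m24 m25 m34 m35 m45 c0 c1 c2 c3 c4 c5 : R}
    (h0 : m01 * c1 + m02 * c2 + m03 * c3 + m04 * c4 + m05 * c5 = 0)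
    (h1 : -m01 * c0 + m12 * c2 + m13 * c3 + m14 * c4 + m15 * c5 = 0)
    (h2 : -m02 * c0 - m12 * c1 + m23 * c3 + m24 * c4 + m25 * c5 = 0)
    (h3 : -m03 * c0 - m13 * c1 - m23 * c2 + m34 * c4 + m35 * c5 = 0)
    (h4 : -m04 * c0 - m14 * c1 - m24 * c2 - m34 * c3 + m45 * c5 = 0)
    (h5 : -m05 * c0 - m15 * c1 - m25 * c2 - m35 * c3 - m45 * c4 = 0) (P : R)
    (hP : P = m01 * (m23 * m45 - m24 * m35 + m25 * m34) - m02 * (m13 * m45 - m14 * m35 + m15 *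
      m34) + m03 * (m12 * m45 - m14 * m25 + m15 * m24) - m04 * (m12 * m35 - m13 * m25 + m15 *
      m23) + m05 * (m12 * m34 - m13 * m24 + m14 * m23)) :
    c0 * P = 0 ∧ c1 * P = 0 ∧ c2 * P = 0 ∧ c3 * P = 0 ∧ c4 * P = 0 ∧ c5 * P = 0 := by
  subst hP
  refine ⟨?_, ?_, ?_, ?_, ?_, ?_⟩
  -- The coefficients are entries of the Pfaffian adjoint, the signed Pfaffians of principal
  -- submatrices of size four; its product with the matrix is the Pfaffian times the identity, up to
  -- sign.
  · linear_combination -(m23 * m45 - m24 * m35 + m25 * m34) * h1 + (m13 * m45 - m14 * m35 + m15 *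
      m34) * h2 - (m12 * m45 - m14 * m25 + m15 * m24) * h3 + (m12 * m35 - m13 * m25 + m15 * m23)
      * h4 - (m12 * m34 - m13 * m24 + m14 * m23) * h5
  · linear_combination (m23 * m45 - m24 * m35 + m25 * m34) * h0 - (m03 * m45 - m04 * m35 + m05 *
      m34) * h2 + (m02 * m45 - m04 * m25 + m05 * m24) * h3 - (m02 * m35 - m03 * m25 + m05 * m23)
      * h4 + (m02 * m34 - m03 * m24 + m04 * m23) * h5
  · linear_combination -(m13 * m45 - m14 * m35 + m15 * m34) * h0 + (m03 * m45 - m04 * m35 + m05 *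
      m34) * h1 - (m01 * m45 - m04 * m15 + m05 * m14) * h3 + (m01 * m35 - m03 * m15 + m05 * m13)
      * h4 - (m01 * m34 - m03 * m14 + m04 * m13) * h5
  · linear_combination (m12 * m45 - m14 * m25 + m15 * m24) * h0 - (m02 * m45 - m04 * m25 + m05 *
      m24) * h1 + (m01 * m45 - m04 * m15 + m05 * m14) * h2 - (m01 * m25 - m02 * m15 + m05 * m12)
      * h4 + (m01 * m24 - m02 * m14 + m04 * m12) * h5
  · linear_combination -(m12 * m35 - m13 * m25 + m15 * m23) * h0 + (m02 * m35 - m03 * m25 + m05 *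
      m23) * h1 - (m01 * m35 - m03 * m15 + m05 * m13) * h2 + (m01 * m25 - m02 * m15 + m05 * m12)
      * h3 - (m01 * m23 - m02 * m13 + m03 * m12) * h5
  · linear_combination (m12 * m34 - m13 * m24 + m14 * m23) * h0 - (m02 * m34 - m03 * m24 + m04 *
      m23) * h1 + (m01 * m34 - m03 * m14 + m04 * m13) * h2 - (m01 * m24 - m02 * m14 + m04 * m12)
      * h3 + (m01 * m23 - m02 * m13 + m03 * m12) * h4

/-- A function of four indices that changes sign under transpositions of neighbours vanishes if it
vanishes on increasing indices. -/
theorem eq_zero_of_increasing {k ι : Type*} [Field k] [CharZero k] [LinearOrder ι]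
    {Q : ι → ι → ι → ι → k} (h12 : ∀ a b c d, Q a b c d = -Q b a c d)
    (h23 : ∀ a b c d, Q a b c d = -Q a c b d) (h34 : ∀ a b c d, Q a b c d = -Q a b d c)
    (h : ∀ a b c d, a < b → b < c → c < d → Q a b c d = 0) (a b c d : ι) : Q a b c d = 0 := by
  have e12 : ∀ a c d, Q a a c d = 0 := fun a c d => self_eq_neg.1 (h12 a a c d)
  have e23 : ∀ a b d, Q a b b d = 0 := fun a b d => self_eq_neg.1 (h23 a b b d)
  have e34 : ∀ a b c, Q a b c c = 0 := fun a b c => self_eq_neg.1 (h34 a b c c)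
  have s3 : ∀ a b c d, a < b → b < c → Q a b c d = 0 := by
    intro a b c d hab hbc
    rcases lt_trichotomy c d with h1 | rfl | h1
    · exact h _ _ _ _ hab hbc h1
    · exact e34 _ _ _
    rw [h34, neg_eq_zero]
    rcases lt_trichotomy b d with h2 | rfl | h2
    · exact h _ _ _ _ hab h2 h1
    · exact e23 _ _ _
    rw [h23, neg_eq_zero]
    rcases lt_trichotomy a d with h3 | rfl | h3
    · exact h _ _ _ _ h3 h2 hbc
    · exact e12 _ _ _
    rw [h12, neg_eq_zero]
    exact h _ _ _ _ h3 hab hbc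
  have s2 : ∀ a b c d, a < b → Q a b c d = 0 := by
    intro a b c d hab
    rcases lt_trichotomy b c with h1 | rfl | h1
    · exact s3 _ _ _ _ hab h1
    · exact e23 _ _ _
    rw [h23, neg_eq_zero]
    rcases lt_trichotomy a c with h2 | rfl | h2
    · exact s3 _ _ _ _ h2 h1
    · exact e12 _ _ _
    rw [h12, neg_eq_zero]
    exact s3 _ _ _ _ h2 hab
  rcases lt_trichotomy a b with h1 | rfl | h1
  · exact s2 _ _ _ _ h1
  · exact e12 _ _ _
  rw [h12, neg_eq_zero]
  exact s2 _ _ _ _ h1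

/-- A linear family of linear maps to a space of at most the same dimension has a singular
member, if the family is at least two-dimensional. -/
theorem exists_singular_member {k X N R : Type*} [Field k] [IsAlgClosed k]
    [AddCommGroup X] [Module k X]
    [AddCommGroup N] [Module k N] [AddCommGroup R] [Module k R] [FiniteDimensional k N]
    [FiniteDimensional k R]
    (hX : 2 ≤ Module.finrank k X) (hN : 0 < Module.finrank k N)
    (hR : Module.finrank k R ≤ Module.finrank k N) (T : X →ₗ[k] N →ₗ[k] R) :
    ∃ x ≠ 0, ∃ n ≠ 0, T x n = 0 := by
  by_contra! hc
  have hN' : Nontrivial N := Module.nontrivial_of_finrank_pos hN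
  have hX' : Nontrivial X := Module.nontrivial_of_finrank_pos (R := k) (by omega)
  obtain ⟨x, hx⟩ := exists_ne (0 : X)
  obtain ⟨y, hy⟩ := exists_linearIndependent_pair_of_one_lt_finrank (R := k)
    (show 1 < Module.finrank k X by omega) hx
  have hinj : Function.Injective (T x) := (injective_iff_map_eq_zero _).2 fun n hn => by
    by_contra h
    exact hc x hx n h hn
  have hd : Module.finrank k N = Module.finrank k R :=
    le_antisymm (LinearMap.finrank_le_finrank_of_injective hinj) hR
  let e : N ≃ₗ[k] R := LinearEquiv.ofInjectiveOfFinrankEq (T x) hinj hd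
  -- An eigenvalue `c` of `(T x)⁻¹ ∘ T y` makes the member at `y - c • x` singular.
  obtain ⟨c, hcv⟩ := Module.End.exists_eigenvalue (K := k) (V := N) (e.symm.toLinearMap ∘ₗ T y)
  obtain ⟨n, hn⟩ := hcv.exists_hasEigenvector
  have h1 : T y n = c • T x n := by
    have h2 := congrArg e hn.apply_eq_smul
    rw [map_smul] at h2
    change e (e.symm (T y n)) = c • T x n at h2
    rwa [e.apply_symm_apply] at h2
  refine hc (y - c • x) (fun h => ?_) n hn.2 (by simp [h1])
  have := LinearIndependent.pair_iff.1 hy (-c) 1 (by rw [← h]; module)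
  exact one_ne_zero this.2

section

variable {k V : Type*} [Field k] [AddCommGroup V] [Module k V] [FiniteDimensional k V]

/-- Every nonzero vector is the first vector of a basis. -/
theorem exists_basis_zero_eq {n : ℕ} (hV : Module.finrank k V = n + 1) {v : V} (hv : v ≠ 0) :
    ∃ b : Module.Basis (Fin (n + 1)) k V, b 0 = v := by
  obtain ⟨l, hl⟩ := exists_dual_ne_zero (k := k) hv
  have hd : Module.finrank k (LinearMap.ker l) = n := by
    have h1 := LinearMap.finrank_range_add_finrank_ker l
    have h2 : LinearMap.range l = ⊤ := LinearMap.range_eq_top.2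
      (LinearMap.surjective (f := l) fun h => hl (by rw [h]; rfl))
    rw [h2, finrank_top, Module.finrank_self] at h1
    omega
  refine ⟨Module.Basis.mkFinCons v (Module.finBasisOfFinrankEq k (LinearMap.ker l) hd)
    (fun c x hx h => ?_) (fun z => ⟨-(l z * (l v)⁻¹), ?_⟩), ?_⟩
  · have h1 := congrArg l h
    have h2 : l x = 0 := hx
    rw [map_add, map_smul, h2, add_zero, map_zero, smul_eq_mul] at h1
    exact (mul_eq_zero.1 h1).resolve_right hl
  · rw [LinearMap.mem_ker, map_add, map_smul, smul_eq_mul]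
    field_simp
    ring
  · rw [Module.Basis.coe_mkFinCons, Fin.cons_zero]

end

/-! ### Linear spaces of degenerate skew forms -/

section Polar

variable {k V A : Type*} [Field k] [AddCommGroup V] [Module k V] [AddCommGroup A] [Module k A]
  (B : A →ₗ[k] V →ₗ[k] V →ₗ[k] k)

/-- The polar form of the Pfaffian of the restriction of a form to four vectors. -/
def pfPolar (x y z w : V) : A →ₗ[k] A →ₗ[k] k :=
  LinearMap.mk₂ k (fun a a' => B a x y * B a' z w + B a z w * B a' x y - B a x z * B a' y w -
      B a y w * B a' x z + B a x w * B a' y z + B a y z * B a' x w)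
    (fun a₁ a₂ a' => by simp only [map_add, LinearMap.add_apply]; ring)
    (fun c a a' => by simp only [map_smul, LinearMap.smul_apply, smul_eq_mul]; ring)
    (fun a a₁ a₂ => by simp only [map_add, LinearMap.add_apply]; ring)
    (fun c a a' => by simp only [map_smul, LinearMap.smul_apply, smul_eq_mul]; ring)

theorem pfPolar_apply (x y z w : V) (a a' : A) : pfPolar B x y z w a a' =
    B a x y * B a' z w + B a z w * B a' x y - B a x z * B a' y w -
      B a y w * B a' x z + B a x w * B a' y z + B a y z * B a' x w := rfl

/-- The polarization of the kernel vector of a skew form on a five-dimensional space. -/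
def kerPolar (e : Fin 5 → V) : A →ₗ[k] A →ₗ[k] V :=
  LinearMap.mk₂ k (fun a a' => pfPolar B (e 1) (e 2) (e 3) (e 4) a a' • e 0 -
      pfPolar B (e 0) (e 2) (e 3) (e 4) a a' • e 1 + pfPolar B (e 0) (e 1) (e 3) (e 4) a a' • e 2 -
      pfPolar B (e 0) (e 1) (e 2) (e 4) a a' • e 3 + pfPolar B (e 0) (e 1) (e 2) (e 3) a a' • e 4)
    (fun a₁ a₂ a' => by simp only [map_add, LinearMap.add_apply]; module)
    (fun c a a' => by simp only [map_smul, LinearMap.smul_apply, smul_eq_mul]; module)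
    (fun a a₁ a₂ => by simp only [map_add]; module)
    (fun c a a' => by simp only [map_smul, smul_eq_mul]; module)

theorem kerPolar_apply (e : Fin 5 → V) (a a' : A) : kerPolar B e a a' =
    pfPolar B (e 1) (e 2) (e 3) (e 4) a a' • e 0 -
      pfPolar B (e 0) (e 2) (e 3) (e 4) a a' • e 1 + pfPolar B (e 0) (e 1) (e 3) (e 4) a a' • e 2 -
      pfPolar B (e 0) (e 1) (e 2) (e 4) a a' • e 3 +
      pfPolar B (e 0) (e 1) (e 2) (e 3) a a' • e 4 := rfl

theorem kerPolar_comm (e : Fin 5 → V) (a a' : A) : kerPolar B e a a' = kerPolar B e a' a := by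
  have h : ∀ x y z w, pfPolar B x y z w a a' = pfPolar B x y z w a' a := fun x y z w => by
    rw [pfPolar_apply, pfPolar_apply]; ring
  simp only [kerPolar_apply, h]

variable {B}


theorem swap_of_alternating (hB : ∀ a v, B a v v = 0) (a : A) (v w : V) : B a w v = -B a v w := by
  have h := hB a (v + w)
  simp only [map_add, LinearMap.add_apply] at h
  rw [hB, hB] at h
  linear_combination h

/-- This polarizes a cubic identity: the vector of signed Pfaffians of size four lies in the kernel
of a skew matrix of size five. Putting `a' = a` gives three times that identity. -/
theorem polar_apply_kerPolar (hB : ∀ a v, B a v v = 0) (e : Fin 5 → V) (a a' : A) (l : Fin 5) :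
    2 * B a (kerPolar B e a a') (e l) + B a' (kerPolar B e a a) (e l) = 0 := by
  have h := fun a i j => swap_of_alternating hB a (e i) (e j)
  have h0 := fun a i => hB a (e i)
  rw [kerPolar_apply, kerPolar_apply]
  simp only [map_add, map_sub, map_smul, LinearMap.add_apply, LinearMap.sub_apply,
    LinearMap.smul_apply, smul_eq_mul, pfPolar_apply]
  fin_cases l
  all_goals
    simp only [Fin.zero_eta, Fin.mk_one, Fin.reduceFinMk, h0, h _ 0 1, h _ 0 2, h _ 0 3, h _ 0 4,
      h _ 1 2, h _ 1 3, h _ 1 4, h _ 2 3, h _ 2 4, h _ 3 4]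
    ring

variable [CharZero k]

theorem apply_kerPolar_self (hB : ∀ a v, B a v v = 0) (e : Fin 5 → V) (a : A) (l : Fin 5) :
    B a (kerPolar B e a a) (e l) = 0 := by
  have h := polar_apply_kerPolar hB e a a l
  have h3 : (3 : k) * B a (kerPolar B e a a) (e l) = 0 := by linear_combination h
  exact (mul_eq_zero.1 h3).resolve_left (by norm_num)

variable (B) in
/-- The Pfaffian in terms of a basis. -/
def pf6 (v : V) (e : Fin 5 → V) (a : A) : k :=
  B a v (e 0) * (B a (e 1) (e 2) * B a (e 3) (e 4) - B a (e 1) (e 3) * B a (e 2) (e 4) +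
      B a (e 1) (e 4) * B a (e 2) (e 3)) -
    B a v (e 1) * (B a (e 0) (e 2) * B a (e 3) (e 4) - B a (e 0) (e 3) * B a (e 2) (e 4) +
      B a (e 0) (e 4) * B a (e 2) (e 3)) +
    B a v (e 2) * (B a (e 0) (e 1) * B a (e 3) (e 4) - B a (e 0) (e 3) * B a (e 1) (e 4) +
      B a (e 0) (e 4) * B a (e 1) (e 3)) -
    B a v (e 3) * (B a (e 0) (e 1) * B a (e 2) (e 4) - B a (e 0) (e 2) * B a (e 1) (e 4) +
      B a (e 0) (e 4) * B a (e 1) (e 2)) +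
    B a v (e 4) * (B a (e 0) (e 1) * B a (e 2) (e 3) - B a (e 0) (e 2) * B a (e 1) (e 3) +
      B a (e 0) (e 3) * B a (e 1) (e 2))

/-- The Pfaffian adjoint shows that the Pfaffian annihilates every coordinate of a kernel vector. -/
theorem pf6_eq_zero (hB : ∀ a v, B a v v = 0) (b : Module.Basis (Fin 6) k V) {a : A} {u : V}
    (hu : u ≠ 0)
    (hau : B a u = 0) : pf6 B (b 0) (fun i => b i.succ) a = 0 := by
  have h := fun i j => swap_of_alternating hB a (b i) (b j)
  have hrow : ∀ i, B a (b i) u = 0 := fun i => by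
    rw [swap_of_alternating hB, hau, LinearMap.zero_apply, neg_zero]
  have hrow' : ∀ i, ∑ j, b.repr u j * B a (b i) (b j) = 0 := fun i => by
    rw [← hrow i]
    conv_rhs => rw [← b.sum_repr u, map_sum]
    simp
  have key := pfaffian_mul_eq_zero (m01 := B a (b 0) (b 1)) (m02 := B a (b 0) (b 2))
    (m03 := B a (b 0) (b 3)) (m04 := B a (b 0) (b 4)) (m05 := B a (b 0) (b 5))
    (m12 := B a (b 1) (b 2)) (m13 := B a (b 1) (b 3)) (m14 := B a (b 1) (b 4))
    (m15 := B a (b 1) (b 5)) (m23 := B a (b 2) (b 3)) (m24 := B a (b 2) (b 4))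
    (m25 := B a (b 2) (b 5)) (m34 := B a (b 3) (b 4)) (m35 := B a (b 3) (b 5))
    (m45 := B a (b 4) (b 5)) (c0 := b.repr u 0) (c1 := b.repr u 1) (c2 := b.repr u 2)
    (c3 := b.repr u 3) (c4 := b.repr u 4) (c5 := b.repr u 5)
    (by have := hrow' 0; rw [Fin.sum_univ_six, hB] at this; linear_combination this)
    (by have := hrow' 1; rw [Fin.sum_univ_six, hB, h 0] at this; linear_combination this)
    (by have := hrow' 2; rw [Fin.sum_univ_six, hB, h 0, h 1] at this; linear_combination this)
    (by have := hrow' 3; rw [Fin.sum_univ_six, hB, h 0, h 1, h 2] at this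
        linear_combination this)
    (by have := hrow' 4; rw [Fin.sum_univ_six, hB, h 0, h 1, h 2, h 3] at this
        linear_combination this)
    (by have := hrow' 5; rw [Fin.sum_univ_six, hB, h 0, h 1, h 2, h 3, h 4] at this
        linear_combination this) (pf6 B (b 0) (fun i => b i.succ) a) rfl
  have hc : ∃ j, b.repr u j ≠ 0 := by
    by_contra! hc
    exact hu (b.ext_elem fun j => by simp [hc])
  obtain ⟨h0, h1, h2, h3, h4, h5⟩ := key
  obtain ⟨j, hj⟩ := hc
  have hall : ∀ j, b.repr u j * pf6 B (b 0) (fun i => b i.succ) a = 0 := by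
    intro j
    fin_cases j
    exacts [h0, h1, h2, h3, h4, h5]
  exact (mul_eq_zero.1 (hall j)).resolve_left hj

/-- Expand along the row of `v`. That row is the same for all four forms because `a` and `a'` kill
`v`, so the second difference merely polarizes the quadratic cofactors. -/
theorem pf6_polar {v : V} (e : Fin 5 → V) (z : A) {a a' : A} (ha : B a v = 0) (ha' : B a' v = 0) :
    pf6 B v e (z + a + a') - pf6 B v e (z + a) - pf6 B v e (z + a') + pf6 B v e z =
      B z v (kerPolar B e a a') := by
  simp only [pf6, kerPolar_apply, map_add, map_sub, map_smul, LinearMap.add_apply, ha, ha',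
    LinearMap.zero_apply, smul_eq_mul, pfPolar_apply]
  ring

variable [FiniteDimensional k V]

/-- A form on a six-dimensional space with a kernel vector has rank at most two, if all principal
Pfaffians of size four of the induced form on the quotient vanish. -/
theorem four_le_finrank_ker (hB : ∀ a v, B a v v = 0) (b : Module.Basis (Fin 6) k V) {a : A}
    (ha : B a (b 0) = 0)
    (hκ : kerPolar B (fun i => b i.succ) a a = 0) : 4 ≤ Module.finrank k (LinearMap.ker (B a)) := by
  set e : Fin 5 → V := fun i => b i.succ with he
  have hs := fun i j => swap_of_alternating hB a (e i) (e j)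
  have hV : Module.finrank k V = 6 := by simpa using Module.finrank_eq_card_basis b
  have hli : LinearIndependent k e := b.linearIndependent.comp _ (Fin.succ_injective 5)
  have hcoef := Fintype.linearIndependent_iff.1 hli
    ![pfPolar B (e 1) (e 2) (e 3) (e 4) a a, -pfPolar B (e 0) (e 2) (e 3) (e 4) a a,
      pfPolar B (e 0) (e 1) (e 3) (e 4) a a, -pfPolar B (e 0) (e 1) (e 2) (e 4) a a,
      pfPolar B (e 0) (e 1) (e 2) (e 3) a a] (by
        rw [← hκ, kerPolar_apply, Fin.sum_univ_five]
        simp only [Matrix.cons_val]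
        module)
  let Q : V → V → V → V → k := fun x y z w =>
    B a x y * B a z w - B a x z * B a y w + B a x w * B a y z
  have hQ : ∀ x y z w, pfPolar B x y z w a a = 2 * Q x y z w := fun x y z w => by
    rw [pfPolar_apply]; ring
  have h2 : (2 : k) ≠ 0 := two_ne_zero
  have hinc : ∀ i j m l : Fin 5, i < j → j < m → m < l → Q (e i) (e j) (e m) (e l) = 0 := by
    have henum : ∀ i j m l : Fin 5, i < j → j < m → m < l →
        (i = 1 ∧ j = 2 ∧ m = 3 ∧ l = 4) ∨ (i = 0 ∧ j = 2 ∧ m = 3 ∧ l = 4) ∨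
        (i = 0 ∧ j = 1 ∧ m = 3 ∧ l = 4) ∨ (i = 0 ∧ j = 1 ∧ m = 2 ∧ l = 4) ∨
        (i = 0 ∧ j = 1 ∧ m = 2 ∧ l = 3) := by decide
    intro i j m l h1 h3 h4
    rcases henum i j m l h1 h3 h4 with ⟨rfl, rfl, rfl, rfl⟩ | ⟨rfl, rfl, rfl, rfl⟩ |
      ⟨rfl, rfl, rfl, rfl⟩ | ⟨rfl, rfl, rfl, rfl⟩ | ⟨rfl, rfl, rfl, rfl⟩
    · simpa [hQ] using hcoef 0
    · simpa [hQ] using hcoef 1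
    · simpa [hQ] using hcoef 2
    · simpa [hQ] using hcoef 3
    · simpa [hQ] using hcoef 4
  have hQ0 : ∀ i j m l : Fin 5, Q (e i) (e j) (e m) (e l) = 0 :=
    eq_zero_of_increasing (Q := fun i j m l => Q (e i) (e j) (e m) (e l))
      (fun i j m l => by simp only [Q, hs i j]; ring) (fun i j m l => by simp only [Q, hs j m]; ring)
      (fun i j m l => by simp only [Q, hs m l]; ring) hinc
  have ha' : ∀ x, B a x (b 0) = 0 := fun x => by
    rw [swap_of_alternating hB, ha, LinearMap.zero_apply, neg_zero]
  by_cases hm : ∃ i j, B a (e i) (e j) ≠ 0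
  · obtain ⟨i, j, hij⟩ := hm
    -- Since `B a (e i) (e j) ≠ 0`, the vanishing Pfaffians of size four express every value of the
    -- form through pairings with `e i` and `e j`. The kernel then has codimension at most two.
    let L : V →ₗ[k] k × k := ((B a).flip (e i)).prod ((B a).flip (e j))
    have hL : LinearMap.ker L ≤ LinearMap.ker (B a) := by
      intro x hx
      replace hx : (B a x (e i), B a x (e j)) = 0 := hx
      rw [Prod.mk_eq_zero] at hx
      refine b.ext fun l => ?_
      rw [LinearMap.zero_apply]
      refine Fin.cases (ha' x) (fun l => ?_) l
      have hQx : Q x (e l) (e i) (e j) = 0 := by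
        let Qx : V →ₗ[k] k := B a (e i) (e j) • (B a).flip (e l) - B a (e l) (e j) • (B a).flip (e i)
          + B a (e l) (e i) • (B a).flip (e j)
        have : Qx = 0 := b.ext fun m => by
          refine Fin.cases ?_ (fun m => ?_) m
          · simp [Qx, ha]
          · have := hQ0 m l i j
            simp only [Q] at this
            simp only [Qx, LinearMap.add_apply, LinearMap.sub_apply, LinearMap.smul_apply,
              LinearMap.flip_apply, smul_eq_mul, LinearMap.zero_apply]
            linear_combination this
        have := congrArg (fun T => T x) this
        simp only [Qx, LinearMap.add_apply, LinearMap.sub_apply, LinearMap.smul_apply,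
              LinearMap.flip_apply, smul_eq_mul, LinearMap.zero_apply] at this
        simp only [Q]
        linear_combination this
      simp only [Q, hx.1, hx.2, zero_mul, sub_zero, add_zero] at hQx
      exact (mul_eq_zero.1 hQx).resolve_right hij
    have h1 := LinearMap.finrank_range_add_finrank_ker L
    have h3 := Submodule.finrank_le (LinearMap.range L)
    rw [Module.finrank_prod, Module.finrank_self] at h3
    have := Submodule.finrank_mono hL
    omega
  · push Not at hm
    have : B a = 0 := by
      refine b.ext fun i => b.ext fun j => ?_
      refine Fin.cases (by simp [ha]) (fun i => ?_) i
      refine Fin.cases (by simp [ha']) (fun j => by simpa using hm i j) j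
    rw [this, LinearMap.ker_zero, finrank_top, hV]
    norm_num

/-- A vector in a kernel of dimension at most two, in terms of a basis adapted to a functional. -/
theorem eq_add_smul_of_mem {K : Submodule k V} (hK : Module.finrank k K ≤ 2) (l : Module.Dual k V)
    {u x w : V} (hu : u ∈ K) (hx : x ∈ K) (hw : w ∈ K) (hlu : l u = 1) (hlx : l x = 0)
    (hx0 : x ≠ 0) : ∃ c : k, w = l w • u + c • x := by
  have hli : LinearIndependent k ![(⟨u, hu⟩ : K), ⟨x, hx⟩] := by
    refine LinearIndependent.pair_iff.2 fun s t hst => ?_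
    have h1 : s • u + t • x = 0 := congrArg Subtype.val hst
    have h2 := congrArg l h1
    simp only [map_add, map_smul, hlu, hlx, smul_eq_mul, mul_one, mul_zero, add_zero,
      map_zero] at h2
    subst h2
    refine ⟨rfl, ?_⟩
    rw [zero_smul, zero_add] at h1
    exact (smul_eq_zero.1 h1).resolve_right hx0
  have hspan := hli.span_eq_top_of_card_eq_finrank (by
    have := hli.fintype_card_le_finrank
    simp only [Fintype.card_fin] at this ⊢
    omega)
  have hmem : (⟨w, hw⟩ : K) ∈ Submodule.span k (Set.range ![(⟨u, hu⟩ : K), ⟨x, hx⟩]) := by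
    rw [hspan]; trivial
  rw [Matrix.range_cons, Matrix.range_cons, Matrix.range_empty, Set.union_empty,
    Set.singleton_union, Submodule.mem_span_pair] at hmem
  obtain ⟨s, t, hst⟩ := hmem
  have h1 : s • u + t • x = w := congrArg Subtype.val hst
  have h2 : l w = s := by rw [← h1]; simp [hlu, hlx]
  exact ⟨t, by rw [h2, h1]⟩

/-- The kernel of a degenerate skew form on a six-dimensional space has dimension at least two. -/
theorem two_le_finrank_ker (hB : ∀ a v, B a v v = 0) (hV : Module.finrank k V = 6) {a : A} {u : V}
    (hu : u ≠ 0) (hau : B a u = 0) : 2 ≤ Module.finrank k (LinearMap.ker (B a)) := by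
  obtain ⟨b, rfl⟩ := exists_basis_zero_eq (n := 5) hV hu
  by_cases hκ : kerPolar B (fun i => b i.succ) a a = 0
  · have := four_le_finrank_ker hB b hau hκ
    omega
  have hmem : kerPolar B (fun i => b i.succ) a a ∈ LinearMap.ker (B a) := by
    refine b.ext fun i => Fin.cases ?_ (fun i => ?_) i
    · rw [swap_of_alternating hB, hau, LinearMap.zero_apply, LinearMap.zero_apply, neg_zero]
    · exact apply_kerPolar_self hB (fun i => b i.succ) a i
  have hl : b.coord 0 (kerPolar B (fun i => b i.succ) a a) = 0 := by
    rw [kerPolar_apply]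
    simp
  have hli : LinearIndependent k ![(⟨b 0, hau⟩ : LinearMap.ker (B a)), ⟨_, hmem⟩] := by
    refine LinearIndependent.pair_iff.2 fun s t hst => ?_
    have h1 : s • b 0 + t • kerPolar B (fun i => b i.succ) a a = 0 := congrArg Subtype.val hst
    have h2 := congrArg (b.coord 0) h1
    rw [map_add, map_smul, map_smul, hl, smul_zero, add_zero, LinearMap.map_zero] at h2
    simp only [Module.Basis.coord_apply, Module.Basis.repr_self, Finsupp.single_eq_same,
      smul_eq_mul, mul_one] at h2
    subst h2
    refine ⟨rfl, ?_⟩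
    rw [zero_smul, zero_add] at h1
    exact (smul_eq_zero.1 h1).resolve_right hκ
  simpa using hli.fintype_card_le_finrank

/-- The bilinear kernel vector of the forms that have a given vector in their kernel, for a linear
space of degenerate forms whose nonzero members have kernels of dimension at most two. -/
theorem exists_kerPolar (hB : ∀ a v, B a v v = 0) (hV : Module.finrank k V = 6)
    (hker : ∀ a ≠ 0, Module.finrank k (LinearMap.ker (B a)) ≤ 2)
    (hdeg : ∀ a, ∃ u ≠ 0, B a u = 0) {v : V} (hv : v ≠ 0) :
    ∃ (l : Module.Dual k V) (κ : A →ₗ[k] A →ₗ[k] V), l v = 1 ∧ (∀ a a', l (κ a a') = 0) ∧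
      (∀ a a', κ a a' = κ a' a) ∧
      (∀ a, B a v = 0 → B a (κ a a) = 0 ∧ (κ a a = 0 → a = 0)) ∧
      (∀ a a', B a v = 0 → B a' v = 0 → κ a a' = 0 → B a' (κ a a) = 0) ∧
      ∀ z a a', B a v = 0 → B a' v = 0 → B z v (κ a a') = 0 := by
  obtain ⟨b, hb⟩ := exists_basis_zero_eq (n := 5) hV hv
  subst hb
  have hl : ∀ (a a' : A), b.coord 0 (kerPolar B (fun i => b i.succ) a a') = 0 := fun a a' => by
    rw [kerPolar_apply]
    simp
  have hflip : ∀ a, B a (b 0) = 0 → ∀ x, B a x (b 0) = 0 := fun a ha x => by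
    rw [swap_of_alternating hB, ha, LinearMap.zero_apply, neg_zero]
  refine ⟨b.coord 0, kerPolar B fun i => b i.succ, by simp, hl, kerPolar_comm B _,
    fun a ha => ⟨?_, fun h => ?_⟩, fun a a' ha ha' h => ?_, fun z a a' ha ha' => ?_⟩
  · refine b.ext fun i => Fin.cases ?_ (fun i => ?_) i
    · exact hflip a ha _
    · exact apply_kerPolar_self hB (fun i => b i.succ) a i
  · by_contra ha0
    have := four_le_finrank_ker hB b ha h
    have := hker a ha0
    omega
  · refine b.ext fun i => Fin.cases ?_ (fun i => ?_) i
    · exact hflip a' ha' _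
    · have := polar_apply_kerPolar hB (fun i => b i.succ) a a' i
      rwa [h, map_zero, LinearMap.zero_apply, mul_zero, zero_add] at this
  -- The Pfaffian vanishes on the whole space of forms, hence so do its second differences; this
  -- yields a linear condition on every form `z`.
  · have h0 : ∀ d, pf6 B (b 0) (fun i => b i.succ) d = 0 := fun d => by
      obtain ⟨u, hu, hdu⟩ := hdeg d
      exact pf6_eq_zero hB b hu hdu
    rw [← pf6_polar (fun i => b i.succ) z ha ha']
    simp [h0]

/-- There is no five-dimensional linear space of degenerate skew forms on a six-dimensional space
whose nonzero members have kernels of dimension at most two. -/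
theorem exists_nondegenerate [IsAlgClosed k] [FiniteDimensional k A] (hB : ∀ a v, B a v v = 0)
    (hV : Module.finrank k V = 6) (hA : Module.finrank k A = 5)
    (hker : ∀ a ≠ 0, Module.finrank k (LinearMap.ker (B a)) ≤ 2) :
    ∃ a, ∀ u, B a u = 0 → u = 0 := by
  by_contra! hdeg
  replace hdeg : ∀ a, ∃ u ≠ 0, B a u = 0 := fun a => by
    obtain ⟨u, h1, h2⟩ := hdeg a
    exact ⟨u, h2, h1⟩
  have hA' : Nontrivial A := Module.nontrivial_of_finrank_pos (R := k) (by omega)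
  obtain ⟨a₀, ha₀⟩ := exists_ne (0 : A)
  set K := LinearMap.ker (B a₀) with hK
  have hK2 := hker a₀ ha₀
  -- Degeneracy of the whole space makes `K` isotropic for every form: for `u ≠ 0` in `K`, the plane
  -- is spanned by `u` and `κ a₀ a₀`, and `z` vanishes on this pair.
  have hiso : ∀ z, ∀ u ∈ K, ∀ w ∈ K, B z u w = 0 := by
    intro z u hu w hw
    by_cases hu0 : u = 0
    · simp [hu0]
    obtain ⟨l, κ, hl, hlκ, -, hκ, -, hzκ⟩ := exists_kerPolar hB hV hker hdeg hu0
    obtain ⟨c, hc⟩ := eq_add_smul_of_mem hK2 l hu (hκ a₀ hu).1 hw hl (hlκ _ _)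
      fun h => ha₀ ((hκ a₀ hu).2 h)
    rw [hc, map_add, map_smul, map_smul, hB, hzκ z a₀ a₀ hu hu]
    simp
  have hKdim : Module.finrank k K = 2 := by
    obtain ⟨u, hu0, hu⟩ := hdeg a₀
    exact le_antisymm hK2 (two_le_finrank_ker hB hV hu0 hu)
  obtain ⟨u, hu0, hu2⟩ : ∃ u ≠ 0, 2 ≤ Module.finrank k (LinearMap.ker (B.flip u)) := by
    obtain ⟨f, hf⟩ := exists_dual_ne_zero (k := k) ha₀
    have hN : Module.finrank k (LinearMap.ker f) = 4 := by
      have h1 := LinearMap.finrank_range_add_finrank_ker f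
      have h2 : LinearMap.range f = ⊤ := LinearMap.range_eq_top.2
        (LinearMap.surjective (f := f) fun h => hf (by rw [h]; rfl))
      rw [h2, finrank_top, Module.finrank_self] at h1
      omega
    have hR : Module.finrank k K.dualAnnihilator = 4 := by
      have := Subspace.finrank_add_finrank_dualAnnihilator_eq K
      omega
    -- For `u ∈ K`, the forms in a complement of `a₀` send `u` into the annihilator of `K`. Both
    -- spaces have dimension four and `u` moves in a plane, so some `u` is killed by a form
    -- independent of `a₀`.
    let T : K →ₗ[k] LinearMap.ker f →ₗ[k] K.dualAnnihilator :=
      LinearMap.mk₂ k (fun u n => ⟨B n u, (Submodule.mem_dualAnnihilator _).2 fun w hw =>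
          hiso n u u.2 w hw⟩)
        (fun u₁ u₂ n => Subtype.ext (by simp)) (fun c u n => Subtype.ext (by simp))
        (fun u n₁ n₂ => Subtype.ext (by simp)) (fun c u n => Subtype.ext (by simp))
    obtain ⟨u, hu, n, hn, hun⟩ := exists_singular_member (k := k) (X := K)
      (N := LinearMap.ker f) (R := K.dualAnnihilator) hKdim.ge (by rw [hN]; omega)
      (hR.trans hN.symm).le T
    have hun' : B n u = 0 := congrArg Subtype.val hun
    refine ⟨u, fun h => hu (Subtype.ext h), ?_⟩
    have hli : LinearIndependent k ![(⟨a₀, u.2⟩ : LinearMap.ker (B.flip u)), ⟨n, hun'⟩] := by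
      refine LinearIndependent.pair_iff.2 fun s t hst => ?_
      have h1 : s • a₀ + t • (n : A) = 0 := congrArg Subtype.val hst
      have h2 := congrArg f h1
      have h3 : f n = 0 := n.2
      simp only [map_add, map_smul, h3, smul_eq_mul, mul_zero, add_zero, map_zero] at h2
      have h4 := (mul_eq_zero.1 h2).resolve_right hf
      subst h4
      refine ⟨rfl, ?_⟩
      rw [zero_smul, zero_add] at h1
      exact (smul_eq_zero.1 h1).resolve_right fun h => hn (Subtype.ext h)
    simpa using hli.fintype_card_le_finrank
  obtain ⟨l, κ, hl, hlκ, hsymm, hκ, hκ', hzκ⟩ := exists_kerPolar hB hV hker hdeg hu0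
  set N := LinearMap.ker (B.flip u) with hNdef
  let M : Submodule k V := (LinearMap.range (B.flip u)).dualCoannihilator
  have hM : ∀ x, x ∈ M ↔ ∀ z, B z u x = 0 := fun x => by
    rw [Submodule.mem_dualCoannihilator]
    simp
  let R : Submodule k V := LinearMap.ker l ⊓ M
  -- By duality `dim M = 6 - (5 - dim N) = dim N + 1`, and `u ∈ M` is not killed by `l`, so `R`
  -- loses at least one dimension.
  have hRN : Module.finrank k R ≤ Module.finrank k N := by
    have h1 : Module.finrank k R < Module.finrank k M := by
      refine Submodule.finrank_lt_finrank_of_lt (lt_of_le_of_ne inf_le_right fun h => ?_)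
      have h2 : u ∈ R := by rw [h]; exact (hM u).2 fun z => hB z u
      have h3 : l u = 0 := h2.1
      rw [hl] at h3
      exact one_ne_zero h3
    have h2 := LinearMap.finrank_range_add_finrank_ker (B.flip u)
    have h3 := Subspace.finrank_add_finrank_dualCoannihilator_eq (LinearMap.range (B.flip u))
    change Module.finrank k (LinearMap.range (B.flip u)) + Module.finrank k M = _ at h3
    change Module.finrank k (LinearMap.range (B.flip u)) + Module.finrank k N = _ at h2
    omega
  -- The target is no larger than `N` and `dim N ≥ 2`, so the bilinear map `κ` has a zero `κ a a' =
  -- 0` with both arguments nonzero.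
  let T : N →ₗ[k] N →ₗ[k] R :=
    LinearMap.mk₂ k (fun a a' => ⟨κ a a', ⟨hlκ _ _, (hM _).2 fun z => hzκ z a a' a.2 a'.2⟩⟩)
      (fun u₁ u₂ n => Subtype.ext (by simp)) (fun c u n => Subtype.ext (by simp))
      (fun u n₁ n₂ => Subtype.ext (by simp)) (fun c u n => Subtype.ext (by simp))
  obtain ⟨a, ha, a', ha', haa⟩ := exists_singular_member (k := k) hu2 (by omega) hRN T
  have haa' : κ a a' = 0 := congrArg Subtype.val haa
  have hau : B a u = 0 := a.2
  have hau' : B a' u = 0 := a'.2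
  -- By the polarized identity `κ a a` also lies in the kernel of `a'`. This kernel is a plane
  -- containing `u`, and `l` kills both `κ a a` and `κ a' a'`, so they are proportional.
  obtain ⟨c, hc⟩ := eq_add_smul_of_mem (hker a' fun h => ha' (Subtype.ext h)) l hau'
    (hκ' a a' hau hau' haa') (hκ a' hau').1 hl (hlκ _ _)
    fun h => ha (Subtype.ext ((hκ a hau).2 h))
  rw [hlκ, zero_smul, zero_add] at hc
  -- With `t ^ 2 = -c⁻¹` the two squares cancel in `κ` at `a + t • a'`. Hence `a = -t • a'`, and `κ
  -- a a = -t • κ a a' = 0` contradicts `a ≠ 0`.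
  obtain ⟨t, ht⟩ := IsAlgClosed.exists_pow_nat_eq (-c⁻¹) (n := 2) (by norm_num)
  have hc0 : c ≠ 0 := by
    rintro rfl
    rw [zero_smul] at hc
    exact ha' (Subtype.ext ((hκ a' hau').2 hc))
  have hsum : κ ((a : A) + t • (a' : A)) ((a : A) + t • (a' : A)) = 0 := by
    simp only [map_add, map_smul, LinearMap.add_apply, LinearMap.smul_apply, haa',
      hsymm (a' : A) a, hc, smul_smul, smul_zero, zero_add, add_zero]
    rw [show t * (t * c) = t ^ 2 * c by ring, ht, neg_mul, inv_mul_cancel₀ hc0]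
    module
  have hzero := (hκ _ (by simp [hau, hau'])).2 hsum
  refine ha (Subtype.ext ((hκ a hau).2 ?_))
  have h1 : (a : A) = -(t • (a' : A)) := eq_neg_of_add_eq_zero_left hzero
  conv_lhs => arg 2; rw [h1]
  rw [map_neg, map_smul, haa', smul_zero, neg_zero]

end Polar

/-! ### Bilinear functions and the dimension of the ambient space -/

section

variable {k E : Type*} [Field k] [AddCommGroup E] [Module k E]

theorem bilin_mem_polyFun {F : Type*} [AddCommGroup F] [Module k F] [FiniteDimensional k F]
    (T : E →ₗ[k] F →ₗ[k] k) : (fun z : E × F => T z.1 z.2) ∈ PolyFun k (E × F) := by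
  set b := Module.finBasis k F
  have h : ∀ z : E × F, T z.1 z.2 = ∑ i, b.repr z.2 i * T z.1 (b i) := fun z => by
    conv_lhs => rw [← b.sum_repr z.2, map_sum]
    simp only [map_smul, smul_eq_mul]
  simp only [h]
  exact sum_mem_polyFun _ fun i _ =>
    mul_mem_polyFun (dual_mem_polyFun (b.coord i ∘ₗ LinearMap.snd k E F))
      (dual_mem_polyFun (T.flip (b i) ∘ₗ LinearMap.fst k E F))

/-- View `E` as the kernel of the zero family over a single point. The fibre bound gives `d ≤ d' +
dim E`, and a point supports no independent functions. -/
theorem DimGE.le_finrank [Infinite k] [FiniteDimensional k E] {T : Set E} {d : ℕ}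
    (h : DimGE k T d) : d ≤ Module.finrank k E := by
  have h1 : DimGE k (({0} : Set (Fin 0 → k)) ×ˢ (Set.univ : Set E)) d :=
    DimGE.of_image (φ := Prod.snd) (isPolyMap_linear (LinearMap.snd k (Fin 0 → k) E))
      (h.of_subset_acl fun x _ => subset_acl _ ⟨(0, x), ⟨rfl, trivial⟩, rfl⟩)
  have h2 : AIrr k ({0} : Set (Fin 0 → k)) := ⟨⟨0, rfl⟩, fun p _ q _ hpq => by
    simpa using hpq 0 rfl⟩
  obtain ⟨d', hd, f, -, hd'⟩ := DimGE.of_kernels (k := k) (Q := k)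
    (0 : (Fin 0 → k) →ₗ[k] E →ₗ[k] k) (h2.prod_univ (K := E)) (j := Module.finrank k E)
    (fun z _ => ⟨rfl, by rw [nullity, LinearMap.zero_apply, LinearMap.ker_zero, finrank_top]⟩) h1
  have : d' = 0 := by
    by_contra hne
    have i : Fin d' := ⟨0, Nat.pos_of_ne_zero hne⟩
    have := hd' (fun y => y i - f 0 i) (sub_mem_polyFun (dual_mem_polyFun (LinearMap.proj (R := k)
      (φ := fun _ : Fin d' => k) i)) (const_mem_polyFun _)) (fun x _ => by rw [Subsingleton.elim x 0, sub_self])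
      (fun _ => f 0 i + 1)
    simp at this
  omega

end

/-! ### Equations and dimension bound for degenerate pairs -/

section Bound

variable {k V A : Type*} [Field k] [AddCommGroup V] [Module k V] [AddCommGroup A] [Module k A]
  [FiniteDimensional k V] [FiniteDimensional k A] {B : A →ₗ[k] V →ₗ[k] V →ₗ[k] k}

/-- Because `B a v v = 0`, the equation against `b 0` follows from the others wherever the first
coordinate of `v` is nonzero. This leaves `dim A` equations. -/
theorem locallyFewEquations_flip (hB : ∀ a v, B a v v = 0)
    (hVA : Module.finrank k V = Module.finrank k A + 1) : LocallyFewEquations B.flip := by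
  intro v₀ a₀ hv₀ h0
  obtain ⟨b, rfl⟩ := exists_basis_zero_eq hVA hv₀
  refine ⟨Module.finrank k A, fun j z => B z.2 z.1 (b j.succ), fun z => b.coord 0 z.1, le_rfl,
    fun j => ?_, dual_mem_polyFun (b.coord 0 ∘ₗ LinearMap.fst k V A), by simp, fun j => ?_, ?_⟩
  · exact bilin_mem_polyFun (B.flip.compr₂ (LinearMap.applyₗ (b j.succ)))
  · exact congrArg (fun l => l (b j.succ)) h0
  · rintro ⟨v, a⟩ hv h
    refine b.ext fun i => Fin.cases ?_ (fun j => h j) i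
    have h1 := hB a v
    conv_lhs at h1 => arg 2; rw [← b.sum_repr v]
    rw [map_sum, Fin.sum_univ_succ] at h1
    simp only [map_smul] at h1
    rw [Finset.sum_eq_zero (fun j _ => by rw [show B a v (b j.succ) = 0 from h j, smul_zero]),
      add_zero, smul_eq_mul] at h1
    exact (mul_eq_zero.1 h1).resolve_left hv

/-- A polynomial function that vanishes exactly at the degenerate members. -/
theorem exists_discriminant (B : A →ₗ[k] V →ₗ[k] V →ₗ[k] k) :
    ∃ D ∈ PolyFun k A, ∀ a, D a = 0 ↔ ∃ u ≠ 0, B a u = 0 := by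
  set b := Module.finBasis k V
  let M : A → Matrix (Fin (Module.finrank k V)) (Fin (Module.finrank k V)) k := fun a =>
    Matrix.of fun i j => B a (b i) (b j)
  refine ⟨fun a => (M a).det, ?_, fun a => ?_⟩
  · exact det_mem_polyFun fun i j =>
      dual_mem_polyFun (LinearMap.applyₗ (b j) ∘ₗ LinearMap.applyₗ (b i) ∘ₗ B)
  · rw [← Matrix.exists_vecMul_eq_zero_iff]
    have hvec : ∀ c : Fin (Module.finrank k V) → k, ∀ j, (Matrix.vecMul c (M a)) j =
        B a (b.equivFun.symm c) (b j) := fun c j => by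
      simp [Matrix.vecMul, dotProduct, M, Module.Basis.equivFun_symm_apply]
    constructor
    · rintro ⟨c, hc, h⟩
      refine ⟨b.equivFun.symm c, b.equivFun.symm.map_ne_zero_iff.2 hc, b.ext fun j => ?_⟩
      rw [← hvec, h]
      rfl
    · rintro ⟨u, hu, h⟩
      refine ⟨b.equivFun u, b.equivFun.map_ne_zero_iff.2 hu, funext fun j => ?_⟩
      rw [hvec, b.equivFun.symm_apply_apply, h]
      rfl

variable [IsAlgClosed k] [CharZero k]

theorem nullity_eq_two (hB : ∀ a v, B a v v = 0) (hV : Module.finrank k V = 6)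
    (hker : ∀ a ≠ 0, Module.finrank k (LinearMap.ker (B a)) ≤ 2) {a : A} (ha : a ≠ 0) {u : V}
    (hu : u ≠ 0) (h : B a u = 0) : nullity B a = 2 :=
  le_antisymm (hker a ha) (two_le_finrank_ker hB hV hu h)

/-- The pairs over `T` with nonzero form have dimension at least `d + j`. Projected to `A`, they
land in the zero set of the discriminant, which is proper by `exists_nondegenerate` and so has
dimension at most four. The fibres are kernels of dimension two, hence `d + j ≤ 6`. -/
theorem strataBound_flip (hB : ∀ a v, B a v v = 0) (hV : Module.finrank k V = 6)
    (hA : Module.finrank k A = 5) (hker : ∀ a ≠ 0, Module.finrank k (LinearMap.ker (B a)) ≤ 2) :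
    StrataBound k (nullity B.flip) := by
  have : Infinite k := IsAlgClosed.instInfinite
  intro j T hj hT hTj d hd
  obtain ⟨v₀, hv₀⟩ := id hT.1
  obtain ⟨C, hC, hCT, hCv, -, hCd⟩ := exists_kernel_family B.flip hT (fun v hv => (hTj v hv).2) hv₀
  obtain ⟨a₀, ha₀, ha₀'⟩ : ∃ a ≠ 0, B.flip v₀ a = 0 := by
    have : Nontrivial (LinearMap.ker (B.flip v₀)) := by
      have := (hTj v₀ hv₀).2
      rw [nullity] at this
      exact Module.nontrivial_of_finrank_pos (R := k) (by omega)
    obtain ⟨x, hx⟩ := exists_ne (0 : LinearMap.ker (B.flip v₀))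
    exact ⟨x, fun h => hx (Subtype.ext h), x.2⟩
  obtain ⟨f, hf⟩ := exists_dual_ne_zero (k := k) ha₀
  have hfp := dual_mem_polyFun (f ∘ₗ LinearMap.snd k V A)
  set C₁ := {z ∈ C | (f ∘ₗ LinearMap.snd k V A) z ≠ 0} with hC₁
  have h1 : C ⊆ acl k C₁ := hC.subset_acl_ne hfp (hCv a₀ ha₀') hf
  have h2 : AIrr k C₁ := hC.ne hfp (hCv a₀ ha₀') hf
  have hsw : IsPolyMap k (Prod.swap : V × A → A × V) :=
    isPolyMap_linear (LinearEquiv.prodComm k V A).toLinearMap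
  have hsw' : IsPolyMap k (Prod.swap : A × V → V × A) :=
    isPolyMap_linear (LinearEquiv.prodComm k A V).toLinearMap
  have h3 : DimGE k (Prod.swap '' C₁ : Set (A × V)) (d + j) := by
    refine DimGE.of_image hsw' (((hCd d hd).of_subset_acl h1).of_subset_acl ?_)
    exact fun x hx => subset_acl _ ⟨x.swap, ⟨x, hx, rfl⟩, Prod.swap_swap x⟩
  have hprop : ∀ z ∈ (Prod.swap '' C₁ : Set (A × V)), z.1 ≠ 0 ∧ z.2 ≠ 0 ∧ B z.1 z.2 = 0 := by
    rintro _ ⟨z, ⟨hz, hfz⟩, rfl⟩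
    refine ⟨fun h => hfz ?_, (hTj _ (hCT z hz).1).1, (hCT z hz).2⟩
    change f z.2 = 0
    rw [show z.2 = 0 from h, map_zero]
  obtain ⟨d', hd', hd''⟩ := DimGE.of_kernels B (h2.image hsw) (j := 2) (fun z hz => by
    obtain ⟨h4, h5, h6⟩ := hprop z hz
    exact ⟨h6, nullity_eq_two hB hV hker h4 h5 h6⟩) h3
  obtain ⟨D, hD, hD0⟩ := exists_discriminant B
  obtain ⟨a, ha⟩ := exists_nondegenerate hB hV hA hker
  have := (hd''.succ_of_lt aIrr_univ (fun x _ => subset_acl _ trivial) hD (by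
    rintro _ ⟨z, hz, rfl⟩
    obtain ⟨-, h5, h6⟩ := hprop z hz
    exact (hD0 _).2 ⟨_, h5, h6⟩) ⟨a, trivial, fun h => by
      obtain ⟨u, hu, hau⟩ := (hD0 a).1 h
      exact hu (ha u hau)⟩).le_finrank
  omega

end Bound

/-! ### The Pfaffian and degeneracy of a form -/

section Forms

variable {k V : Type*} [Field k] [AddCommGroup V] [Module k V]

theorem update_pair_zero (u v w : V) : Function.update ![u, v] 0 w = ![w, v] := by
  ext i; fin_cases i <;> rfl

theorem update_pair_one (u v w : V) : Function.update ![u, v] 1 w = ![u, w] := by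
  ext i; fin_cases i <;> rfl

/-- The bilinear map underlying an alternating map of two variables. -/
def altBilin {E : Type*} [AddCommGroup E] [Module k E] (ω : V [⋀^Fin 2]→ₗ[k] E) :
    V →ₗ[k] V →ₗ[k] E :=
  LinearMap.mk₂ k (fun v w => ω ![v, w])
    (fun u v w => by simpa only [update_pair_zero] using ω.map_update_add ![u, w] 0 u v)
    (fun c v w => by simpa only [update_pair_zero] using ω.map_update_smul ![v, w] 0 c v)
    (fun u v w => by simpa only [update_pair_one] using ω.map_update_add ![u, v] 1 v w)
    (fun c v w => by simpa only [update_pair_one] using ω.map_update_smul ![v, w] 1 c w)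

/-- The bilinear form underlying a skew form. -/
def skewBilin : SkewForm k V →ₗ[k] V →ₗ[k] V →ₗ[k] k where
  toFun ω := altBilin ω
  map_add' _ _ := by ext; rfl
  map_smul' _ _ := by ext; rfl

theorem skewBilin_apply (ω : SkewForm k V) (v w : V) : skewBilin ω v w = ω ![v, w] := rfl

theorem skewBilin_self (ω : SkewForm k V) (v : V) : skewBilin ω v v = 0 :=
  ω.map_eq_zero_of_eq ![v, v] (i := 0) (j := 1) rfl (by decide)

theorem skewBilin_swap (ω : SkewForm k V) (v w : V) : skewBilin ω w v = -skewBilin ω v w :=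
  swap_of_alternating skewBilin_self ω v w

theorem ker_curryLeft (ω : SkewForm k V) :
    LinearMap.ker ω.curryLeft = LinearMap.ker (skewBilin ω) := by
  ext v
  rw [LinearMap.mem_ker, LinearMap.mem_ker]
  constructor
  · intro h
    ext w
    exact congrArg (fun B => B ![w]) h
  · intro h
    ext w
    have : w = ![w 0] := by ext i; fin_cases i; rfl
    rw [this]
    exact congrArg (fun B => B (w 0)) h

theorem skewRank_add_finrank_ker [FiniteDimensional k V] (ω : SkewForm k V) :
    skewRank ω + Module.finrank k (LinearMap.ker (skewBilin ω)) = Module.finrank k V := by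
  rw [← ker_curryLeft]
  exact LinearMap.finrank_range_add_finrank_ker _

/-- The product of three values of a bilinear form. -/
def tripleProduct (B : V →ₗ[k] V →ₗ[k] k) : MultilinearMap k (fun _ : Fin 6 => V) k :=
  MultilinearMap.mk' (fun v => B (v 0) (v 1) * B (v 2) (v 3) * B (v 4) (v 5))
    (fun v i x y => by fin_cases i <;> simp [Function.update] <;> ring)
    (fun v i c x => by fin_cases i <;> simp [Function.update] <;> ring)

/-- As an alternating function of six vectors, the Pfaffian can be compared between bases by a
determinant. -/
theorem alternatization_tripleProduct (b : Module.Basis (Fin 6) k V) (ω : SkewForm k V) :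
    pfaffian b ω = (48 : k)⁻¹ * MultilinearMap.alternatization (tripleProduct (skewBilin ω)) b := by
  rw [pfaffian, MultilinearMap.alternatization_apply]
  congr 1
  refine Finset.sum_congr rfl fun σ _ => ?_
  rw [Units.smul_def, zsmul_eq_mul]
  rfl

/-- In a basis starting with the kernel vector, every term of the sum contains a factor that pairs
this vector with another. -/
theorem pfaffian_eq_zero_of_ker [FiniteDimensional k V] (hV : Module.finrank k V = 6)
    {ω : SkewForm k V} {u : V} (hu : u ≠ 0) (h : skewBilin ω u = 0)
    (b : Module.Basis (Fin 6) k V) : pfaffian b ω = 0 := by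
  obtain ⟨c, rfl⟩ := exists_basis_zero_eq (n := 5) hV hu
  have h' : ∀ x, skewBilin ω x (c 0) = 0 := fun x => by rw [skewBilin_swap, h]; simp
  rw [alternatization_tripleProduct,
    AlternatingMap.eq_smul_basis_det (e := c) (MultilinearMap.alternatization _)]
  have : MultilinearMap.alternatization (tripleProduct (skewBilin ω)) c = 0 := by
    rw [MultilinearMap.alternatization_apply]
    refine Finset.sum_eq_zero fun σ _ => ?_
    have : (MultilinearMap.domDomCongr σ (tripleProduct (skewBilin ω))) c = 0 := by
      change skewBilin ω (c (σ 0)) (c (σ 1)) * skewBilin ω (c (σ 2)) (c (σ 3)) *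
        skewBilin ω (c (σ 4)) (c (σ 5)) = 0
      have hcase : ∀ i : Fin 6, i = 0 ∨ i = 1 ∨ i = 2 ∨ i = 3 ∨ i = 4 ∨ i = 5 := by decide
      have hσ := σ.apply_symm_apply 0
      rcases hcase (σ.symm 0) with hi | hi | hi | hi | hi | hi <;> rw [hi] at hσ <;>
        simp [hσ, h, h']
    rw [this, smul_zero]
  rw [this]
  simp

/-- A nondegenerate alternating form admits hyperbolic systems up to the maximal size. -/
theorem exists_hyperbolic [FiniteDimensional k V] {B : V →ₗ[k] V →ₗ[k] k} (hB : ∀ v, B v v = 0)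
    (hnd : ∀ u, B u = 0 → u = 0) (n : ℕ) (hn : 2 * n ≤ Module.finrank k V) :
    ∃ x y : Fin n → V, (∀ i j, B (x i) (x j) = 0) ∧ (∀ i j, B (y i) (y j) = 0) ∧
      ∀ i j, B (x i) (y j) = if i = j then 1 else 0 := by
  have hs : ∀ v w, B w v = -B v w := fun v w => by
    have h := hB (v + w)
    simp only [map_add, LinearMap.add_apply] at h
    rw [hB, hB] at h
    linear_combination h
  induction n with
  | zero => exact ⟨Fin.elim0, Fin.elim0, fun i => i.elim0, fun i => i.elim0, fun i => i.elim0⟩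
  | succ n ih =>
    obtain ⟨x, y, hx, hy, hxy⟩ := ih (by omega)
    have hyx : ∀ i j, B (y i) (x j) = if i = j then -1 else 0 := fun i j => by
      rw [hs, hxy]
      by_cases h : i = j
      · simp [h]
      · simp [h, Ne.symm h]
    let L : V →ₗ[k] (Fin n → k) × (Fin n → k) :=
      (LinearMap.pi fun i => B (x i)).prod (LinearMap.pi fun i => B (y i))
    have hL : LinearMap.ker L ≠ ⊥ := LinearMap.ker_ne_bot_of_finrank_lt (by
      rw [Module.finrank_prod, Module.finrank_fin_fun]; omega)
    obtain ⟨u, huL, hu0⟩ := (Submodule.ne_bot_iff _).1 hL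
    have hux : ∀ i, B (x i) u = 0 := fun i => congrFun (congrArg Prod.fst huL) i
    have huy : ∀ i, B (y i) u = 0 := fun i => congrFun (congrArg Prod.snd huL) i
    have hux' : ∀ i, B u (x i) = 0 := fun i => by rw [hs, hux, neg_zero]
    have huy' : ∀ i, B u (y i) = 0 := fun i => by rw [hs, huy, neg_zero]
    obtain ⟨w, hw⟩ : ∃ w, B u w ≠ 0 := by
      by_contra! h
      exact hu0 (hnd u (LinearMap.ext h))
    -- From `w` one removes its components along the hyperbolic pairs already found, then normalizes
    -- against `u`, which is orthogonal to those pairs.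
    let w' := (B u w)⁻¹ • (w + ∑ j, B (y j) w • x j - ∑ j, B (x j) w • y j)
    have hw1 : B u w' = 1 := by
      simp [w', hux', huy', hw]
    have hw2 : ∀ i, B (x i) w' = 0 := fun i => by
      simp [w', hx, hxy]
    have hw3 : ∀ i, B (y i) w' = 0 := fun i => by
      simp [w', hy, hyx]
    have hw2' : ∀ i, B w' (x i) = 0 := fun i => by rw [hs, hw2, neg_zero]
    have hw3' : ∀ i, B w' (y i) = 0 := fun i => by rw [hs, hw3, neg_zero]
    refine ⟨Fin.cons u x, Fin.cons w' y, fun i j => ?_, fun i j => ?_, fun i j => ?_⟩ <;>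
      refine Fin.cases ?_ (fun i => ?_) i <;> refine Fin.cases ?_ (fun j => ?_) j <;>
      simp [hB, hx, hy, hxy, hux, hux', huy', hw1, hw2, hw3, hw3', Fin.succ_ne_zero,
        (Fin.succ_ne_zero _).symm]

/-- The Gram matrix of a symplectic basis. -/
def symplecticGram (i j : Fin 6) : ℤ :=
  if i.val / 2 = j.val / 2 then (j.val : ℤ) - i.val else 0

/-- For a permutation compatible with the blocks `{0,1}`, `{2,3}`, `{4,5}`, its sign agrees with the
sign of the product of Gram entries, so nothing cancels. This is a finite check. -/
theorem sign_mul_symplecticGram : ∀ σ : Equiv.Perm (Fin 6), (σ 0).val / 2 = (σ 1).val / 2 →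
    (σ 2).val / 2 = (σ 3).val / 2 → (σ 4).val / 2 = (σ 5).val / 2 →
    (Equiv.Perm.sign σ : ℤ) * (symplecticGram (σ 0) (σ 1) * symplecticGram (σ 2) (σ 3) *
      symplecticGram (σ 4) (σ 5)) = 1 := by
  decide +kernel

/-- Permutations that break a block contribute zero and the others one, so the terms are nonnegative
with a positive one at the identity. -/
theorem sum_symplecticGram_ne_zero : ∑ σ : Equiv.Perm (Fin 6), (Equiv.Perm.sign σ : ℤ) *
    (symplecticGram (σ 0) (σ 1) * symplecticGram (σ 2) (σ 3) * symplecticGram (σ 4) (σ 5)) ≠ 0 := by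
  refine (Finset.sum_pos' (fun σ _ => ?_) ⟨1, Finset.mem_univ _, ?_⟩).ne'
  · by_cases h : (σ 0).val / 2 = (σ 1).val / 2 ∧ (σ 2).val / 2 = (σ 3).val / 2 ∧
        (σ 4).val / 2 = (σ 5).val / 2
    · rw [sign_mul_symplecticGram σ h.1 h.2.1 h.2.2]
      norm_num
    · by_contra h0
      simp only [symplecticGram] at h0
      split_ifs at h0 <;> simp_all
  · rw [sign_mul_symplecticGram 1 rfl rfl rfl]
    norm_num

/-- In a symplectic basis the Pfaffian is a nonzero integer divided by `48`, and characteristic zero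
keeps it nonzero. -/
theorem exists_pfaffian_ne_zero [CharZero k] [FiniteDimensional k V]
    (hV : Module.finrank k V = 6) {ω : SkewForm k V} (hω : ∀ u, skewBilin ω u = 0 → u = 0) :
    ∃ b : Module.Basis (Fin 6) k V, pfaffian b ω ≠ 0 := by
  obtain ⟨x, y, hx, hy, hxy⟩ := exists_hyperbolic (skewBilin_self ω) hω 3 (by omega)
  let e : Fin 6 → V := ![x 0, y 0, x 1, y 1, x 2, y 2]
  have hgram : ∀ i j, skewBilin ω (e i) (e j) = (symplecticGram i j : k) := by
    intro i j
    have hyx : ∀ i j, skewBilin ω (y i) (x j) = if i = j then -1 else 0 := fun i j => by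
      rw [skewBilin_swap, hxy]
      by_cases h : i = j
      · simp [h]
      · simp [h, Ne.symm h]
    fin_cases i <;> fin_cases j <;> simp [e, symplecticGram, hx, hy, hxy, hyx]
  have hli : LinearIndependent k e := by
    refine Fintype.linearIndependent_iff.2 fun c hc => ?_
    have h : ∀ i, ∑ j, c j * (symplecticGram i j : k) = 0 := fun i => by
      have := congrArg (skewBilin ω (e i)) hc
      rw [map_sum, map_zero] at this
      simpa only [map_smul, smul_eq_mul, hgram] using this
    intro i
    simp only [Fin.sum_univ_six, symplecticGram] at h
    fin_cases i
    · simpa using h 1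
    · simpa using h 0
    · simpa using h 3
    · simpa using h 2
    · simpa using h 5
    · simpa using h 4
  refine ⟨basisOfLinearIndependentOfCardEqFinrank hli (by simp [hV]), ?_⟩
  rw [pfaffian, coe_basisOfLinearIndependentOfCardEqFinrank]
  refine mul_ne_zero (inv_ne_zero (by norm_num)) ?_
  have h := sum_symplecticGram_ne_zero
  rw [← Int.cast_ne_zero (α := k)] at h
  simp only [Int.cast_sum, Int.cast_mul, ← hgram] at h
  exact h

theorem pfaffian_eq_zero_iff [CharZero k] [FiniteDimensional k V]
    (hV : Module.finrank k V = 6) (ω : SkewForm k V) :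
    (∀ b : Module.Basis (Fin 6) k V, pfaffian b ω = 0) ↔ ∃ u ≠ 0, skewBilin ω u = 0 := by
  constructor
  · intro h
    by_contra! hc
    obtain ⟨b, hb⟩ := exists_pfaffian_ne_zero hV fun u hu => by
      by_contra h0
      exact hc u h0 hu
    exact hb (h b)
  · rintro ⟨u, hu, h⟩ b
    exact pfaffian_eq_zero_of_ker hV hu h b

end Forms

/-! ### Bivectors, contraction and incidence -/

section Wedge

variable {k V : Type*} [Field k] [AddCommGroup V] [Module k V]

/-- The product `v ∧ w`. -/
def wedge : V →ₗ[k] V →ₗ[k] ⋀[k]^2 V := altBilin (exteriorPower.ιMulti k 2)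

theorem wedge_apply (v w : V) : wedge v w = exteriorPower.ιMulti k 2 ![v, w] := rfl

theorem wedge_self (v : V) : wedge (k := k) v v = 0 :=
  (exteriorPower.ιMulti k 2).map_eq_zero_of_eq ![v, v] (i := 0) (j := 1) rfl (by decide)

theorem wedge_swap (v w : V) : wedge (k := k) w v = -wedge v w := by
  have h := wedge_self (k := k) (v + w)
  simp only [map_add, LinearMap.add_apply, wedge_self, zero_add, add_zero] at h
  exact eq_neg_of_add_eq_zero_left h

theorem linearMap_ext_wedge {E : Type*} [AddCommGroup E] [Module k E] {S T : ⋀[k]^2 V →ₗ[k] E}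
    (h : ∀ v w, S (wedge v w) = T (wedge v w)) : S = T := by
  apply exteriorPower.linearMap_ext
  ext v
  have hv : v = ![v 0, v 1] := by ext i; fin_cases i <;> rfl
  rw [hv]
  exact h _ _

variable (k V) in
/-- The contraction `(u ∧ w, l) ↦ l(u) w - l(w) u`. -/
def contraction : ⋀[k]^2 V →ₗ[k] Module.Dual k V →ₗ[k] V :=
  exteriorPower.alternatingMapLinearEquiv
    { MultilinearMap.mk' (fun v : Fin 2 → V => (LinearMap.applyₗ (v 0)).smulRight (v 1) -
        (LinearMap.applyₗ (v 1)).smulRight (v 0) : (Fin 2 → V) → Module.Dual k V →ₗ[k] V)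
        (fun v i x y => by
          ext l
          fin_cases i <;> simp [Function.update] <;> module)
        (fun v i c x => by
          ext l
          fin_cases i <;> simp [Function.update] <;> module) with
      map_eq_zero_of_eq' := fun v i j h hij => by
        have : v 0 = v 1 := by
          fin_cases i <;> fin_cases j <;> first | exact absurd rfl hij | exact h | exact h.symm
        change (LinearMap.applyₗ (v 0)).smulRight (v 1) -
          (LinearMap.applyₗ (v 1)).smulRight (v 0) = _
        rw [this, sub_self] }

theorem contraction_wedge (u w : V) (l : Module.Dual k V) :
    contraction k V (wedge u w) l = l u • w - l w • u := by
  rw [contraction, wedge_apply, exteriorPower.alternatingMapLinearEquiv_apply_ιMulti]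
  rfl

/-- Wedging basis vectors with the contractions by the dual basis and summing gives twice the
identity, first on `u ∧ w` and then everywhere. -/
theorem contraction_injective [CharZero k] [FiniteDimensional k V] :
    Function.Injective (contraction k V) := by
  refine (injective_iff_map_eq_zero _).2 fun x hx => ?_
  set b := Module.finBasis k V
  have h : ∑ i, (wedge (b i)) ∘ₗ (LinearMap.applyₗ (b.coord i)) ∘ₗ contraction k V =
      (2 : k) • LinearMap.id := linearMap_ext_wedge fun u w => by
    simp only [LinearMap.sum_apply, LinearMap.comp_apply, LinearMap.applyₗ_apply_apply,
      contraction_wedge, map_sub, map_smul, Finset.sum_sub_distrib]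
    have h1 : ∀ u w : V, ∑ i, b.coord i u • wedge (k := k) (b i) w = wedge u w := fun u w => by
      conv_rhs => rw [← b.sum_repr u, map_sum, LinearMap.sum_apply]
      simp only [map_smul, LinearMap.smul_apply, Module.Basis.coord_apply]
    rw [h1, h1, wedge_swap u w]
    simp only [LinearMap.smul_apply, LinearMap.id_apply]
    module
  have h2 := congrArg (fun T => T x) h
  simp only [LinearMap.sum_apply, LinearMap.comp_apply, hx, map_zero, Finset.sum_const_zero, LinearMap.smul_apply,
    LinearMap.id_apply] at h2
  exact (smul_eq_zero.1 h2.symm).resolve_left two_ne_zero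

theorem contraction_skew (x : ⋀[k]^2 V) (l l' : Module.Dual k V) :
    l' (contraction k V x l) = -l (contraction k V x l') := by
  have h : l' ∘ₗ (LinearMap.applyₗ l) ∘ₗ contraction k V =
      -(l ∘ₗ (LinearMap.applyₗ l') ∘ₗ contraction k V) := linearMap_ext_wedge fun u w => by
    simp only [LinearMap.comp_apply, LinearMap.applyₗ_apply_apply, LinearMap.neg_apply,
      contraction_wedge, map_sub, map_smul, smul_eq_mul]
    ring
  exact congrArg (fun T => T x) h

variable (k V) in
/-- The linear family of maps whose vanishing means that `v ∧ x = 0`. -/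
def incidence : V →ₗ[k] ⋀[k]^2 V →ₗ[k] Module.Dual k V →ₗ[k] Module.Dual k V →ₗ[k] V :=
  LinearMap.mk₂ k (fun v x => LinearMap.mk₂ k (fun l l' => l v • contraction k V x l' -
      l' v • contraction k V x l + l' (contraction k V x l) • v)
      (fun _ _ _ => by simp only [map_add, LinearMap.add_apply]; module)
      (fun _ _ _ => by simp only [map_smul, LinearMap.smul_apply, smul_eq_mul]; module)
      (fun _ _ _ => by simp only [map_add, LinearMap.add_apply]; module)
      (fun _ _ _ => by simp only [map_smul, LinearMap.smul_apply, smul_eq_mul]; module))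
    (fun _ _ _ => by ext; simp only [map_add, LinearMap.add_apply, LinearMap.mk₂_apply]; module)
    (fun _ _ _ => by
      ext; simp only [map_smul, LinearMap.smul_apply, LinearMap.mk₂_apply, smul_eq_mul]; module)
    (fun _ _ _ => by ext; simp only [map_add, LinearMap.add_apply, LinearMap.mk₂_apply]; module)
    (fun _ _ _ => by
      ext; simp only [map_smul, LinearMap.smul_apply, LinearMap.mk₂_apply, smul_eq_mul]; module)

/-- The right-hand side is the contraction of the trivector `v ∧ x` by `l` and then by `l'`;
incidence is thus expressed without leaving `⋀²V`. -/
theorem incidence_apply (v : V) (x : ⋀[k]^2 V) (l l' : Module.Dual k V) :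
    incidence k V v x l l' = l v • contraction k V x l' - l' v • contraction k V x l +
      l' (contraction k V x l) • v := rfl

theorem incidence_wedge (v w : V) : incidence k V v (wedge v w) = 0 := by
  ext l l'
  simp only [incidence_apply, contraction_wedge, map_sub, map_smul, LinearMap.zero_apply,
    smul_eq_mul]
  module

theorem incidence_wedge_right (v w : V) : incidence k V w (wedge v w) = 0 := by
  rw [wedge_swap w v, map_neg, incidence_wedge, neg_zero]

/-- The candidate for `w` is the contraction of `x` by `l`, divided by `l v`; the equations say that
`x` and `v ∧ w` have the same contractions. Only one functional `l` is needed, which keeps the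
number of equations small. -/
theorem exists_of_incidence_eq_zero [CharZero k] [FiniteDimensional k V] {v : V}
    {l : Module.Dual k V} (hl : l v ≠ 0) {x : ⋀[k]^2 V} (h : incidence k V v x l = 0) :
    ∃ w, x = wedge v w := by
  refine ⟨(l v)⁻¹ • contraction k V x l, contraction_injective ?_⟩
  ext l'
  have h1 : incidence k V v x l l' = 0 := by rw [h]; rfl
  rw [incidence_apply] at h1
  rw [map_smul, map_smul, LinearMap.smul_apply, contraction_wedge]
  have h2 : contraction k V x l' = (l v)⁻¹ • (l v • contraction k V x l') := by
    rw [smul_smul, inv_mul_cancel₀ hl, one_smul]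
  rw [h2]
  congr 1
  linear_combination (norm := module) h1

theorem incidence_eq_zero_iff [CharZero k] [FiniteDimensional k V] {v : V} (hv : v ≠ 0)
    (x : ⋀[k]^2 V) : incidence k V v x = 0 ↔ ∃ w, x = wedge v w := by
  constructor
  · intro h
    obtain ⟨l, hl⟩ := exists_dual_ne_zero (k := k) hv
    exact exists_of_incidence_eq_zero hl (by rw [h]; rfl)
  · rintro ⟨w, rfl⟩
    exact incidence_wedge v w

theorem exists_dual_of_linearIndependent {n : ℕ} {v : Fin n → V} (hv : LinearIndependent k v)
    (i : Fin n) : ∃ l : Module.Dual k V, ∀ j, l (v j) = if j = i then 1 else 0 := by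
  obtain ⟨g, hg⟩ := (Fintype.linearCombination k v).exists_leftInverse_of_injective
    (LinearMap.ker_eq_bot.2 hv.fintypeLinearCombination_injective)
  refine ⟨LinearMap.proj i ∘ₗ g, fun j => ?_⟩
  have h := congrArg (fun T => T (Pi.single j 1) i) hg
  simp only [LinearMap.comp_apply, Fintype.linearCombination_apply_single, one_smul,
    LinearMap.id_apply, Pi.single_apply] at h
  simpa [eq_comm] using h

/-- The vectors incident with a nonzero decomposable bivector form a plane. -/
theorem finrank_ker_incidence_flip {u w : V} (h : wedge (k := k) u w ≠ 0) :
    Module.finrank k (LinearMap.ker ((incidence k V).flip (wedge u w))) = 2 := by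
  have hli : LinearIndependent k ![u, w] := by
    refine LinearIndependent.pair_iff.2 fun s t hst => ?_
    have h1 := congrArg (fun v => wedge (k := k) v w) hst
    have h2 := congrArg (fun v => wedge (k := k) u v) hst
    simp only [map_add, map_smul, LinearMap.add_apply, LinearMap.smul_apply, wedge_self, smul_zero,
      add_zero, zero_add, map_zero, LinearMap.zero_apply] at h1 h2
    exact ⟨(smul_eq_zero.1 h1).resolve_right h, (smul_eq_zero.1 h2).resolve_right h⟩
  have hspan : LinearMap.ker ((incidence k V).flip (wedge u w)) =
      Submodule.span k (Set.range ![u, w]) := by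
    apply le_antisymm
    · intro v hv
      obtain ⟨l, hl⟩ : ∃ l : Module.Dual k V, l u = 1 ∧ l w = 0 := by
        obtain ⟨l, hl⟩ := exists_dual_of_linearIndependent hli 0
        exact ⟨l, by simpa using hl 0, by simpa using hl 1⟩
      obtain ⟨l', hl'⟩ : ∃ l' : Module.Dual k V, l' u = 0 ∧ l' w = 1 := by
        obtain ⟨l, hl⟩ := exists_dual_of_linearIndependent hli 1
        exact ⟨l, by simpa using hl 0, by simpa using hl 1⟩
      -- Testing against functionals dual to `u` and `w` writes `v` as a combination of these two
      -- vectors.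
      have h1 : incidence k V v (wedge u w) l l' = 0 := by
        rw [show incidence k V v (wedge u w) = 0 from hv]; rfl
      rw [incidence_apply, contraction_wedge, contraction_wedge, hl.1, hl.2, hl'.1, hl'.2] at h1
      simp only [zero_smul, one_smul, sub_zero, zero_sub, hl'.2] at h1
      rw [Matrix.range_cons, Matrix.range_cons, Matrix.range_empty, Set.union_empty,
        Set.singleton_union, Submodule.mem_span_pair]
      exact ⟨l v, l' v, by linear_combination (norm := module) -h1⟩
    · rw [Submodule.span_le]
      rintro _ ⟨i, rfl⟩
      fin_cases i
      · exact incidence_wedge u w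
      · exact incidence_wedge_right u w
  rw [hspan, finrank_span_eq_card hli, Fintype.card_fin]

end Wedge

/-! ### Invariance of strata -/

section Strata

variable {k V : Type*} [Field k] [AddCommGroup V] [Module k V]

theorem stratum_congr {n n' : V → ℕ} (h : ∀ v ≠ 0, n v = n' v) (j : ℕ) :
    stratum k n j = stratum k n' j := by
  have key : ∀ {n n' : V → ℕ}, (∀ v ≠ 0, n v = n' v) → stratum k n j ⊆ stratum k n' j := by
    rintro n n' h v ⟨T, hv, hT, hTj, hd⟩
    exact ⟨T, hv, hT, fun u hu => ⟨(hTj u hu).1, (h u (hTj u hu).1).symm.trans (hTj u hu).2⟩, hd⟩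
  exact (key h).antisymm (key fun v hv => (h v hv).symm)

theorem StrataBound.congr {n n' : V → ℕ} (hn : StrataBound k n) (h : ∀ v ≠ 0, n v = n' v) :
    StrataBound k n' := fun j T hj hT hTj d hd =>
  hn j T hj hT (fun u hu => ⟨(hTj u hu).1, (h u (hTj u hu).1).trans (hTj u hu).2⟩) d hd

theorem map_mem_stratum {n : V → ℕ} (e : V ≃ₗ[k] V) (he : ∀ v, n (e v) = n v) {j : ℕ} {v : V}
    (hv : v ∈ stratum k n j) : e v ∈ stratum k n j := by
  obtain ⟨T, hvT, hT, hTj, d, hd, hTd⟩ := hv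
  refine ⟨e '' T, ⟨v, hvT, rfl⟩, hT.image (isPolyMap_linear e.toLinearMap), ?_, d, hd, ?_⟩
  · rintro _ ⟨u, hu, rfl⟩
    exact ⟨e.map_ne_zero_iff.2 (hTj u hu).1, (he u).trans (hTj u hu).2⟩
  · refine DimGE.of_image (isPolyMap_linear e.symm.toLinearMap) (hTd.of_subset_acl ?_)
    exact fun x hx => subset_acl _ ⟨e x, ⟨x, hx, rfl⟩, e.symm_apply_apply x⟩

end Strata

/-! ### The annihilator of the net and its incidence family -/

section Net

variable {k V A : Type*} [Field k] [AddCommGroup V] [Module k V] [AddCommGroup A] [Module k A]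
  (f : A →ₗ[k] SkewForm k V)

/-- The family of bilinear forms of a net of skew forms. -/
def netBilin : A →ₗ[k] V →ₗ[k] V →ₗ[k] k := skewBilin ∘ₗ f

theorem netBilin_self (a : A) (v : V) : netBilin f a v v = 0 := skewBilin_self _ v

theorem mem_perp {x : ⋀[k]^2 V} : x ∈ perp f ↔
    ∀ a, exteriorPower.alternatingMapLinearEquiv (f a) x = 0 := by
  rw [perp, Submodule.mem_iInf]
  rfl

theorem wedge_mem_perp {v w : V} : wedge v w ∈ perp f ↔ ∀ a, netBilin f a v w = 0 := by
  rw [mem_perp]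
  simp only [wedge_apply, exteriorPower.alternatingMapLinearEquiv_apply_ιMulti]
  rfl

variable (k V) in
/-- The target of the maps that express incidence. -/
abbrev IncidenceSpace : Type _ := Module.Dual k V →ₗ[k] Module.Dual k V →ₗ[k] V

/-- The family of linear maps whose kernels consist of the elements of `f(A)^⊥` incident with a
given vector. -/
def perpFamily : V →ₗ[k] perp f →ₗ[k] IncidenceSpace k V :=
  (incidence k V).compl₂ (perp f).subtype

variable [FiniteDimensional k V] [FiniteDimensional k A]

theorem wedge_eq_zero_iff {v : V} (hv : v ≠ 0) (w : V) :
    wedge (k := k) v w = 0 ↔ ∃ c : k, w = c • v := by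
  constructor
  · intro h
    obtain ⟨l, hl⟩ := exists_dual_ne_zero (k := k) hv
    have h1 := contraction_wedge v w l
    rw [h, map_zero, LinearMap.zero_apply] at h1
    refine ⟨(l v)⁻¹ * l w, ?_⟩
    rw [mul_smul, eq_inv_smul_iff₀ hl]
    exact (sub_eq_zero.1 h1.symm)
  · rintro ⟨c, rfl⟩
    rw [map_smul, wedge_self, smul_zero]

/-- A square matrix and its transpose have kernels of the same dimension. The vectors `w` with
`f(a)(v, w) = 0` for all `a` form a space of dimension `dim V - rank`, and wedging with `v` kills
exactly the line of `v`. Since `dim V = dim A + 1`, this leaves `dim A - rank`. -/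
theorem nullity_perpFamily [CharZero k] (hVA : Module.finrank k V = Module.finrank k A + 1) {v : V}
    (hv : v ≠ 0) : nullity (P := perp f) (Q := IncidenceSpace k V) (perpFamily f) v = nullity (netBilin f).flip v := by
  let M : Submodule k V := (LinearMap.range ((netBilin f).flip v)).dualCoannihilator
  have hM : ∀ w, w ∈ M ↔ ∀ a, netBilin f a v w = 0 := fun w => by
    rw [Submodule.mem_dualCoannihilator]
    simp
  have h1 : Module.finrank k (LinearMap.range ((netBilin f).flip v)) + Module.finrank k M =
      Module.finrank k V := Subspace.finrank_add_finrank_dualCoannihilator_eq _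
  have h2 : Module.finrank k (LinearMap.range ((netBilin f).flip v)) +
      nullity (netBilin f).flip v = Module.finrank k A :=
    LinearMap.finrank_range_add_finrank_ker _
  let L : M →ₗ[k] ⋀[k]^2 V := wedge v ∘ₗ M.subtype
  have h3 : Module.finrank k (LinearMap.range L) + Module.finrank k (LinearMap.ker L) =
      Module.finrank k M := LinearMap.finrank_range_add_finrank_ker _
  have hvM : v ∈ M := (hM v).2 fun a => netBilin_self f a v
  have h4 : Module.finrank k (LinearMap.ker L) = 1 := by
    have : LinearMap.ker L = Submodule.span k {⟨v, hvM⟩} := by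
      ext w
      rw [LinearMap.mem_ker, Submodule.mem_span_singleton]
      change wedge v (w : V) = 0 ↔ _
      rw [wedge_eq_zero_iff hv]
      exact ⟨fun ⟨c, hc⟩ => ⟨c, Subtype.ext hc.symm⟩,
        fun ⟨c, hc⟩ => ⟨c, (congrArg Subtype.val hc).symm⟩⟩
    rw [this, finrank_span_singleton]
    exact fun h => hv (congrArg Subtype.val h)
  have h5 : LinearMap.range L = (LinearMap.ker (perpFamily f v)).map (perp f).subtype := by
    ext x
    rw [LinearMap.mem_range, Submodule.mem_map]
    constructor
    · rintro ⟨w, rfl⟩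
      exact ⟨⟨wedge v w, (wedge_mem_perp f).2 ((hM w).1 w.2)⟩, incidence_wedge v _, rfl⟩
    · rintro ⟨y, hy, rfl⟩
      obtain ⟨w, hw⟩ := (incidence_eq_zero_iff hv (y : ⋀[k]^2 V)).1 hy
      exact ⟨⟨w, (hM w).2 ((wedge_mem_perp f).1 (hw ▸ y.2))⟩, hw.symm⟩
  have h6 : Module.finrank k (LinearMap.range L) = nullity (P := perp f) (Q := IncidenceSpace k V) (perpFamily f) v := by
    rw [h5]
    exact Submodule.finrank_map_subtype_eq _ _
  omega

/-- Five linear conditions on the fifteen-dimensional space of bivectors. -/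
theorem le_finrank_perp (hV : Module.finrank k V = 6) (hA : Module.finrank k A = 5) :
    10 ≤ Module.finrank k (perp f) := by
  let T : ⋀[k]^2 V →ₗ[k] Module.Dual k A :=
    (exteriorPower.alternatingMapLinearEquiv.toLinearMap ∘ₗ f).flip
  have hT : perp f = LinearMap.ker T := by
    ext x
    rw [mem_perp, LinearMap.mem_ker, LinearMap.ext_iff]
    rfl
  have h1 := LinearMap.finrank_range_add_finrank_ker T
  have h2 := Submodule.finrank_le (LinearMap.range T)
  rw [Subspace.dual_finrank_eq, hA] at h2
  rw [exteriorPower.finrank_eq, hV, show Nat.choose 6 2 = 15 from rfl] at h1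
  rw [hT]
  omega

/-- The skew-symmetric form on functionals whose vanishing expresses incidence. -/
theorem incidence_skew (v : V) (x : ⋀[k]^2 V) (l₀ l l' : Module.Dual k V) :
    l' (incidence k V v x l₀ l) = -l (incidence k V v x l₀ l') := by
  simp only [incidence_apply, map_add, map_sub, map_smul, smul_eq_mul]
  rw [contraction_skew x l l', contraction_skew x l₀ l, contraction_skew x l₀ l']
  ring

theorem incidence_self (v : V) (x : ⋀[k]^2 V) (l₀ l : Module.Dual k V) [CharZero k] :
    l₀ (incidence k V v x l₀ l) = 0 := by
  have h0 := contraction_skew x l₀ l₀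
  have h1 : l₀ (contraction k V x l₀) = 0 := self_eq_neg.1 h0
  simp only [incidence_apply, map_add, map_sub, map_smul, smul_eq_mul, h1]
  rw [contraction_skew x l₀ l]
  ring

/-- With the first functional fixed as `b.coord 0`, incidence becomes an alternating form on
functionals whose radical contains `b.coord 0`. It is determined by the pairs `i < j` of remaining
coordinates. -/
theorem incidence_coord_eq_zero [CharZero k] {n : ℕ} (b : Module.Basis (Fin (n + 1)) k V) {v : V}
    {x : ⋀[k]^2 V} (h : ∀ i j : Fin n, i < j →
      b.coord j.succ (incidence k V v x (b.coord 0) (b.coord i.succ)) = 0) :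
    incidence k V v x (b.coord 0) = 0 := by
  have hall : ∀ i j, b.coord j (incidence k V v x (b.coord 0) (b.coord i)) = 0 := by
    intro i j
    refine Fin.cases (incidence_self v x _ _) (fun j => ?_) j
    refine Fin.cases ?_ (fun i => ?_) i
    · rw [incidence_skew, incidence_self, neg_zero]
    · rcases lt_trichotomy i j with hij | rfl | hij
      · exact h i j hij
      · exact self_eq_neg.1 (incidence_skew v x _ _ _)
      · rw [incidence_skew, h j i hij, neg_zero]
  refine b.dualBasis.ext fun i => b.ext_elem fun j => ?_
  rw [Module.Basis.coe_dualBasis, LinearMap.zero_apply, map_zero]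
  exact hall i j

theorem incidence_mem_polyFun (U : Submodule k (⋀[k]^2 V)) (l₀ l l' : Module.Dual k V) :
    (fun z : V × U => l' (incidence k V z.1 z.2 l₀ l)) ∈ PolyFun k (V × U) :=
  bilin_mem_polyFun (LinearMap.mk₂ k (fun v (x : U) => l' (incidence k V v x l₀ l))
    (fun _ _ _ => by simp only [map_add, LinearMap.add_apply])
    (fun _ _ _ => by simp only [map_smul, LinearMap.smul_apply])
    (fun _ _ _ => by simp only [Submodule.coe_add, map_add, LinearMap.add_apply])
    (fun _ _ _ => by simp only [Submodule.coe_smul, map_smul, LinearMap.smul_apply]))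

theorem dual_fst_mem_polyFun {F : Type*} [AddCommGroup F] [Module k F] (l : Module.Dual k V) :
    (fun z : V × F => l z.1) ∈ PolyFun k (V × F) :=
  dual_mem_polyFun (l ∘ₗ LinearMap.fst k V F)

/-- Where the first coordinate of `v` is nonzero, the ten entries above the diagonal of a skew form
in five variables already express `v ∧ x = 0`, and the annihilator has dimension at least ten. -/
theorem locallyFewEquations_perpFamily [CharZero k] (hV : Module.finrank k V = 6)
    (hA : Module.finrank k A = 5) :
    LocallyFewEquations (P := perp f) (Q := IncidenceSpace k V) (perpFamily f) := by
  intro v₀ x₀ hv₀ h0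
  obtain ⟨b, rfl⟩ := exists_basis_zero_eq (n := 5) hV hv₀
  have hI : Fintype.card {p : Fin 5 × Fin 5 // p.1 < p.2} = 10 := by decide
  let e := (Fintype.equivFinOfCardEq hI).symm
  refine ⟨10, fun i z => b.coord (e i).1.2.succ (incidence k V z.1 z.2 (b.coord 0)
    (b.coord (e i).1.1.succ)), fun z => b.coord 0 z.1, le_finrank_perp f hV hA, fun i =>
    incidence_mem_polyFun (perp f) _ _ _,
    dual_fst_mem_polyFun (b.coord 0), ?_, fun i => ?_, ?_⟩
  · dsimp only
    rw [Module.Basis.coord_apply, Module.Basis.repr_self, Finsupp.single_eq_same]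
    exact one_ne_zero
  · replace h0 : incidence k V (b 0) x₀ = 0 := h0
    dsimp only
    rw [h0, LinearMap.zero_apply, LinearMap.zero_apply, map_zero]
  · rintro ⟨v, x⟩ hv h
    have hz := incidence_coord_eq_zero b (v := v) (x := x) fun i j hij => by
      have := h (e.symm ⟨(i, j), hij⟩)
      dsimp only at this
      rwa [e.apply_symm_apply] at this
    obtain ⟨w, hw⟩ := exists_of_incidence_eq_zero hv hz
    change incidence k V v x = 0
    rw [hw, incidence_wedge]

end Net

/-! ### Projectivized kernel bundles and their strata -/

section Flags

variable {k V P Q F : Type*} [Field k] [AddCommGroup V] [Module k V] [AddCommGroup P] [Module k P]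
  [AddCommGroup Q] [Module k Q] [AddCommGroup F] [Module k F]

theorem nullity_smul (Φ : V →ₗ[k] P →ₗ[k] Q) {c : k} (hc : c ≠ 0) (v : V) :
    nullity Φ (c • v) = nullity Φ v := by
  have h : LinearMap.ker (Φ (c • v)) = LinearMap.ker (Φ v) := by
    ext p
    rw [LinearMap.mem_ker, LinearMap.mem_ker, map_smul, LinearMap.smul_apply, smul_eq_zero,
      or_iff_right hc]
  rw [nullity, nullity, h]

theorem smul_mem_stratum_iff (Φ : V →ₗ[k] P →ₗ[k] Q) {c : k} (hc : c ≠ 0) {j : ℕ} {v : V} :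
    c • v ∈ stratum k (nullity Φ) j ↔ v ∈ stratum k (nullity Φ) j := by
  have key : ∀ {c : k} (_ : c ≠ 0) {v : V}, v ∈ stratum k (nullity Φ) j →
      c • v ∈ stratum k (nullity Φ) j := fun hc _ hv =>
    map_mem_stratum (LinearEquiv.smulOfNeZero k V _ hc) (nullity_smul Φ hc) hv
  refine ⟨fun h => ?_, key hc⟩
  have := key (inv_ne_zero hc) h
  rwa [smul_smul, inv_mul_cancel₀ hc, one_smul] at this

/-- The points of the projective space that lie in a stratum. -/
def projStratum (Φ : V →ₗ[k] P →ₗ[k] Q) (j : ℕ) : Set (ℙ k V) :=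
  {m | m.rep ∈ stratum k (nullity Φ) j}

theorem mem_projStratum_iff (Φ : V →ₗ[k] P →ₗ[k] Q) {j : ℕ} {m : ℙ k V} {v : V}
    (hv : HomCoords.IsCoord k v m) : m ∈ projStratum Φ j ↔ v ∈ stratum k (nullity Φ) j := by
  obtain ⟨c, hc, rfl⟩ := isCoord_eq_smul (isCoord_rep m) hv
  exact (smul_mem_stratum_iff Φ hc).symm

variable {H L : Type*} [HomCoords k H L] [AddCommGroup H] [Module k H]

/-- The points over `S` of the projectivized bundle of kernels, times a factor. -/
def flagSet (L : Type*) (Φ : V →ₗ[k] P →ₗ[k] Q) (ι : P →ₗ[k] F) (S : Set (ℙ k V)) :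
    Set (ℙ k V × (ℙ k F × L)) :=
  {q | q.1 ∈ S ∧ q.2.1.rep ∈ (LinearMap.ker (Φ q.1.rep)).map ι}

variable (Φ : V →ₗ[k] P →ₗ[k] Q) (ι : P →ₗ[k] F)

theorem smul_mem_map_ker_iff {c d : k} (hc : c ≠ 0) (hd : d ≠ 0) {v : V} {y : F} :
    d • y ∈ (LinearMap.ker (Φ (c • v))).map ι ↔ y ∈ (LinearMap.ker (Φ v)).map ι := by
  have h : LinearMap.ker (Φ (c • v)) = LinearMap.ker (Φ v) := by
    ext p
    rw [LinearMap.mem_ker, LinearMap.mem_ker, map_smul, LinearMap.smul_apply, smul_eq_zero,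
      or_iff_right hc]
  rw [h]
  exact Submodule.smul_mem_iff _ hd

theorem mem_flagSet_iff {S : Set (ℙ k V)} {q : ℙ k V × (ℙ k F × L)} {v : V} {y : F}
    (hv : HomCoords.IsCoord k v q.1) (hy : HomCoords.IsCoord k y q.2.1) :
    q ∈ flagSet L Φ ι S ↔ q.1 ∈ S ∧ y ∈ (LinearMap.ker (Φ v)).map ι := by
  obtain ⟨c, hc, rfl⟩ := isCoord_eq_smul (isCoord_rep q.1) hv
  obtain ⟨d, hd, rfl⟩ := isCoord_eq_smul (isCoord_rep q.2.1) hy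
  rw [smul_mem_map_ker_iff Φ ι hc hd]
  rfl

/-- The points of the product that have a given set of pairs as coordinates. -/
def pairPoints (L : Type*) (T : Set (V × P)) : Set (ℙ k V × (ℙ k F × L)) :=
  {q | ∃ z ∈ T, HomCoords.IsCoord k z.1 q.1 ∧ HomCoords.IsCoord k (ι z.2) q.2.1}

variable {ι}

/-- Freezing the third factor and the scalars `c`, `d` turns a multihomogeneous equation into a
polynomial in the pair, to which the affine closure applies. -/
theorem pairPoints_subset_zcl (hι : Function.Injective ι) {T U : Set (V × P)}
    (hU : ∀ z ∈ U, z.1 ≠ 0 ∧ z.2 ≠ 0) (h : T ⊆ acl k U) :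
    pairPoints ι L T ⊆ zcl k (pairPoints ι L U) := by
  rintro q ⟨z, hz, hz1, hz2⟩ p hp hpU x ⟨hx1, hx2, hx3⟩
  obtain ⟨c, hc, hxc⟩ := isCoord_eq_smul hz1 hx1
  obtain ⟨d, hd, hxd⟩ := isCoord_eq_smul hz2 hx2
  have hg : IsPolyMap k fun u : V × P => (c • u.1, (d • ι u.2, x.2.2)) :=
    (isPolyMap_linear (c • LinearMap.fst k V P)).prodMk
      ((isPolyMap_linear (d • ι ∘ₗ LinearMap.snd k V P)).prodMk (isPolyMap_const x.2.2))
  have := h hz _ (comp_mem_polyFun hg hp) fun u hu => by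
    obtain ⟨h1, h2⟩ := hU u hu
    have h3 : ι u.2 ≠ 0 := fun h => h2 (hι (by rw [h, map_zero]))
    exact hpU (Projectivization.mk k _ h1, (Projectivization.mk k _ h3, q.2.2))
      ⟨u, hu, isCoord_mk h1, isCoord_mk h3⟩ _
      ⟨isCoord_smul (isCoord_mk h1) hc, isCoord_smul (isCoord_mk h3) hd, hx3⟩
  have hxe : x = (c • z.1, (d • ι z.2, x.2.2)) := by
    rw [← hxc, ← hxd]
  rw [hxe]
  exact this

/-- In the other direction, an affine equation is pulled back along a retraction of `ι`. Stability
of `T` under separate scalings makes it vanish at every coordinate vector of the points. -/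
theorem mem_acl_of_mem_zcl [NiceCoords k H L] (hι : Function.Injective ι) {T : Set (V × P)}
    (hT : ∀ z ∈ T, ∀ c d : k, c ≠ 0 → d ≠ 0 → (c • z.1, d • z.2) ∈ T) {z : V × P}
    {q : ℙ k V × (ℙ k F × L)} (hz1 : HomCoords.IsCoord k z.1 q.1)
    (hz2 : HomCoords.IsCoord k (ι z.2) q.2.1) (hq : q ∈ zcl k (pairPoints ι L T)) :
    z ∈ acl k T := by
  intro p hp hpT
  obtain ⟨π, hπ⟩ := ι.exists_leftInverse_of_injective (LinearMap.ker_eq_bot.2 hι)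
  have hπι : ∀ y, π (ι y) = y := fun y => congrArg (fun T => T y) hπ
  obtain ⟨r, hr⟩ := NiceCoords.exists_coord (k := k) (E := H) q.2.2
  have hg : IsPolyMap k fun x : V × (F × H) => (x.1, π x.2.1) :=
    (isPolyMap_linear (LinearMap.fst k V (F × H))).prodMk
      (isPolyMap_linear (π ∘ₗ LinearMap.fst k F H ∘ₗ LinearMap.snd k V (F × H)))
  have := hq _ (comp_mem_polyFun hg hp) (fun m ⟨u, hu, hu1, hu2⟩ x hx => by
    obtain ⟨c, hc, hxc⟩ := isCoord_eq_smul hu1 hx.1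
    obtain ⟨d, hd, hxd⟩ := isCoord_eq_smul hu2 hx.2.1
    rw [hxc, hxd, map_smul, hπι]
    exact hpT _ (hT u hu c d hc hd)) (z.1, (ι z.2, r)) ⟨hz1, hz2, hr⟩
  rwa [hπι] at this

theorem pairPoints_kernelPairs :
    pairPoints ι L (kernelPairs Φ) = flagSet L Φ ι Set.univ := by
  ext q
  constructor
  · rintro ⟨z, hz, hz1, hz2⟩
    exact (mem_flagSet_iff Φ ι hz1 hz2).2 ⟨trivial, z.2, hz.2.2, rfl⟩
  · rintro ⟨-, p, hp, hpq⟩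
    refine ⟨(q.1.rep, p), ⟨q.1.rep_nonzero, fun h => q.2.1.rep_nonzero ?_, hp⟩, isCoord_rep _, ?_⟩
    · rw [← hpq, show p = 0 from h, map_zero]
    · change HomCoords.IsCoord k (ι p) _
      rw [hpq]
      exact isCoord_rep _

theorem pairPoints_stratumPairs (j : ℕ) :
    pairPoints ι L (stratumPairs Φ j) = flagSet L Φ ι (projStratum Φ j) := by
  ext q
  constructor
  · rintro ⟨z, hz, hz1, hz2⟩
    exact (mem_flagSet_iff Φ ι hz1 hz2).2
      ⟨(mem_projStratum_iff Φ hz1).2 hz.2, z.2, hz.1.2.2, rfl⟩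
  · rintro ⟨hq, hq'⟩
    have : q ∈ flagSet L Φ ι Set.univ := ⟨trivial, hq'⟩
    rw [← pairPoints_kernelPairs Φ] at this
    obtain ⟨z, hz, hz1, hz2⟩ := this
    exact ⟨z, ⟨hz, (mem_projStratum_iff Φ hz1).1 hq⟩, hz1, hz2⟩

theorem smul_mem_kernelPairs {z : V × P} (hz : z ∈ kernelPairs Φ) {c d : k} (hc : c ≠ 0)
    (hd : d ≠ 0) : (c • z.1, d • z.2) ∈ kernelPairs Φ :=
  ⟨smul_ne_zero hc hz.1, smul_ne_zero hd hz.2.1, by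
    simp only [map_smul, LinearMap.smul_apply, hz.2.2, smul_zero]⟩

variable [FiniteDimensional k V] [FiniteDimensional k P] [IsAlgClosed k] [NiceCoords k H L]

theorem flagSet_subset_zcl_iUnion (hι : Function.Injective ι) (hK : LocallyFewEquations Φ) :
    flagSet L Φ ι Set.univ ⊆ zcl k (⋃ j : ℕ, flagSet L Φ ι (projStratum Φ (j + 1))) := by
  rw [← pairPoints_kernelPairs Φ]
  refine (pairPoints_subset_zcl hι ?_ (kernelPairs_subset_acl Φ hK)).trans (zcl_mono ?_)
  · intro z hz
    obtain ⟨i, hi⟩ := Set.mem_iUnion.1 hz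
    exact ⟨hi.1.1, hi.1.2.1⟩
  · rintro q ⟨z, hz, hz1, hz2⟩
    obtain ⟨i, hi⟩ := Set.mem_iUnion.1 hz
    refine Set.mem_iUnion.2 ⟨i, ?_⟩
    rw [← pairPoints_stratumPairs Φ]
    exact ⟨z, hi, hz1, hz2⟩

theorem flagSet_subset_zcl_interior (hι : Function.Injective ι) (hU : StrataBound k (nullity Φ))
    {j : ℕ} (hj : 0 < j) : flagSet L Φ ι (projStratum Φ j) ⊆
      zcl k (flagSet L Φ ι (projStratum Φ j) \
        zcl k (flagSet L Φ ι Set.univ \ flagSet L Φ ι (projStratum Φ j))) := by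
  rw [← pairPoints_stratumPairs Φ, ← pairPoints_kernelPairs Φ]
  refine (pairPoints_subset_zcl hι (fun z hz => ⟨hz.1.1.1, hz.1.1.2.1⟩)
    (stratumPairs_subset_acl Φ hU hj)).trans (zcl_mono ?_)
  rintro q ⟨z, hz, hz1, hz2⟩
  refine ⟨⟨z, hz.1, hz1, hz2⟩, fun hq => hz.2 (mem_acl_of_mem_zcl hι ?_ hz1 hz2
    (zcl_mono ?_ hq))⟩
  · rintro u ⟨hu, hu'⟩ c d hc hd
    exact ⟨smul_mem_kernelPairs Φ hu hc hd, fun h =>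
      hu' ⟨hu, (smul_mem_stratum_iff Φ hc).1 h.2⟩⟩
  · rintro m ⟨⟨u, hu, hu1, hu2⟩, hm⟩
    exact ⟨u, ⟨hu, fun h => hm ⟨u, h, hu1, hu2⟩⟩, hu1, hu2⟩

end Flags

/-! ### Comparing two kernel bundles over the same strata -/

section Glue

variable {k V P Q F P' Q' F' W : Type*} [Field k] [AddCommGroup V] [Module k V]
  [AddCommGroup P] [Module k P] [AddCommGroup Q] [Module k Q] [AddCommGroup F] [Module k F]
  [AddCommGroup P'] [Module k P'] [AddCommGroup Q'] [Module k Q'] [AddCommGroup F'] [Module k F']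
  [AddCommGroup W] [Module k W]
  [FiniteDimensional k V] [FiniteDimensional k P] [FiniteDimensional k P'] [FiniteDimensional k W]
variable {G Gt : Type*} [Group G] [Group Gt] {ext : GmExtension k G Gt}
  {ρ : Gt →* (V ≃ₗ[k] V)} {φ : Gt →* (F ≃ₗ[k] F)} {φ' : Gt →* (F' ≃ₗ[k] F')}
  {τ : Gt →* (W ≃ₗ[k] W)}

/-- `φ g` embeds the kernel at `v` into the kernel at `ρ g v`, and `g⁻¹` gives the reverse
inequality. -/
theorem nullity_map {Φ : V →ₗ[k] P →ₗ[k] Q} {ι : P →ₗ[k] F} (hι : Function.Injective ι)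
    (hLg : ∀ (g : Gt) (v : V), ∀ y ∈ (LinearMap.ker (Φ v)).map ι,
      φ g y ∈ (LinearMap.ker (Φ (ρ g v))).map ι) (g : Gt) (v : V) :
    nullity Φ (ρ g v) = nullity Φ v := by
  have key : ∀ g v, nullity Φ v ≤ nullity Φ (ρ g v) := fun g v => by
    rw [nullity, nullity, (Submodule.equivMapOfInjective ι hι (LinearMap.ker (Φ v))).finrank_eq,
      (Submodule.equivMapOfInjective ι hι (LinearMap.ker (Φ (ρ g v)))).finrank_eq,
      ← LinearEquiv.finrank_map_eq (φ g)]
    refine Submodule.finrank_mono ?_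
    rintro _ ⟨y, hy, rfl⟩
    exact hLg g v y hy
  refine le_antisymm ?_ (key g v)
  have := key g⁻¹ (ρ g v)
  rwa [← LinearEquiv.mul_apply, ← map_mul, inv_mul_cancel, map_one] at this

theorem projStratum_stable (hρ : GmActsByScalars ext ρ) {Φ : V →ₗ[k] P →ₗ[k] Q}
    (h : ∀ g v, nullity Φ (ρ g v) = nullity Φ v) (j : ℕ) (γ : G) :
    ∀ m ∈ projStratum Φ j, projAction ext hρ γ m ∈ projStratum Φ j := by
  intro m hm
  obtain ⟨g, rfl⟩ := ext.proj_surjective γ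
  exact (mem_projStratum_iff Φ (isCoord_projAction hρ g (isCoord_rep m))).2
    (map_mem_stratum (ρ g) (h g) hm)

theorem flagSet_stable {H L : Type*} [HomCoords k H L] [AddCommGroup H] [Module k H]
    (hρ : GmActsByScalars ext ρ) (hφ : GmActsByScalars ext φ)
    {Φ : V →ₗ[k] P →ₗ[k] Q} {ι : P →ₗ[k] F}
    (hLg : ∀ (g : Gt) (v : V), ∀ y ∈ (LinearMap.ker (Φ v)).map ι,
      φ g y ∈ (LinearMap.ker (Φ (ρ g v))).map ι) {S : Set (ℙ k V)}
    (hS : ∀ γ, ∀ m ∈ S, projAction ext hρ γ m ∈ S) (β : G →* Equiv.Perm L) (γ : G) :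
    ∀ q ∈ flagSet L Φ ι S, prodAction (projAction ext hρ) (prodAction (projAction ext hφ) β) γ q ∈
      flagSet L Φ ι S := by
  rintro q ⟨hq, hq'⟩
  obtain ⟨g, rfl⟩ := ext.proj_surjective γ
  exact (mem_flagSet_iff Φ ι (isCoord_projAction hρ g (isCoord_rep q.1))
    (isCoord_projAction hφ g (isCoord_rep q.2.1))).2 ⟨hS _ _ hq, hLg g _ _ hq'⟩

variable [IsAlgClosed k] [CharZero k] [Finite G]

/-- The bundles of kernels of two linear families of linear maps of equal nullities are
equivariantly birational, after a product with a line and a projective representation. -/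
theorem equivBirational_flagSet [Nontrivial P] [Nontrivial P'] [Nontrivial F] [Nontrivial F']
    [Nontrivial V] [Nontrivial W] (hρ : GmActsByScalars ext ρ)
    (hφ : GmActsByScalars ext φ) (hφ' : GmActsByScalars ext φ') (hτ : GmActsByScalars ext τ)
    (hτi : Function.Injective τ) (hfree : GenericallyFree k (projAction ext hτ) Set.univ)
    {Φ : V →ₗ[k] P →ₗ[k] Q} {ι : P →ₗ[k] F} (hι : Function.Injective ι)
    (hLg : ∀ (g : Gt) (v : V), ∀ y ∈ (LinearMap.ker (Φ v)).map ι,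
      φ g y ∈ (LinearMap.ker (Φ (ρ g v))).map ι)
    {Φ' : V →ₗ[k] P' →ₗ[k] Q'} {ι' : P' →ₗ[k] F'} (hι' : Function.Injective ι')
    (hLg' : ∀ (g : Gt) (v : V), ∀ y ∈ (LinearMap.ker (Φ' v)).map ι',
      φ' g y ∈ (LinearMap.ker (Φ' (ρ g v))).map ι')
    (hK : LocallyFewEquations Φ) (hK' : LocallyFewEquations Φ')
    (hU : StrataBound k (nullity Φ)) (hn : ∀ v ≠ 0, nullity Φ v = nullity Φ' v) :
    EquivBirational k
      (prodAction (projAction ext hρ) (prodAction (projAction ext hφ)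
        (prodAction (1 : G →* Equiv.Perm (ℙ k (Fin 2 → k))) (projAction ext hτ))))
      (flagSet (ℙ k (Fin 2 → k) × ℙ k W) Φ ι Set.univ)
      (prodAction (projAction ext hρ) (prodAction (projAction ext hφ')
        (prodAction (1 : G →* Equiv.Perm (ℙ k (Fin 2 → k))) (projAction ext hτ))))
      (flagSet (ℙ k (Fin 2 → k) × ℙ k W) Φ' ι' Set.univ) := by
  have hst : ∀ j, projStratum Φ j = projStratum Φ' j := fun j => by
    rw [projStratum, projStratum, stratum_congr hn]
  have hS := projStratum_stable hρ (nullity_map hι hLg)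
  have hS' := projStratum_stable hρ (nullity_map hι' hLg')
  have hun : ∀ γ, ∀ m ∈ (Set.univ : Set (ℙ k V)), projAction ext hρ γ m ∈ Set.univ :=
    fun _ _ _ => trivial
  have hact := isPolyAction_one (k := k) (G := G) (M := ℙ k (Fin 2 → k)) |>.prod
    (isPolyAction_projAction hτ)
  have hdis : ∀ (i j : ℕ) (m : ℙ k V), m ∈ projStratum Φ (i + 1) → m ∈ projStratum Φ (j + 1) →
      i = j := fun i j m hi hj => by
    have h1 := (stratum_spec hi).2
    have h2 := (stratum_spec hj).2
    omega
  refine equivBirational_glue (ι := ℕ)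
    ((isPolyAction_projAction hρ).prod ((isPolyAction_projAction hφ).prod hact))
    ((isPolyAction_projAction hρ).prod ((isPolyAction_projAction hφ').prod hact))
    (flagSet_stable hρ hφ hLg hun _) (flagSet_stable hρ hφ' hLg' hun _)
    (A := fun j => flagSet _ Φ ι (projStratum Φ (j + 1)))
    (A' := fun j => flagSet _ Φ' ι' (projStratum Φ' (j + 1)))
    (fun j q hq => ⟨trivial, hq.2⟩) (fun j q hq => ⟨trivial, hq.2⟩)
    (fun j => flagSet_stable hρ hφ hLg (hS _) _) (fun j => flagSet_stable hρ hφ' hLg' (hS' _) _)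
    (fun i j m hi hj => hdis i j _ hi.1 hj.1)
    (fun i j m hi hj => hdis i j _ (by rw [hst]; exact hi.1) (by rw [hst]; exact hj.1))
    (fun j => flagSet_subset_zcl_interior Φ hι hU (Nat.succ_pos j))
    (fun j => flagSet_subset_zcl_interior Φ' hι' (hU.congr hn) (Nat.succ_pos j))
    (flagSet_subset_zcl_iUnion Φ hι hK) (flagSet_subset_zcl_iUnion Φ' hι' hK') fun j => ?_
  -- Over one stratum both bundles have rank `j + 1`, so both are equivalent to the same product of
  -- the stratum with a projective space and the auxiliary factors.
  have h1 := equivBirational_noName_ker hρ hφ hτ hτi hfree (hS (j + 1)) Φ ι hι hLg (Nat.succ_pos j)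
    fun m hm => (stratum_spec hm).2
  have h2 := equivBirational_noName_ker hρ hφ' hτ hτi hfree (hS' (j + 1)) Φ' ι' hι' hLg'
    (Nat.succ_pos j) fun m hm => (stratum_spec hm).2
  rw [← hst] at h2
  rw [flagSet, flagSet, ← hst]
  exact h1.symm.trans h2

end Glue

/-! ### The plane as a product of two lines -/

section Plane

variable {k : Type*} [Field k] {E M H N : Type*} [HomCoords k E M] [AddCommGroup E] [Module k E]
  [NiceCoords k E M] [HomCoords k H N] [AddCommGroup H] [Module k H] [NiceCoords k H N]

/-- The product of a dense open subset cut out in one factor. -/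
theorem isDenseOpenIn_of_polyFun [Infinite k] {T : Type*} [AddCommGroup T] [Module k T] {Z : Set M}
    {D : T → k} (hD : D ∈ PolyFun k T) {t₀ : T} (ht₀ : D t₀ ≠ 0) {R : Type*} [HomCoords k T R]
    [NiceCoords k T R] (hDR : ∀ t, D t ≠ 0 → ∃ r : R, HomCoords.IsCoord k t r)
    (hinv : ∀ (t t' : T) (r : R), HomCoords.IsCoord k t r → HomCoords.IsCoord k t' r → D t = 0 →
      D t' = 0) :
    IsDenseOpenIn k {q : M × (R × N) | q.1 ∈ Z ∧ ∀ t, HomCoords.IsCoord k t q.2.1 → D t ≠ 0}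
      (Z ×ˢ (Set.univ : Set (R × N))) := by
  rw [isDenseOpenIn_iff]
  refine ⟨⟨{q | ∃ t, HomCoords.IsCoord k t q.2.1 ∧ D t = 0}, ?_, ?_⟩, ?_⟩
  · refine ⟨{fun x => D x.2.1}, ?_, fun x q hx => ⟨?_, fun h => ⟨x.2.1, hx.2.1, h _ rfl⟩⟩⟩
    · rintro _ rfl
      exact comp_mem_polyFun (isPolyMap_linear (LinearMap.fst k T H ∘ₗ LinearMap.snd k E (T × H)))
        hD
    · rintro ⟨t, ht, h⟩ _ rfl
      exact hinv t _ _ ht hx.2.1 h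
  · ext q
    simp only [Set.mem_ofPred_eq, Set.mem_sdiff, Set.mem_prod, Set.mem_univ, and_true, not_exists,
      not_and]
  · rintro q ⟨hq, -⟩ p hp hpU x hx
    have hs : IsPolyMap k fun t : T => (x.1, (t, x.2.2)) :=
      (isPolyMap_const x.1).prodMk (isPolyMap_id.prodMk (isPolyMap_const x.2.2))
    have := (polyFun_mul_eq_zero (comp_mem_polyFun hs hp) hD fun t => by
      by_cases ht : D t = 0
      · rw [ht, mul_zero]
      · obtain ⟨r, hr⟩ := hDR t ht
        rw [hpU (q.1, (r, q.2.2)) ⟨hq, fun t' ht' h => ht (hinv t' t r ht' hr h)⟩ (x.1, (t, x.2.2))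
          ⟨hx.1, hr, hx.2.2⟩, zero_mul]).resolve_right fun h => ht₀ (h t₀)
    exact this x.2.1

variable {G : Type*} [Group G] {α : G →* Equiv.Perm M} {β : G →* Equiv.Perm N}

theorem vec2_ne_zero_left {a b : k} (h : a ≠ 0) : ![a, b] ≠ 0 := fun hc => h (congrFun hc 0)

theorem vec2_ne_zero_right {a b : k} (h : b ≠ 0) : ![a, b] ≠ 0 := fun hc => h (congrFun hc 1)

theorem entry_mem_polyFun {n : ℕ} {P : E → Fin n → k} (hP : IsPolyMap k P) (i : Fin n) :
    (fun x => P x i) ∈ PolyFun k E := hP (LinearMap.proj i)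

/-- The plane is birational to a product of two lines. -/
theorem equivBirational_plane [Infinite k] {Z : Set M} (hZ : ∀ g, ∀ m ∈ Z, α g m ∈ Z) :
    EquivBirational k
      (prodAction α (prodAction (1 : G →* Equiv.Perm (ℙ k (Fin 3 → k))) β))
      (Z ×ˢ (Set.univ : Set (ℙ k (Fin 3 → k) × N)))
      (prodAction α (prodAction (1 : G →* Equiv.Perm (ℙ k (Fin 2 → k)))
        (prodAction (1 : G →* Equiv.Perm (ℙ k (Fin 2 → k))) β)))
      (Z ×ˢ (Set.univ : Set (ℙ k (Fin 2 → k) × (ℙ k (Fin 2 → k) × N)))) := by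
  have assoc : EquivBirational k
      (prodAction α (prodAction (prodAction (1 : G →* Equiv.Perm (ℙ k (Fin 2 → k)))
        (1 : G →* Equiv.Perm (ℙ k (Fin 2 → k)))) β))
      (Z ×ˢ (Set.univ : Set ((ℙ k (Fin 2 → k) × ℙ k (Fin 2 → k)) × N)))
      (prodAction α (prodAction (1 : G →* Equiv.Perm (ℙ k (Fin 2 → k)))
        (prodAction (1 : G →* Equiv.Perm (ℙ k (Fin 2 → k))) β)))
      (Z ×ˢ (Set.univ : Set (ℙ k (Fin 2 → k) × (ℙ k (Fin 2 → k) × N)))) := by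
    refine equivBirational_of_iso ((Equiv.refl M).prodCongr (Equiv.prodAssoc _ _ _))
      (P := fun x => (x.1, (x.2.1.1, (x.2.1.2, x.2.2))))
      (Q := fun x => (x.1, ((x.2.1, x.2.2.1), x.2.2.2)))
      ?_ ?_ (fun x m hx => ⟨hx.1, hx.2.1.1, hx.2.1.2, hx.2.2⟩)
      (fun x m hx => ⟨hx.1, ⟨hx.2.1, hx.2.2.1⟩, hx.2.2.2⟩) (fun m => Iff.rfl)
      (fun g m hm => ⟨hZ g _ hm.1, trivial⟩) fun g m => rfl
    · exact isPolyMap_id.fst.prodMk (isPolyMap_id.snd.fst.fst.prodMk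
        (isPolyMap_id.snd.fst.snd.prodMk isPolyMap_id.snd.snd))
    · exact isPolyMap_id.fst.prodMk ((isPolyMap_id.snd.fst.prodMk isPolyMap_id.snd.snd.fst).prodMk
        isPolyMap_id.snd.snd.snd)
  refine EquivBirational.trans ?_ assoc
  -- The equivalence is `(c₀ : c₁ : c₂) ↦ ((c₀ : c₁), (c₁ : c₂))`; it is invertible on the loci
  -- where `D` and `D'` are nonzero.
  let D : (Fin 3 → k) → k := fun c => c 1
  let D' : (Fin 2 → k) × (Fin 2 → k) → k := fun z => z.1 1 * z.2 0
  let φ : M × (ℙ k (Fin 3 → k) × N) → M × ((ℙ k (Fin 2 → k) × ℙ k (Fin 2 → k)) × N) := fun q =>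
    (q.1, ((pointOf ![q.2.1.rep 0, q.2.1.rep 1], pointOf ![q.2.1.rep 1, q.2.1.rep 2]), q.2.2))
  let ψ : M × ((ℙ k (Fin 2 → k) × ℙ k (Fin 2 → k)) × N) → M × (ℙ k (Fin 3 → k) × N) := fun q =>
    (q.1, (pointOf ![q.2.1.1.rep 0 * q.2.1.2.rep 0, q.2.1.1.rep 1 * q.2.1.2.rep 0,
      q.2.1.1.rep 1 * q.2.1.2.rep 1], q.2.2))
  have hφc : ∀ q (x : E × ((Fin 3 → k) × H)), HomCoords.IsCoord k x q → D x.2.1 ≠ 0 →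
      HomCoords.IsCoord k (x.1, ((![x.2.1 0, x.2.1 1], ![x.2.1 1, x.2.1 2]), x.2.2)) (φ q) := by
    rintro q x ⟨hx1, hx2, hx3⟩ hD
    obtain ⟨c, hc, h⟩ := isCoord_eq_smul hx2 (isCoord_rep q.2.1)
    have h1 : ![x.2.1 0, x.2.1 1] = c⁻¹ • ![q.2.1.rep 0, q.2.1.rep 1] := by
      rw [h]; ext i; fin_cases i <;> simp [hc]
    have h2 : ![x.2.1 1, x.2.1 2] = c⁻¹ • ![q.2.1.rep 1, q.2.1.rep 2] := by
      rw [h]; ext i; fin_cases i <;> simp [hc]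
    have h0 : q.2.1.rep 1 ≠ 0 := by rw [h]; exact mul_ne_zero hc hD
    refine ⟨hx1, ⟨?_, ?_⟩, hx3⟩
    · change HomCoords.IsCoord k ![x.2.1 0, x.2.1 1] _
      rw [h1]
      exact isCoord_smul (isCoord_pointOf (vec2_ne_zero_right h0)) (inv_ne_zero hc)
    · change HomCoords.IsCoord k ![x.2.1 1, x.2.1 2] _
      rw [h2]
      exact isCoord_smul (isCoord_pointOf (vec2_ne_zero_left h0)) (inv_ne_zero hc)
  have hψc : ∀ q (x : E × (((Fin 2 → k) × (Fin 2 → k)) × H)), HomCoords.IsCoord k x q →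
      D' x.2.1 ≠ 0 → HomCoords.IsCoord k (x.1, (![x.2.1.1 0 * x.2.1.2 0, x.2.1.1 1 * x.2.1.2 0,
        x.2.1.1 1 * x.2.1.2 1], x.2.2)) (ψ q) := by
    rintro q x ⟨hx1, ⟨hx2, hx2'⟩, hx3⟩ hD
    obtain ⟨c, hc, h⟩ := isCoord_eq_smul hx2 (isCoord_rep q.2.1.1)
    obtain ⟨d, hd, h'⟩ := isCoord_eq_smul hx2' (isCoord_rep q.2.1.2)
    have h1 : ![x.2.1.1 0 * x.2.1.2 0, x.2.1.1 1 * x.2.1.2 0, x.2.1.1 1 * x.2.1.2 1] =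
        (c * d)⁻¹ • ![q.2.1.1.rep 0 * q.2.1.2.rep 0, q.2.1.1.rep 1 * q.2.1.2.rep 0,
          q.2.1.1.rep 1 * q.2.1.2.rep 1] := by
      rw [h, h']; ext i; fin_cases i <;> simp <;> field_simp
    refine ⟨hx1, ?_, hx3⟩
    change HomCoords.IsCoord k ![_, _, _] _
    rw [h1]
    refine isCoord_smul (isCoord_pointOf fun hz => ?_) (inv_ne_zero (mul_ne_zero hc hd))
    have h0 : q.2.1.1.rep 1 * q.2.1.2.rep 0 = 0 := congrFun hz 1
    rw [h, h'] at h0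
    simp only [Pi.smul_apply, smul_eq_mul] at h0
    have : (c * d) * (x.2.1.1 1 * x.2.1.2 0) = 0 := by linear_combination h0
    exact mul_ne_zero (mul_ne_zero hc hd) hD this
  have hDp : D ∈ PolyFun k (Fin 3 → k) := dual_mem_polyFun (LinearMap.proj (R := k)
    (φ := fun _ : Fin 3 => k) 1)
  have hDp' : D' ∈ PolyFun k ((Fin 2 → k) × (Fin 2 → k)) :=
    mul_mem_polyFun
      (dual_mem_polyFun (LinearMap.proj (R := k) (φ := fun _ : Fin 2 => k) 1 ∘ₗ
        LinearMap.fst k (Fin 2 → k) (Fin 2 → k)))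
      (dual_mem_polyFun (LinearMap.proj (R := k) (φ := fun _ : Fin 2 => k) 0 ∘ₗ
        LinearMap.snd k (Fin 2 → k) (Fin 2 → k)))
  have hinv : ∀ (t t' : Fin 3 → k) (r : ℙ k (Fin 3 → k)), HomCoords.IsCoord k t r →
      HomCoords.IsCoord k t' r → D t = 0 → D t' = 0 := fun t t' r ht ht' h => by
    obtain ⟨c, -, rfl⟩ := isCoord_eq_smul ht ht'
    change c * D t = 0
    rw [h, mul_zero]
  have hinv' : ∀ (t t' : (Fin 2 → k) × (Fin 2 → k)) (r : ℙ k (Fin 2 → k) × ℙ k (Fin 2 → k)),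
      HomCoords.IsCoord k t r → HomCoords.IsCoord k t' r → D' t = 0 → D' t' = 0 :=
    fun t t' r ht ht' h => by
    obtain ⟨c, -, h1⟩ := isCoord_eq_smul ht.1 ht'.1
    obtain ⟨d, -, h2⟩ := isCoord_eq_smul ht.2 ht'.2
    have : D' t' = c * d * D' t := by
      simp only [D', h1, h2, Pi.smul_apply, smul_eq_mul]; ring
    rw [this, h, mul_zero]
  refine ⟨{q | q.1 ∈ Z ∧ ∀ t, HomCoords.IsCoord k t q.2.1 → D t ≠ 0},
    {q | q.1 ∈ Z ∧ ∀ t, HomCoords.IsCoord k t q.2.1 → D' t ≠ 0}, φ, ψ,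
    isDenseOpenIn_of_polyFun hDp (t₀ := fun _ => 1) one_ne_zero (fun t ht =>
      ⟨Projectivization.mk k t fun h => ht (by rw [h]; rfl), isCoord_mk _⟩) hinv,
    isDenseOpenIn_of_polyFun hDp' (t₀ := (fun _ => 1, fun _ => 1)) (mul_ne_zero one_ne_zero
      one_ne_zero) (fun t ht => ⟨(Projectivization.mk k t.1 fun h => ht ?_,
        Projectivization.mk k t.2 fun h => ht ?_), isCoord_mk _, isCoord_mk _⟩) hinv',
    ?_, ?_, ?_, ?_, ?_, ?_, fun g m hm => ⟨hZ g _ hm.1, hm.2⟩, fun g m hm => ⟨hZ g _ hm.1, hm.2⟩,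
    fun g m hm => rfl⟩
  · simp [D', h]
  · simp [D', h]
  · rintro q ⟨hq, hqD⟩
    obtain ⟨x, hx⟩ := NiceCoords.exists_coord (k := k) (E := E × ((Fin 3 → k) × H)) q
    have h1 := hqD _ hx.2.1
    have h2 := hφc q x hx h1
    exact ⟨hq, fun t ht h => mul_ne_zero h1 h1 (hinv' _ _ _ ht h2.2.1 h)⟩
  · rintro q ⟨hq, hqD⟩
    obtain ⟨x, hx⟩ := NiceCoords.exists_coord (k := k)
      (E := E × (((Fin 2 → k) × (Fin 2 → k)) × H)) q
    have h1 := hqD _ hx.2.1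
    have h2 := hψc q x hx h1
    exact ⟨hq, fun t ht h => h1 (hinv _ _ _ ht h2.2.1 h)⟩
  · rintro q ⟨hq, hqD⟩
    obtain ⟨x, hx⟩ := NiceCoords.exists_coord (k := k) (E := E × ((Fin 3 → k) × H)) q
    have h1 := hqD _ hx.2.1
    have h2 := hψc _ _ (hφc q x hx h1) (mul_ne_zero h1 h1)
    -- The composite multiplies the coordinate vector by its middle entry, which is nonzero here.
    have h3 := isCoord_smul hx.2.1 h1
    refine NiceCoords.unique (k := k) (E := E × ((Fin 3 → k) × H)) _ _ _ h2
      (show HomCoords.IsCoord k _ q from ⟨hx.1, ?_, hx.2.2⟩)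
    convert h3 using 1
    ext i
    fin_cases i <;> simp [D, mul_comm]
  · rintro q ⟨hq, hqD⟩
    obtain ⟨x, hx⟩ := NiceCoords.exists_coord (k := k)
      (E := E × (((Fin 2 → k) × (Fin 2 → k)) × H)) q
    have h1 := hqD _ hx.2.1
    have h2 := hφc _ _ (hψc q x hx h1) h1
    refine NiceCoords.unique (k := k) (E := E × (((Fin 2 → k) × (Fin 2 → k)) × H)) _ _ _ h2
      (show HomCoords.IsCoord k _ q from ⟨hx.1, ⟨?_, ?_⟩, hx.2.2⟩)
    · convert isCoord_smul hx.2.1.1 (right_ne_zero_of_mul h1) using 1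
      ext i
      fin_cases i <;> simp [mul_comm]
    · convert isCoord_smul hx.2.1.2 (left_ne_zero_of_mul h1) using 1
      ext i
      fin_cases i <;> simp
  · intro q hq
    refine ⟨∅, isZariskiClosed_empty, by simp, fun x =>
      (x.1, ((![x.2.1 0, x.2.1 1], ![x.2.1 1, x.2.1 2]), x.2.2)), ?_,
      fun q' hq' x hx => hφc q' x hx (hq'.1.2 _ hx.2.1)⟩
    refine isPolyMap_id.fst.prodMk (IsPolyMap.prodMk (IsPolyMap.prodMk ?_ ?_) isPolyMap_id.snd.snd)
    all_goals
      have hc : IsPolyMap k fun x : E × ((Fin 3 → k) × H) => x.2.1 := isPolyMap_id.snd.fst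
      refine IsPolyMap.pi fun i => ?_
      fin_cases i <;> exact entry_mem_polyFun hc _
  · intro q hq
    refine ⟨∅, isZariskiClosed_empty, by simp, fun x =>
      (x.1, (![x.2.1.1 0 * x.2.1.2 0, x.2.1.1 1 * x.2.1.2 0, x.2.1.1 1 * x.2.1.2 1], x.2.2)), ?_,
      fun q' hq' x hx => hψc q' x hx (hq'.1.2 _ hx.2.1)⟩
    refine isPolyMap_id.fst.prodMk (IsPolyMap.prodMk ?_ isPolyMap_id.snd.snd)
    refine IsPolyMap.pi fun i => ?_
    have ha : IsPolyMap k fun x : E × (((Fin 2 → k) × (Fin 2 → k)) × H) => x.2.1.1 :=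
      isPolyMap_id.snd.fst.fst
    have hb : IsPolyMap k fun x : E × (((Fin 2 → k) × (Fin 2 → k)) × H) => x.2.1.2 :=
      isPolyMap_id.snd.fst.snd
    have ha' := fun i => entry_mem_polyFun ha i
    have hb' := fun i => entry_mem_polyFun hb i
    fin_cases i
    · exact mul_mem_polyFun (ha' 0) (hb' 0)
    · exact mul_mem_polyFun (ha' 1) (hb' 0)
    · exact mul_mem_polyFun (ha' 1) (hb' 1)

/-- Exchange of the first two factors. -/
theorem equivBirational_swap {E' M' : Type*} [HomCoords k E' M'] [AddCommGroup E'] [Module k E']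
    [NiceCoords k E' M'] {α' : G →* Equiv.Perm M'} {Z : Set (M × (M' × N))}
    {Z' : Set (M' × (M × N))} (h : ∀ q : M × (M' × N), q ∈ Z ↔ (q.2.1, (q.1, q.2.2)) ∈ Z')
    (hZ : ∀ g, ∀ m ∈ Z, prodAction α (prodAction α' β) g m ∈ Z) :
    EquivBirational k (prodAction α (prodAction α' β)) Z (prodAction α' (prodAction α β)) Z' :=
  equivBirational_of_iso
    (e := ⟨fun q => (q.2.1, (q.1, q.2.2)), fun q => (q.2.1, (q.1, q.2.2)), fun _ => rfl,
      fun _ => rfl⟩)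
    (P := fun x => (x.2.1, (x.1, x.2.2))) (Q := fun x => (x.2.1, (x.1, x.2.2)))
    (isPolyMap_id.snd.fst.prodMk (isPolyMap_id.fst.prodMk isPolyMap_id.snd.snd))
    (isPolyMap_id.snd.fst.prodMk (isPolyMap_id.fst.prodMk isPolyMap_id.snd.snd))
    (fun _ _ hx => ⟨hx.2.1, hx.1, hx.2.2⟩) (fun _ _ hx => ⟨hx.2.1, hx.1, hx.2.2⟩)
    h hZ fun _ _ => rfl

end Plane

/-! ### Equivariance of forms, bivectors and incidence -/

section Equivariance

variable {k V Gt : Type*} [Field k] [AddCommGroup V] [Module k V] [Group Gt]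
  (ρ : Gt →* (V ≃ₗ[k] V))

theorem finiteDimensional_skewForm [FiniteDimensional k V] : FiniteDimensional k (SkewForm k V) :=
  Module.Finite.equiv (exteriorPower.alternatingMapLinearEquiv (R := k) (M := V) (N := k)
    (n := 2)).symm

theorem skewBilin_formRep (g : Gt) (ω : SkewForm k V) (v w : V) :
    skewBilin (formRep ρ g ω) (ρ g v) (ρ g w) = skewBilin ω v w := by
  have h : skewBilin (formRep ρ g ω) (ρ g v) (ρ g w) =
      ω (fun i => (ρ g).symm (![ρ g v, ρ g w] i)) := rfl
  rw [h, skewBilin_apply]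
  congr 1
  ext i
  fin_cases i <;> simp

theorem skewBilin_formRep_eq_zero (g : Gt) {ω : SkewForm k V} {v : V} (h : skewBilin ω v = 0) :
    skewBilin (formRep ρ g ω) (ρ g v) = 0 := by
  ext w
  obtain ⟨w, rfl⟩ := (ρ g).surjective w
  rw [skewBilin_formRep, h]
  rfl

theorem wedgeRep_wedge (g : Gt) (v w : V) :
    wedgeRep ρ g (wedge v w) = wedge (ρ g v) (ρ g w) := by
  have h : wedgeRep ρ g (wedge v w) = exteriorPower.map 2 (ρ g : V →ₗ[k] V) (wedge v w) := rfl
  rw [h, wedge_apply, exteriorPower.map_apply_ιMulti, wedge_apply]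
  congr 1
  ext i
  fin_cases i <;> rfl

theorem incidence_wedgeRep [CharZero k] [FiniteDimensional k V] (g : Gt) {v : V} {x : ⋀[k]^2 V}
    (h : incidence k V v x = 0) : incidence k V (ρ g v) (wedgeRep ρ g x) = 0 := by
  by_cases hv : v = 0
  · rw [hv, map_zero, map_zero, LinearMap.zero_apply]
  · obtain ⟨w, rfl⟩ := (incidence_eq_zero_iff hv x).1 h
    rw [wedgeRep_wedge, incidence_wedge]

theorem pairing_wedgeRep (g : Gt) (ω : SkewForm k V) (x : ⋀[k]^2 V) :
    exteriorPower.alternatingMapLinearEquiv (formRep ρ g ω) (wedgeRep ρ g x) =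
      exteriorPower.alternatingMapLinearEquiv ω x := by
  have h : exteriorPower.alternatingMapLinearEquiv (formRep ρ g ω) ∘ₗ
      (wedgeRep ρ g).toLinearMap = exteriorPower.alternatingMapLinearEquiv ω :=
    linearMap_ext_wedge fun v w => by
      rw [LinearMap.comp_apply, LinearEquiv.coe_coe, wedgeRep_wedge, wedge_apply, wedge_apply,
        exteriorPower.alternatingMapLinearEquiv_apply_ιMulti,
        exteriorPower.alternatingMapLinearEquiv_apply_ιMulti]
      exact skewBilin_formRep ρ g ω v w
  exact congrArg (fun T => T x) h

variable {A : Type*} [AddCommGroup A] [Module k A] {f : A →ₗ[k] SkewForm k V}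

/-- The pairing is invariant, so `g` can be moved from the bivector to the form as `g⁻¹`, which
preserves the net. -/
theorem wedgeRep_mem_perp (hinv : ∀ g : Gt, ∀ ω ∈ LinearMap.range f,
    formRep ρ g ω ∈ LinearMap.range f) (g : Gt) {x : ⋀[k]^2 V} (hx : x ∈ perp f) :
    wedgeRep ρ g x ∈ perp f := by
  rw [mem_perp] at hx ⊢
  intro a
  obtain ⟨a', ha'⟩ := hinv g⁻¹ (f a) ⟨a, rfl⟩
  have h : f a = formRep ρ g (f a') := by
    rw [ha', ← LinearEquiv.mul_apply, ← map_mul, mul_inv_cancel, map_one]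
    rfl
  rw [h, pairing_wedgeRep]
  exact hx a'

end Equivariance

/-! ### The Pfaffian cubic, the Fano threefold and the bundles over `ℙ(V)` -/

section Main

variable {k V A : Type*} [Field k] [AddCommGroup V] [Module k V] [AddCommGroup A] [Module k A]
  [CharZero k] [FiniteDimensional k V] {f : A →ₗ[k] SkewForm k V}

theorem mem_cubicY_iff (hV : Module.finrank k V = 6) {m : ℙ k (SkewForm k V)} {ω : SkewForm k V}
    (hω : HomCoords.IsCoord k ω m) :
    m ∈ cubicY f ↔ ω ∈ LinearMap.range f ∧ ∃ u ≠ 0, skewBilin ω u = 0 := by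
  obtain ⟨c, hc, rfl⟩ := isCoord_eq_smul (isCoord_rep m) hω
  rw [Submodule.smul_mem_iff _ hc]
  have h : (∃ u ≠ 0, skewBilin (c • m.rep) u = 0) ↔ ∃ u ≠ 0, skewBilin m.rep u = 0 := by
    simp only [map_smul, LinearMap.smul_apply, smul_eq_zero, hc, false_or]
  rw [h, ← pfaffian_eq_zero_iff hV]
  rfl

theorem mem_fanoX_iff {m : ℙ k (⋀[k]^2 V)} {x : ⋀[k]^2 V} (hx : HomCoords.IsCoord k x m) :
    m ∈ fanoX f ↔ x ∈ perp f ∧ ∃ v w : V, x = wedge v w := by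
  obtain ⟨c, hc, rfl⟩ := isCoord_eq_smul (isCoord_rep m) hx
  rw [Submodule.smul_mem_iff _ hc]
  refine and_congr Iff.rfl ⟨fun ⟨v, w, h⟩ => ⟨c • v, w, ?_⟩, fun ⟨v, w, h⟩ => ⟨c⁻¹ • v, w, ?_⟩⟩
  · rw [map_smul, LinearMap.smul_apply, wedge_apply, ← h]
  · rw [← wedge_apply, map_smul, LinearMap.smul_apply, ← h, smul_smul, inv_mul_cancel₀ hc, one_smul]

variable {G Gt : Type*} [Group G] [Group Gt] {ext : GmExtension k G Gt}
  {ρ : Gt →* (V ≃ₗ[k] V)}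

theorem cubicY_stable (hV : Module.finrank k V = 6) (hρ : GmActsByScalars ext ρ)
    (hinv : ∀ g : Gt, ∀ ω ∈ LinearMap.range f, formRep ρ g ω ∈ LinearMap.range f) (γ : G) :
    ∀ m ∈ cubicY f, projAction ext hρ.form γ m ∈ cubicY f := by
  intro m hm
  obtain ⟨g, rfl⟩ := ext.proj_surjective γ
  obtain ⟨h1, u, hu, h2⟩ := (mem_cubicY_iff hV (isCoord_rep m)).1 hm
  exact (mem_cubicY_iff hV (isCoord_projAction hρ.form g (isCoord_rep m))).2
    ⟨hinv g _ h1, ρ g u, (ρ g).map_ne_zero_iff.2 hu, skewBilin_formRep_eq_zero ρ g h2⟩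

theorem fanoX_stable (hρ : GmActsByScalars ext ρ)
    (hinv : ∀ g : Gt, ∀ ω ∈ LinearMap.range f, formRep ρ g ω ∈ LinearMap.range f) (γ : G) :
    ∀ m ∈ fanoX f, projAction ext hρ.wedge γ m ∈ fanoX f := by
  intro m hm
  obtain ⟨g, rfl⟩ := ext.proj_surjective γ
  obtain ⟨h1, v, w, h2⟩ := (mem_fanoX_iff (isCoord_rep m)).1 hm
  exact (mem_fanoX_iff (isCoord_projAction hρ.wedge g (isCoord_rep m))).2
    ⟨wedgeRep_mem_perp ρ hinv g h1, ρ g v, ρ g w, by rw [h2, wedgeRep_wedge]⟩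

variable [IsAlgClosed k] [Finite G] {W : Type*} [AddCommGroup W] [Module k W]
  [FiniteDimensional k W] {τ : Gt →* (W ≃ₗ[k] W)}

/-- The Pfaffian cubic, times a plane and a projective representation, is birational to the bundle
of pairs of a degenerate form of the net and a vector in its kernel. -/
theorem equivBirational_cubicY [Nontrivial V] (hV : Module.finrank k V = 6)
    (hρ : GmActsByScalars ext ρ) (hreg : IsRegularNet f)
    (hinv : ∀ g : Gt, ∀ ω ∈ LinearMap.range f, formRep ρ g ω ∈ LinearMap.range f)
    (hτ : Function.Injective τ) (hτs : GmActsByScalars ext τ)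
    (hτfree : GenericallyFree k (projAction ext hτs) Set.univ) :
    EquivBirational k
      (prodAction (projAction ext hρ.form)
        (prodAction (1 : G →* Equiv.Perm (ℙ k (Fin 3 → k))) (projAction ext hτs)))
      (cubicY f ×ˢ (Set.univ : Set (ℙ k (Fin 3 → k) × ℙ k W)))
      (prodAction (projAction ext hρ) (prodAction (projAction ext hρ.form)
        (prodAction (1 : G →* Equiv.Perm (ℙ k (Fin 2 → k))) (projAction ext hτs))))
      (flagSet (ℙ k (Fin 2 → k) × ℙ k W) (netBilin f).flip f Set.univ) := by
  have : Infinite k := IsAlgClosed.instInfinite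
  have := finiteDimensional_skewForm (k := k) (V := V)
  have hLg : ∀ (g : Gt) (ω : SkewForm k V), ∀ y ∈ (LinearMap.ker (skewBilin ω)).map
      (LinearMap.id : V →ₗ[k] V), ρ g y ∈ (LinearMap.ker (skewBilin (formRep ρ g ω))).map
      (LinearMap.id : V →ₗ[k] V) := by
    rintro g ω _ ⟨v, hv, rfl⟩
    exact ⟨ρ g v, skewBilin_formRep_eq_zero ρ g hv, rfl⟩
  have h1 := equivBirational_noName_ker hρ.form hρ hτs hτ hτfree (cubicY_stable hV hρ hinv)
    skewBilin (LinearMap.id : V →ₗ[k] V) Function.injective_id hLg (r := 2) (by norm_num)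
    (fun m hm => by
      obtain ⟨⟨a, ha⟩, u, hu, h⟩ := (mem_cubicY_iff hV (isCoord_rep m)).1 hm
      have ha0 : a ≠ 0 := fun h0 => m.rep_nonzero (by rw [← ha, h0, map_zero])
      -- A degenerate form in six variables has a kernel of dimension at least two, and regularity
      -- gives at most two, so the kernels form a bundle of rank exactly two.
      have h2 := two_le_finrank_ker skewBilin_self hV hu h
      have h3 := skewRank_add_finrank_ker m.rep
      have h4 := hreg a ha0
      rw [ha] at h4
      omega)
  -- One line of `ℙ¹ × ℙ¹` becomes the fibre of the kernel bundle, the other stays as the parameter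
  -- line. The swap then views the bundle over `ℙ(V)`.
  refine ((equivBirational_plane (cubicY_stable hV hρ hinv)).trans h1).trans
    (equivBirational_swap (fun q => ?_)
      (flagSet_stable hρ.form hρ hLg (cubicY_stable hV hρ hinv) _))
  constructor
  · rintro ⟨hq, v, hv, hvq⟩
    obtain ⟨⟨a, ha⟩, -⟩ := (mem_cubicY_iff hV (isCoord_rep q.1)).1 hq
    refine ⟨trivial, a, ?_, ha⟩
    change skewBilin (f a) q.2.1.rep = 0
    rw [ha, ← hvq]
    exact hv
  · rintro ⟨-, a, ha, haq⟩
    have h : skewBilin (f a) q.2.1.rep = 0 := ha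
    replace haq : f a = q.1.rep := haq
    rw [haq] at h
    exact ⟨(mem_cubicY_iff hV (isCoord_rep q.1)).2 ⟨⟨a, haq⟩, _, q.2.1.rep_nonzero, h⟩, _, h, rfl⟩

/-- The Fano threefold, times a plane and a projective representation, is birational to the bundle
of pairs of a decomposable bivector in the annihilator of the net and a vector incident with it. -/
theorem equivBirational_fanoX [Nontrivial V] (hρ : GmActsByScalars ext ρ)
    (hinv : ∀ g : Gt, ∀ ω ∈ LinearMap.range f, formRep ρ g ω ∈ LinearMap.range f)
    (hτ : Function.Injective τ) (hτs : GmActsByScalars ext τ)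
    (hτfree : GenericallyFree k (projAction ext hτs) Set.univ) :
    EquivBirational k
      (prodAction (projAction ext hρ.wedge)
        (prodAction (1 : G →* Equiv.Perm (ℙ k (Fin 3 → k))) (projAction ext hτs)))
      (fanoX f ×ˢ (Set.univ : Set (ℙ k (Fin 3 → k) × ℙ k W)))
      (prodAction (projAction ext hρ) (prodAction (projAction ext hρ.wedge)
        (prodAction (1 : G →* Equiv.Perm (ℙ k (Fin 2 → k))) (projAction ext hτs))))
      (flagSet (P := perp f) (Q := IncidenceSpace k V) (ℙ k (Fin 2 → k) × ℙ k W) (perpFamily f)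
        (perp f).subtype Set.univ) := by
  have : Infinite k := IsAlgClosed.instInfinite
  let Φ : ⋀[k]^2 V →ₗ[k] V →ₗ[k] IncidenceSpace k V := (incidence k V).flip
  have hLg : ∀ (g : Gt) (x : ⋀[k]^2 V), ∀ y ∈ (LinearMap.ker (Φ x)).map
      (LinearMap.id : V →ₗ[k] V), ρ g y ∈ (LinearMap.ker (Φ (wedgeRep ρ g x))).map
      (LinearMap.id : V →ₗ[k] V) := by
    rintro g x _ ⟨v, hv, rfl⟩
    exact ⟨ρ g v, incidence_wedgeRep ρ g hv, rfl⟩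
  have h1 := equivBirational_noName_ker (P := V) (Q := IncidenceSpace k V) hρ.wedge hρ hτs hτ hτfree
    (fanoX_stable hρ hinv)
    Φ (LinearMap.id : V →ₗ[k] V) Function.injective_id hLg (r := 2) (by norm_num)
    (fun m hm => by
      obtain ⟨-, v, w, h⟩ := (mem_fanoX_iff (isCoord_rep m)).1 hm
      have h0 := m.rep_nonzero
      rw [h] at h0 ⊢
      exact finrank_ker_incidence_flip h0)
  refine ((equivBirational_plane (fanoX_stable hρ hinv)).trans h1).trans
    (equivBirational_swap (fun q => ?_)
      (flagSet_stable (P := V) (Q := IncidenceSpace k V) hρ.wedge hρ hLg (fanoX_stable hρ hinv) _))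
  constructor
  · rintro ⟨hq, v, hv, hvq⟩
    obtain ⟨h2, -⟩ := (mem_fanoX_iff (isCoord_rep q.1)).1 hq
    refine ⟨trivial, ⟨q.1.rep, h2⟩, ?_, rfl⟩
    change incidence k V q.2.1.rep q.1.rep = 0
    rw [← hvq]
    exact hv
  · rintro ⟨-, x, hx, hxq⟩
    have h : incidence k V q.2.1.rep x = 0 := hx
    replace hxq : (x : ⋀[k]^2 V) = q.1.rep := hxq
    rw [hxq] at h
    obtain ⟨w, hw⟩ := (incidence_eq_zero_iff q.2.1.rep_nonzero _).1 h
    exact ⟨(mem_fanoX_iff (isCoord_rep q.1)).2 ⟨hxq ▸ x.2, _, w, hw⟩, _, h, rfl⟩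

/-- The bundles over `ℙ(V)` of degenerate forms and of decomposable bivectors are birational. -/
theorem equivBirational_bundles [FiniteDimensional k A] (hV : Module.finrank k V = 6)
    (hA : Module.finrank k A = 5)
    (hρ : GmActsByScalars ext ρ) (hf : Function.Injective f) (hreg : IsRegularNet f)
    (hinv : ∀ g : Gt, ∀ ω ∈ LinearMap.range f, formRep ρ g ω ∈ LinearMap.range f)
    (hτ : Function.Injective τ) (hτs : GmActsByScalars ext τ)
    (hτfree : GenericallyFree k (projAction ext hτs) Set.univ) :
    EquivBirational k
      (prodAction (projAction ext hρ) (prodAction (projAction ext hρ.form)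
        (prodAction (1 : G →* Equiv.Perm (ℙ k (Fin 2 → k))) (projAction ext hτs))))
      (flagSet (ℙ k (Fin 2 → k) × ℙ k W) (netBilin f).flip f Set.univ)
      (prodAction (projAction ext hρ) (prodAction (projAction ext hρ.wedge)
        (prodAction (1 : G →* Equiv.Perm (ℙ k (Fin 2 → k))) (projAction ext hτs))))
      (flagSet (P := perp f) (Q := IncidenceSpace k V) (ℙ k (Fin 2 → k) × ℙ k W) (perpFamily f)
        (perp f).subtype Set.univ) := by
  have := nontrivial_of_faithful hτ ext
  have : Nontrivial A := Module.nontrivial_of_finrank_pos (R := k) (by omega)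
  have : Nontrivial V := Module.nontrivial_of_finrank_pos (R := k) (by omega)
  have : Nontrivial (perp f) := Module.nontrivial_of_finrank_pos (R := k)
    (by have := le_finrank_perp f hV hA; omega)
  have : Nontrivial (SkewForm k V) := hf.nontrivial
  have : Nontrivial (⋀[k]^2 V) := (perp f).injective_subtype.nontrivial
  have hker : ∀ a ≠ 0, Module.finrank k (LinearMap.ker (netBilin f a)) ≤ 2 := fun a ha => by
    have h3 := skewRank_add_finrank_ker (f a)
    have h4 := hreg a ha
    change Module.finrank k (LinearMap.ker (skewBilin (f a))) ≤ 2
    omega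
  refine equivBirational_flagSet (P' := perp f) (Q' := IncidenceSpace k V) hρ hρ.form hρ.wedge hτs
    hτ hτfree hf ?_ (perp f).injective_subtype ?_
    (locallyFewEquations_flip (netBilin_self f) (by rw [hV, hA]))
    (locallyFewEquations_perpFamily f hV hA)
    (strataBound_flip (netBilin_self f) hV hA hker)
    fun v hv => (nullity_perpFamily f (by rw [hV, hA]) hv).symm
  · rintro g v _ ⟨a, ha, rfl⟩
    obtain ⟨a', ha'⟩ := hinv g (f a) ⟨a, rfl⟩
    refine ⟨a', ?_, ha'⟩
    change skewBilin (f a') (ρ g v) = 0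
    rw [ha']
    exact skewBilin_formRep_eq_zero ρ g ha
  · rintro g v _ ⟨x, hx, rfl⟩
    exact ⟨⟨_, wedgeRep_mem_perp ρ hinv g x.2⟩, incidence_wedgeRep ρ g hx, rfl⟩

end Main

end PfaffianGrassmannian

end

open PfaffianGrassmannian in
theorem proposition3p1
    {k : Type*} [Field k] [IsAlgClosed k] [CharZero k]
    {G Gt : Type*} [Group G] [Finite G] [Group Gt] (ext : GmExtension k G Gt)
    {V A W : Type*} [AddCommGroup V] [Module k V] [AddCommGroup A] [Module k A]
    [AddCommGroup W] [Module k W] [FiniteDimensional k W]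
    (hV : Module.finrank k V = 6) (hA : Module.finrank k A = 5)
    -- the faithful representation `V` of the central extension
    (ρ : Gt →* (V ≃ₗ[k] V)) (hρ : Function.Injective ρ) (hρs : GmActsByScalars ext ρ)
    (hρfree : GenericallyFree k (projAction ext hρs) Set.univ)
    -- the invariant regular net of skew forms
    (f : A →ₗ[k] SkewForm k V) (hf : Function.Injective f) (hreg : IsRegularNet f)
    (hinv : ∀ g : Gt, ∀ ω ∈ LinearMap.range f, formRep ρ g ω ∈ LinearMap.range f)
    (hfreeA : GenericallyFree k (projAction ext hρs.form) (projSub (LinearMap.range f)))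
    (hfreeP : GenericallyFree k (projAction ext hρs.wedge) (projSub (perp f)))
    -- the auxiliary faithful representation `W`
    (τ : Gt →* (W ≃ₗ[k] W)) (hτ : Function.Injective τ) (hτs : GmActsByScalars ext τ)
    (hτfree : GenericallyFree k (projAction ext hτs) Set.univ) :
    EquivBirational k
      (prodAction (projAction ext hρs.form)
        (prodAction (1 : G →* Equiv.Perm (ℙ k (Fin 3 → k))) (projAction ext hτs)))
      (cubicY f ×ˢ (Set.univ : Set (ℙ k (Fin 3 → k) × ℙ k W)))
      (prodAction (projAction ext hρs.wedge)
        (prodAction (1 : G →* Equiv.Perm (ℙ k (Fin 3 → k))) (projAction ext hτs)))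
      (fanoX f ×ˢ (Set.univ : Set (ℙ k (Fin 3 → k) × ℙ k W))) := by
  have : FiniteDimensional k V := Module.finite_of_finrank_pos (by omega)
  have : FiniteDimensional k A := Module.finite_of_finrank_pos (by omega)
  have : Nontrivial V := Module.nontrivial_of_finrank_pos (R := k) (by omega)
  -- The path goes up from the cubic to its bundle, across over `ℙ(V)`, and down to the Fano
  -- threefold.
  exact ((equivBirational_cubicY hV hρs hreg hinv hτ hτs hτfree).trans
    (equivBirational_bundles hV hA hρs hf hreg hinv hτ hτs hτfree)).trans
    (equivBirational_fanoX hρs hinv hτ hτs hτfree).symm
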